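/- For $n\ge 6$ let $OP_n$ be the CNF formula in the variables $P_{i,j}$ ($1\le i,j\le n$, $i\ne j$) with the clauses $\neg P_{i,j}\vee\neg P_{j,k}\vee P_{i,k}$ for distinct $i,j,k$, the clauses $\neg P_{i,j}\vee\neg P_{j,i}$ for $i\neq j$, and the clauses $\bigvee_{i\ne j}P_{i,j}$ for $1\le j\le n$. Let $C(j,k)$ be the disjunction of the first $k$ variables of column $j$, that is, of the sequence $P_{1,j},\dots,P_{n,j}$ without $P_{j,j}$. Consider the following CDCL solver. Derived literals are propagated in the order in which they were derived; each one is propagated to saturation (all unit literals of clauses made unit by it are derived) before the next; propagation goes on no further once some clause is falsified. When propagation is complete without a conflict, the solver branches on the unassigned variable of highest VSIDS score, ties being broken by the column-major order $P_{2,1},\dots,P_{n,1},P_{1,2},\dots,P_{n-1,n}$, and assigns it to false. The scores are initially $0$; after each conflict the score $q$ of every variable $x$ is replaced by $b+\delta q$, where $b=1$ if $x$ occurs in the clause learned from this conflict and $b=0$ otherwise; the decay factor satisfies $0<\delta\le 1/2$. When a clause is falsified after at least one decision (a conflict), the solver learns the 1UIP clause, in which false literals of all lower levels, including level $0$, are kept,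 and restarts; learned clauses are never deleted. When a clause is falsified without any decision, the solver answers UNSAT (this is not counted as a conflict). Then, whatever the order in which clauses are visited while a literal is propagated, and whichever falsified clause is used when there are several, the solver halts on $OP_n$ with the answer UNSAT after exactly $\binom n2-3=\frac{(n-3)(n+2)}2$ conflicts, a polynomial number in $n$. The clauses learned are, in this order: the $2$ Head clauses $C(1,n-2), C(1,n-3)$; the $\frac{n(n-3)}2$ Cascade clauses $C(j,n-2),C(j,n-3),\dots,C(j,j-1)$ for $j=n-2,n-3,\dots,2$; and the $n-5$ Tail clauses $C(1,n-4),\dots,C(1,2)$. -/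

import Mathlib

/-! ## Conflict-driven clause learning -/

namespace CDCL

/-- A literal is a variable with a polarity (`true` for the positive literal). -/
abbrev Literal (V : Type) : Type := V × Bool

/-- The complementary literal. -/
def neg {V : Type} (l : Literal V) : Literal V := (l.1, !l.2)

/-- A clause is a finite set of literals, read as their disjunction. -/
abbrev Clause (V : Type) : Type := Finset (Literal V)

/-- A formula in conjunctive normal form is a finite set of clauses. -/
abbrev CNF (V : Type) : Type := Finset (Clause V)

/-- One entry of the assignment trail: a literal made true, its decision level, and the clause
that implied it (`none` for a decision). -/
structure Entry (V : Type) where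
  lit : Literal V
  level : ℕ
  reason : Option (Clause V)

/-- A state of the solver. `learned` is the database of learned clauses, oldest first. The trail,
oldest first, is `processed ++ queue`: the literals of `processed` have been propagated, the head of
`queue` is the literal being propagated, the rest of `queue` waits to be propagated. `level` is the
current decision level, and `unsat` says that the solver has answered UNSAT. -/
structure State (V : Type) where
  learned : List (Clause V)
  processed : List (Entry V)
  queue : List (Entry V)
  level : ℕ
  unsat : Bool

/-- The state in which the solver has just (re)started with the learned clauses `Γ`: the trail is
empty. -/
def State.restart {V : Type} (Γ : List (Clause V)) : State V where
  learned := Γ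
  processed := []
  queue := []
  level := 0
  unsat := false

/-- The assignment trail, oldest entry first. -/
def State.trail {V : Type} (s : State V) : List (Entry V) := s.processed ++ s.queue

/-- The number of conflicts from which the solver has learned a clause and restarted. Every such
conflict adds exactly one clause to the database. -/
def State.numConflicts {V : Type} (s : State V) : ℕ := s.learned.length

/-- The variable `x` has a value. -/
def State.Assigned {V : Type} (s : State V) (x : V) : Prop := ∃ e ∈ s.trail, e.lit.1 = x

/-- The literal `l` is false. -/
def State.IsFalse {V : Type} (s : State V) (l : Literal V) : Prop := ∃ e ∈ s.trail, e.lit = neg l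

/-- All literals of `c` are false. -/
def State.Falsified {V : Type} (s : State V) (c : Clause V) : Prop := ∀ l ∈ c, s.IsFalse l

/-- The clause `c` is unit, with unit literal `l`: `l` is unassigned and all other literals of `c`
are false. -/
def State.IsUnit {V : Type} (s : State V) (c : Clause V) (l : Literal V) : Prop :=
  l ∈ c ∧ ¬ s.Assigned l.1 ∧ ∀ m ∈ c, m ≠ l → s.IsFalse m

/-- The clauses that the solver uses: those of the formula and the learned ones. -/
def State.Database {V : Type} (s : State V) (F : CNF V) (c : Clause V) : Prop :=
  c ∈ F ∨ c ∈ s.learned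

/-- The clauses that are visited for propagation in the state `s`: those that contain the negation
of the literal being propagated, and the clauses with a single literal. (Single-literal clauses
are thus propagated at level zero, before everything else.) -/
def State.Visited {V : Type} (s : State V) (c : Clause V) : Prop :=
  c.card = 1 ∨ ∃ e rest, s.queue = e :: rest ∧ neg e.lit ∈ c

/-- No clause is falsified, and no visited clause is unit: the literal being propagated (if any)
has been propagated to saturation, without a conflict. -/
def State.Saturated {V : Type} (s : State V) (F : CNF V) : Prop :=
  (∀ c, s.Database F c → ¬ s.Falsified c) ∧
    ∀ c l, s.Database F c → s.Visited c → ¬ s.IsUnit c l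

section Heuristics

variable {V : Type} [DecidableEq V]

/-- The variables of a clause. -/
def clauseVars (c : Clause V) : Finset V := c.image Prod.fst

/-- The variables of a formula. -/
def formulaVars (F : CNF V) : Finset V := F.biUnion clauseVars

/-- The VSIDS score of the variable `x` with decay factor `δ` after the clauses `Γ` have been
learned (oldest first): all scores start at `0`, and at each conflict the score `q` of `x` becomes
`b + δ * q`, where `b` is `1` if `x` occurs in the clause learned from that conflict and `0`
otherwise. -/
noncomputable def score (δ : ℝ) (Γ : List (Clause V)) (x : V) : ℝ :=
  Γ.foldl (fun q c => (if x ∈ clauseVars c then 1 else 0) + δ * q) 0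

/-- `x` is the unassigned variable of `F` on which the solver branches: it has the highest VSIDS
score among the unassigned variables, and it comes first in the order `before` among those with
that score. -/
def State.BranchVar (s : State V) (F : CNF V) (before : V → V → Prop) (δ : ℝ) (x : V) : Prop :=
  x ∈ formulaVars F ∧ ¬ s.Assigned x ∧
    ∀ y ∈ formulaVars F, ¬ s.Assigned y → y ≠ x →
      score δ s.learned y < score δ s.learned x ∨
        (score δ s.learned y = score δ s.learned x ∧ before x y)

/-- The literals of `c` that were made false at decision level `lvl` of the trail `tr`. -/
def literalsAtLevel (tr : List (Entry V)) (lvl : ℕ) (c : Clause V) : Clause V :=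
  c.filter (fun l => ∃ e ∈ tr, e.lit = neg l ∧ e.level = lvl)

/-- The loop of 1UIP conflict analysis: run through the entries of the trail `tr`, newest first
(third argument), and resolve the current clause with the reason of each entry whose literal occurs
negated in it, until the current clause has just one literal of the level `lvl`. Literals of lower
levels, level zero included, stay in the clause. -/
def analyzeAux (tr : List (Entry V)) (lvl : ℕ) : List (Entry V) → Clause V → Clause V
  | [], c => c
  | e :: es, c =>
    if (literalsAtLevel tr lvl c).card ≤ 1 then c
    else if neg e.lit ∈ c then
      match e.reason with
      | some r => analyzeAux tr lvl es (c.erase (neg e.lit) ∪ r.erase e.lit)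
      | none => c
    else analyzeAux tr lvl es c

/-- The 1UIP clause learned in state `s` from the falsified clause `c`. -/
def State.analyze (s : State V) (c : Clause V) : Clause V :=
  analyzeAux s.trail s.level s.trail.reverse c

/-- One step of the solver on the formula `F`, with tie-breaking order `before` and VSIDS decay
factor `δ`. The literals of the trail are propagated in the order in which they were derived, each
one to saturation before the next; the order in which the clauses are visited during the
propagation of one literal, and the choice among several falsified clauses, are left open, so that
a run of the solver for any fixed choice is a run of this relation. -/
inductive Step (F : CNF V) (before : V → V → Prop) (δ : ℝ) : State V → State V → Prop
  /-- A visited clause is unit: its unit literal is implied, and queued for propagation. -/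
  | imply (s : State V) (c : Clause V) (l : Literal V) (hs : s.unsat = false)
      (hc : s.Database F c) (hv : s.Visited c) (hu : s.IsUnit c l) :
      Step F before δ s { s with queue := s.queue ++ [⟨l, s.level, some c⟩] }
  /-- The literal being propagated is saturated and there is no conflict: go on to the next one. -/
  | advance (s : State V) (e : Entry V) (rest : List (Entry V)) (hs : s.unsat = false)
      (hq : s.queue = e :: rest) (hsat : s.Saturated F) :
      Step F before δ s { s with processed := s.processed ++ [e], queue := rest }
  /-- Unit propagation is complete and there is no conflict: branch, and assign the variable to
  false. -/
  | decide (s : State V) (x : V) (hs : s.unsat = false) (hq : s.queue = [])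
      (hsat : s.Saturated F) (hx : s.BranchVar F before δ x) :
      Step F before δ s
        { s with queue := [⟨(x, false), s.level + 1, none⟩], level := s.level + 1 }
  /-- A clause is falsified after at least one decision: learn the 1UIP clause and restart. -/
  | learn (s : State V) (c : Clause V) (hs : s.unsat = false) (hl : 0 < s.level)
      (hc : s.Database F c) (hf : s.Falsified c) :
      Step F before δ s (State.restart (s.learned ++ [s.analyze c]))
  /-- A clause is falsified without any decision: answer UNSAT. -/
  | refute (s : State V) (c : Clause V) (hs : s.unsat = false) (hl : s.level = 0)
      (hc : s.Database F c) (hf : s.Falsified c) :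
      Step F before δ s { s with unsat := true }

end Heuristics

end CDCL

/-! ## The ordering principle -/

namespace OrderingPrinciple

open CDCL

/-- The positive literal of the variable `P i j`, which is encoded as the pair `(i, j)`
(row `i`, column `j`, both counted from `1`). -/
def pos (i j : ℕ) : Literal (ℕ × ℕ) := ((i, j), true)

/-- The negative literal of the variable `P i j`. -/
def negP (i j : ℕ) : Literal (ℕ × ℕ) := ((i, j), false)

/-- The transitivity clauses. -/
def transitivity (n : ℕ) : CNF (ℕ × ℕ) :=
  ((Finset.Icc 1 n ×ˢ Finset.Icc 1 n ×ˢ Finset.Icc 1 n).filter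
      (fun t => t.1 ≠ t.2.1 ∧ t.2.2 ≠ t.1 ∧ t.2.1 ≠ t.2.2)).image
    (fun t => {negP t.1 t.2.1, negP t.2.1 t.2.2, pos t.1 t.2.2})

/-- The antisymmetry clauses. -/
def antisymmetry (n : ℕ) : CNF (ℕ × ℕ) :=
  ((Finset.Icc 1 n ×ˢ Finset.Icc 1 n).filter (fun t => t.1 ≠ t.2)).image
    (fun t => {negP t.1 t.2, negP t.2 t.1})

/-- The non-minimality clauses. -/
def nonMinimality (n : ℕ) : CNF (ℕ × ℕ) :=
  (Finset.Icc 1 n).image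
    (fun j => ((Finset.Icc 1 n).filter (fun i => i ≠ j)).image (fun i => pos i j))

/-- The ordering principle formula on `n` elements. -/
def formula (n : ℕ) : CNF (ℕ × ℕ) := transitivity n ∪ antisymmetry n ∪ nonMinimality n

/-- The column-major order of the variables. -/
def columnMajor (x y : ℕ × ℕ) : Prop := x.2 < y.2 ∨ (x.2 = y.2 ∧ x.1 < y.1)

/-- The prefix clause `C(j, k)`: the disjunction of the first `k` variables of column `j`. -/
def prefixClause (n j k : ℕ) : Clause (ℕ × ℕ) :=
  ((((List.range' 1 n).filter (fun i => i ≠ j)).take k).map (fun i => pos i j)).toFinset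

/-- `C(1, n - 2), C(1, n - 3)`. -/
def headClauses (n : ℕ) : List (Clause (ℕ × ℕ)) :=
  [prefixClause n 1 (n - 2), prefixClause n 1 (n - 3)]

/-- For `j` from `n - 2` down to `2`, the clauses `C(j, k)` for `k` from `n - 2` down to `j - 1`. -/
def cascadeClauses (n : ℕ) : List (Clause (ℕ × ℕ)) :=
  (List.range' 2 (n - 3)).reverse.flatMap
    (fun j => (List.range' (j - 1) (n - j)).reverse.map (fun k => prefixClause n j k))

/-- The clauses `C(1, k)` for `k` from `n - 4` down to `2`. -/
def tailClauses (n : ℕ) : List (Clause (ℕ × ℕ)) :=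
  (List.range' 2 (n - 5)).reverse.map (fun k => prefixClause n 1 k)

/-- One step of the solver on the ordering principle formula, with ties broken in column-major
order. -/
def SolverStep (n : ℕ) (δ : ℝ) : State (ℕ × ℕ) → State (ℕ × ℕ) → Prop :=
  Step (formula n) columnMajor δ

end OrderingPrinciple

/-! ## Inevitability -/

/-! The whole run repeats one derivation. Let `C(j, k)` be available with `j ≤ k`, so that its rows
are `1, …, k + 1` without `j`, and let the rows of column `j` up to `k` be false. Then `P (k+1) j`
is implied. Antisymmetry falsifies `P j (k+1)`, and transitivity falsifies the other `P i (k+1)`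
with `i ≤ k`, because `P i j` is false; so `C(k+1, k)` is falsified. Resolving back through these
entries and through `P (k+1) j` gives `C(j, k-1)`. Until then the clause has two literals of the
last level. In `C(j, k-1)` there is one, the row falsified last, so this is the 1UIP clause
(`analyzeAux_block`, `Phase.ends_of_conflict`).

The clause `C(k+1, k)` is there when it is needed: for `k + 1 = n` it is a clause of the formula,
and for `k + 1 ≤ n - 2` it is the last Cascade clause of a column treated earlier. Nothing is ever
learned in column `n - 1`. For `k + 1 = n - 1` this column instead forces `P n (n-1)`, which
falsifies column `n`, and the analysis performs the derivation twice (`Phase.ends_of_last`).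

Since `δ ≤ 1/2`, a fresh occurrence in a learned clause outweighs all older ones together. Prefix
clauses of one column are nested, so the solver falsifies the column of the latest learned clauses
from the top down (`branchOrder_of_column`). When a new column `j` is due, this is still another
column `q`: column 1 for `j = n - 2`, column `j + 1` in the rest of the Cascade, column 2 at the
start of the Tail. There `P j q` becomes true, and from then on every decision `¬P a q` implies `¬P
a j` by transitivity, so column `j` is falsified nevertheless. In the Tail, `P 1 2` is true at level
0 because `C(2, 1)` is a single literal; with `C(1, 2)` learned, the conflict itself arises at level
0.

Independence of the order of propagation is built into `Inevitable`. For each literal being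
propagated, an invariant of the queue is given that every possible implication preserves
(`inevitable_of_head`). `Phase` describes the available clauses before one conflict;
`Phase.ends_of_restart`, `Phase.ends_of_restart_true` and `Phase.ends_of_restart_single` treat the
ways of reaching it, and the phases are chained backwards from the answer UNSAT. -/

/-- Every maximal `R`-path from the given point reaches, after finitely many steps, a point
with the property `P`. -/
inductive Inevitable {α : Type} (R : α → α → Prop) (P : α → Prop) : α → Prop
  | now (a : α) (h : P a) : Inevitable R P a
  | later (a : α) (hex : ∃ b, R a b) (hall : ∀ b, R a b → Inevitable R P b) : Inevitable R P a

namespace Inevitable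

variable {α : Type} {R : α → α → Prop} {P : α → Prop}

/-- An inductive proof of `Inevitable` is a well-founded tree of runs. An infinite run would descend
in it forever, since it cannot pass through a point with `P`. -/
theorem no_infinite_run (hP : ∀ a, P a → ∀ b, ¬ R a b) {a : α} (h : Inevitable R P a) :
    ¬ ∃ run : ℕ → α, run 0 = a ∧ ∀ t, R (run t) (run (t + 1)) := by
  induction h with
  | now a h =>
    rintro ⟨run, h0, hr⟩
    exact hP a h _ (h0 ▸ hr 0)
  | later a _ _ ih =>
    rintro ⟨run, h0, hr⟩
    exact ih (run 1) (h0 ▸ hr 0) ⟨fun t => run (t + 1), rfl, fun t => hr (t + 1)⟩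

/-- A point reached before `P` holds has a successor, by the second constructor, so a run can get
stuck only where `P` holds. -/
theorem of_stuck (hP : ∀ a, P a → ∀ b, ¬ R a b) {a b : α} (h : Inevitable R P a)
    (hab : Relation.ReflTransGen R a b) (hb : ∀ c, ¬ R b c) : P b := by
  induction h with
  | now a h =>
    rcases Relation.ReflTransGen.cases_head hab with rfl | ⟨c, hc, _⟩
    · exact h
    · exact absurd hc (hP a h c)
  | later a hex _ ih =>
    rcases Relation.ReflTransGen.cases_head hab with rfl | ⟨c, hc, hcb⟩
    · obtain ⟨c, hc⟩ := hex
      exact absurd hc (hb c)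
    · exact ih c hc hcb

end Inevitable

/-! ### Propagation, branching and restarting for an arbitrary formula. -/

namespace CDCL

variable {V : Type}

/-- The literal `l` is on the list `L` of trail entries. -/
def Has (L : List (Entry V)) (l : Literal V) : Prop := ∃ e ∈ L, e.lit = l

theorem has_append {L M : List (Entry V)} {l : Literal V} :
    Has (L ++ M) l ↔ Has L l ∨ Has M l := by
  simp [Has, or_and_right, exists_or]

theorem has_cons {e : Entry V} {M : List (Entry V)} {l : Literal V} :
    Has (e :: M) l ↔ e.lit = l ∨ Has M l := by
  simp [Has]

theorem has_nil {l : Literal V} : ¬ Has ([] : List (Entry V)) l := by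
  simp [Has]

theorem State.assigned_iff {s : State V} {l : Literal V} :
    s.Assigned l.1 ↔ Has s.trail l ∨ Has s.trail (neg l) := by
  obtain ⟨x, b⟩ := l
  constructor
  · rintro ⟨e, he, rfl⟩
    by_cases hb : e.lit.2 = b
    · exact Or.inl ⟨e, he, by rw [← hb]⟩
    · refine Or.inr ⟨e, he, ?_⟩
      have : e.lit.2 = !b := by
        cases h : e.lit.2 <;> cases b <;> simp_all
      simp [neg, ← this]
  · rintro (⟨e, he, h⟩ | ⟨e, he, h⟩) <;> exact ⟨e, he, by simp [h, neg]⟩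

/-- The unit literal of a visited clause of a saturated state is assigned. -/
theorem State.Saturated.assigned {F : CNF V} {s : State V} (hs : s.Saturated F) {c : Clause V}
    {l : Literal V} (hc : s.Database F c) (hv : s.Visited c) (hl : l ∈ c)
    (h : ∀ m ∈ c, m ≠ l → Has s.trail (neg m)) : Has s.trail l ∨ Has s.trail (neg l) := by
  by_contra hn
  exact hs.2 c l hc hv ⟨hl, fun ha => hn (s.assigned_iff.1 ha), h⟩

section

variable [DecidableEq V] {F : CNF V} {before : V → V → Prop} {δ : ℝ} {P : State V → Prop}

/-- Propagation of the literal at the head of the queue. The property `I` describes the entries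
queued behind it. -/
theorem inevitable_of_head {Γ : List (Clause V)} {pr : List (Entry V)} {e : Entry V} {lvl : ℕ}
    (I : List (Entry V) → Prop)
    (hvars : ∀ c ∈ Γ, clauseVars c ⊆ formulaVars F)
    (himply : ∀ qu c l, I qu → (State.mk Γ pr (e :: qu) lvl false).Database F c →
      (State.mk Γ pr (e :: qu) lvl false).Visited c →
      (State.mk Γ pr (e :: qu) lvl false).IsUnit c l → I (qu ++ [⟨l, lvl, some c⟩]))
    (hfalse : ∀ qu c, I qu → (State.mk Γ pr (e :: qu) lvl false).Database F c →
      (State.mk Γ pr (e :: qu) lvl false).Falsified c →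
      (0 < lvl → Inevitable (Step F before δ) P
        (State.restart (Γ ++ [(State.mk Γ pr (e :: qu) lvl false).analyze c]))) ∧
      (lvl = 0 → Inevitable (Step F before δ) P (State.mk Γ pr (e :: qu) lvl true)))
    (hadvance : ∀ qu, I qu → (State.mk Γ pr (e :: qu) lvl false).Saturated F →
      Inevitable (Step F before δ) P (State.mk Γ (pr ++ [e]) qu lvl false))
    (qu : List (Entry V)) (hqu : I qu) :
    Inevitable (Step F before δ) P (State.mk Γ pr (e :: qu) lvl false) := by
  classical
  -- Every implication assigns a variable of the formula, so the number of unassigned variables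
  -- bounds the propagation.
  induction hN : ((formulaVars F).filter
    (fun x => ¬ (State.mk Γ pr (e :: qu) lvl false).Assigned x)).card using Nat.strong_induction_on
    generalizing qu with
  | _ N ih =>
  refine Inevitable.later _ ?_ ?_
  · by_cases hf : ∃ c, (State.mk Γ pr (e :: qu) lvl false).Database F c ∧
      (State.mk Γ pr (e :: qu) lvl false).Falsified c
    · obtain ⟨c, hc, hcf⟩ := hf
      rcases Nat.eq_zero_or_pos lvl with h0 | h0
      · exact ⟨_, Step.refute _ c rfl h0 hc hcf⟩
      · exact ⟨_, Step.learn _ c rfl h0 hc hcf⟩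
    · by_cases hu : ∃ c l, (State.mk Γ pr (e :: qu) lvl false).Database F c ∧
        (State.mk Γ pr (e :: qu) lvl false).Visited c ∧
        (State.mk Γ pr (e :: qu) lvl false).IsUnit c l
      · obtain ⟨c, l, hc, hv, hcl⟩ := hu
        exact ⟨_, Step.imply _ c l rfl hc hv hcl⟩
      · refine ⟨_, Step.advance _ e qu rfl rfl ⟨fun c hc hcf => hf ⟨c, hc, hcf⟩,
          fun c l hc hv hcl => hu ⟨c, l, hc, hv, hcl⟩⟩⟩
  · intro b hb
    cases hb with
    | imply c l hs hc hv hu =>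
      refine ih _ ?_ (qu ++ [⟨l, lvl, some c⟩]) (himply qu c l hqu hc hv hu) rfl
      rw [← hN]
      apply Finset.card_lt_card
      rw [Finset.ssubset_iff_of_subset]
      · refine ⟨l.1, ?_, ?_⟩
        · refine Finset.mem_filter.2 ⟨?_, hu.2.1⟩
          have hcv : clauseVars c ⊆ formulaVars F := by
            rcases hc with hc | hc
            · exact Finset.subset_biUnion_of_mem clauseVars hc
            · exact hvars c hc
          exact hcv (Finset.mem_image_of_mem _ hu.1)
        · simp only [Finset.mem_filter, not_and, not_not]
          exact fun _ => ⟨⟨l, lvl, some c⟩, by simp [State.trail], rfl⟩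
      · intro x hx
        rw [Finset.mem_filter] at hx ⊢
        refine ⟨hx.1, fun ⟨e', he', h⟩ => hx.2 ⟨e', ?_, h⟩⟩
        simp only [State.trail, List.mem_append, List.mem_cons] at he' ⊢
        tauto
    | advance e' rest hs hq hsat =>
      obtain ⟨rfl, rfl⟩ := List.cons.inj hq
      exact hadvance _ hqu hsat
    | decide x hs hq hsat hx => cases hq
    | learn c hs hl hc hf => exact (hfalse qu c hqu hc hf).1 hl
    | refute c hs hl hc hf => exact (hfalse qu c hqu hc hf).2 hl

/-- Propagation of the literal at the head of the queue, when it does not lead to a conflict. -/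
theorem inevitable_of_quiet {Γ : List (Clause V)} {pr : List (Entry V)} {e : Entry V} {lvl : ℕ}
    (I : List (Entry V) → Prop)
    (hvars : ∀ c ∈ Γ, clauseVars c ⊆ formulaVars F)
    (himply : ∀ qu c l, I qu → (State.mk Γ pr (e :: qu) lvl false).Database F c →
      (State.mk Γ pr (e :: qu) lvl false).Visited c →
      (State.mk Γ pr (e :: qu) lvl false).IsUnit c l → I (qu ++ [⟨l, lvl, some c⟩]))
    (hfalse : ∀ qu c, I qu → (State.mk Γ pr (e :: qu) lvl false).Database F c →
      ¬ (State.mk Γ pr (e :: qu) lvl false).Falsified c)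
    (hadvance : ∀ qu, I qu → (State.mk Γ pr (e :: qu) lvl false).Saturated F →
      Inevitable (Step F before δ) P (State.mk Γ (pr ++ [e]) qu lvl false))
    (qu : List (Entry V)) (hqu : I qu) :
    Inevitable (Step F before δ) P (State.mk Γ pr (e :: qu) lvl false) :=
  inevitable_of_head I hvars himply (fun qu c h hc hf => absurd hf (hfalse qu c h hc)) hadvance
    qu hqu

/-- Branching in a state without conflict in which propagation is complete. -/
theorem inevitable_of_decide {Γ : List (Clause V)} {pr : List (Entry V)} {lvl : ℕ} {x : V}
    (hbefore : ∀ x y, before x y → ¬ before y x)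
    (hsat : (State.mk Γ pr [] lvl false).Saturated F)
    (hx : (State.mk Γ pr [] lvl false).BranchVar F before δ x)
    (hnext : Inevitable (Step F before δ) P
      (State.mk Γ pr [⟨(x, false), lvl + 1, none⟩] (lvl + 1) false)) :
    Inevitable (Step F before δ) P (State.mk Γ pr [] lvl false) := by
  refine Inevitable.later _ ⟨_, Step.decide _ x rfl rfl hsat hx⟩ ?_
  intro b hb
  cases hb with
  | imply c l hs hc hv hu => exact absurd hu (hsat.2 c l hc hv)
  | advance e' rest hs hq hsat => cases hq
  | decide y hs hq hsat hy =>
    -- If they differed, each of `x` and `y` would be strictly preferred to the other.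
    have : y = x := by
      by_contra hne
      have h1 := hx.2.2 y hy.1 hy.2.1 hne
      have h2 := hy.2.2 x hx.1 hx.2.1 (Ne.symm hne)
      rcases h1 with h1 | h1 <;> rcases h2 with h2 | h2
      · exact lt_asymm h1 h2
      · exact h1.ne h2.1.symm
      · exact h2.ne h1.1.symm
      · exact hbefore _ _ h1.2 h2.2
    subst this
    exact hnext
  | learn c hs hl hc hf => exact absurd hf (hsat.1 c hc)
  | refute c hs hl hc hf => exact absurd hf (hsat.1 c hc)

/-- A restarted solver with a single-literal clause. -/
theorem inevitable_of_single {Γ : List (Clause V)} {d : Clause V}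
    (hd : d ∈ F ∨ d ∈ Γ) {l : Literal V} (hl : d = {l})
    (hF : ∀ c, (c ∈ F ∨ c ∈ Γ) → c.Nonempty)
    (huniq : ∀ c, (c ∈ F ∨ c ∈ Γ) → c.card = 1 → c = d)
    (hnext : Inevitable (Step F before δ) P (State.mk Γ [] [⟨l, 0, some d⟩] 0 false)) :
    Inevitable (Step F before δ) P (State.restart Γ) := by
  have hfal : ∀ c, (State.restart Γ).Database F c → ¬ (State.restart Γ).Falsified c := by
    intro c hc hf
    obtain ⟨m, hm⟩ := hF c hc
    obtain ⟨e, he, -⟩ := hf m hm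
    simp [State.restart, State.trail] at he
  have hu : (State.restart Γ).IsUnit d l := by
    subst hl
    refine ⟨by simp, ?_, by simp⟩
    simp [State.Assigned, State.trail, State.restart]
  have hv : (State.restart Γ).Visited d := Or.inl (by simp [hl])
  refine Inevitable.later _ ⟨_, Step.imply _ d l rfl hd hv hu⟩ ?_
  intro b hb
  cases hb with
  | imply c m hs hc hv hu' =>
    have hcd : c = d := by
      refine huniq c hc ?_
      rcases hv with hv | ⟨e, rest, hq, -⟩
      · exact hv
      · cases hq
    subst hcd
    have : m = l := by simpa [hl] using hu'.1
    subst this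
    exact hnext
  | advance e' rest hs hq hsat => cases hq
  | decide x hs hq hsat hx => exact absurd hu (hsat.2 d l hd hv)
  | learn c hs hl hc hf => exact absurd hf (hfal c hc)
  | refute c hs hl hc hf => exact absurd hf (hfal c hc)

/-- A state in which UNSAT has been answered has no successor. -/
theorem not_step_of_unsat {s t : State V} (h : s.unsat = true) : ¬ Step F before δ s t := by
  intro hs
  cases hs <;> simp_all

/-! ### VSIDS scores. -/

theorem score_append_singleton (Γ : List (Clause V)) (c : Clause V) (x : V) :
    score δ (Γ ++ [c]) x = (if x ∈ clauseVars c then 1 else 0) + δ * score δ Γ x := by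
  simp [score]

theorem score_nonneg (hδ₀ : 0 < δ) (Γ : List (Clause V)) (x : V) : 0 ≤ score δ Γ x := by
  induction Γ using List.reverseRecOn with
  | nil => simp [score]
  | append_singleton Γ c ih =>
    rw [score_append_singleton]
    have := mul_nonneg hδ₀.le ih
    split_ifs <;> linarith

/-- The bound reproduces itself: if `δ q < 1`, then `δ (1 + δ q) < 2 δ ≤ 1`. Here the assumption `δ
≤ 1/2` is needed. -/
theorem mul_score_lt_one (hδ₀ : 0 < δ) (hδ : δ ≤ 1 / 2) (Γ : List (Clause V)) (x : V) :
    δ * score δ Γ x < 1 := by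
  induction Γ using List.reverseRecOn with
  | nil => simp [score]
  | append_singleton Γ c ih =>
    rw [score_append_singleton]
    split_ifs <;> nlinarith

/-- The score is monotone in the set of learned clauses in which the variable occurs. -/
theorem score_mono (hδ₀ : 0 < δ) (Γ : List (Clause V)) {x y : V}
    (h : ∀ c ∈ Γ, y ∈ clauseVars c → x ∈ clauseVars c) : score δ Γ y ≤ score δ Γ x := by
  induction Γ using List.reverseRecOn with
  | nil => simp [score]
  | append_singleton Γ c ih =>
    rw [score_append_singleton, score_append_singleton]
    have h1 := mul_le_mul_of_nonneg_left (ih fun d hd => h d (by simp [hd])) hδ₀.le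
    have h2 := h c (by simp)
    by_cases hy : y ∈ clauseVars c
    · simpa [hy, h2 hy] using h1
    · split_ifs <;> linarith

/-- A variable of a learned clause has a higher score than the variables that occur neither in this
clause nor in the clauses learned later. -/
theorem score_lt_of_later (hδ₀ : 0 < δ) (hδ : δ ≤ 1 / 2) (Γ Δ : List (Clause V)) (c : Clause V)
    {x y : V} (hx : x ∈ clauseVars c) (hy : y ∉ clauseVars c)
    (hΔ : ∀ d ∈ Δ, y ∉ clauseVars d) : score δ (Γ ++ c :: Δ) y < score δ (Γ ++ c :: Δ) x := by
  induction Δ using List.reverseRecOn with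
  | nil =>
    rw [score_append_singleton, score_append_singleton, if_pos hx, if_neg hy]
    -- The summand 1 that `x` has just received exceeds what `y` keeps after discounting.
    have := mul_score_lt_one hδ₀ hδ Γ y
    have := mul_nonneg hδ₀.le (score_nonneg hδ₀ Γ x)
    linarith
  | append_singleton Δ d ih =>
    have h := ih fun e he => hΔ e (by simp [he])
    rw [show Γ ++ c :: (Δ ++ [d]) = (Γ ++ c :: Δ) ++ [d] by simp, score_append_singleton,
      score_append_singleton, if_neg (hΔ d (by simp))]
    have := mul_lt_mul_of_pos_left h hδ₀
    split_ifs <;> linarith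

end

end CDCL

namespace OrderingPrinciple

open CDCL

/-! ## The clauses of the ordering principle -/

/-- The rows of the variables of the prefix clause `C(b, m)`. -/
def InRow (b m i : ℕ) : Prop := 1 ≤ i ∧ i ≠ b ∧ (i ≤ m ∨ (i = m + 1 ∧ b ≤ m))

/-- A single transitivity clause. -/
def transClause (a b d : ℕ) : Clause (ℕ × ℕ) := {negP a b, negP b d, pos a d}

/-- A single antisymmetry clause. -/
def antiClause (a b : ℕ) : Clause (ℕ × ℕ) := {negP a b, negP b a}

@[simp] theorem neg_pos (i j : ℕ) : neg (pos i j) = negP i j := rfl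

@[simp] theorem neg_negP (i j : ℕ) : neg (negP i j) = pos i j := rfl

@[simp] theorem pos_inj {i j a b : ℕ} : pos i j = pos a b ↔ i = a ∧ j = b := by simp [pos]

@[simp] theorem negP_inj {i j a b : ℕ} : negP i j = negP a b ↔ i = a ∧ j = b := by simp [negP]

@[simp] theorem pos_ne_negP {i j a b : ℕ} : pos i j ≠ negP a b := by simp [pos, negP]

@[simp] theorem negP_ne_pos {i j a b : ℕ} : negP i j ≠ pos a b := by simp [pos, negP]

theorem antiClause_comm (a b : ℕ) : antiClause a b = antiClause b a := Finset.pair_comm _ _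

theorem mem_transClause {a b d : ℕ} {l : Literal (ℕ × ℕ)} :
    l ∈ transClause a b d ↔ l = negP a b ∨ l = negP b d ∨ l = pos a d := by
  simp [transClause]

theorem mem_antiClause {a b : ℕ} {l : Literal (ℕ × ℕ)} :
    l ∈ antiClause a b ↔ l = negP a b ∨ l = negP b a := by
  simp [antiClause]

theorem filter_range'_ne {n b : ℕ} (hb : 1 ≤ b) (hbn : b ≤ n) :
    (List.range' 1 n).filter (fun i => i ≠ b) =
      List.range' 1 (b - 1) ++ List.range' (b + 1) (n - b) := by
  have h : List.range' 1 n = List.range' 1 (b - 1) ++ b :: List.range' (b + 1) (n - b) := by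
    rw [show b :: List.range' (b + 1) (n - b) = List.range' b (n - b + 1) from
      (List.range'_succ (s := b) (n := n - b) (step := 1)).symm]
    have := List.range'_append_1 (s := 1) (m := b - 1) (n := n - b + 1)
    rw [show 1 + (b - 1) = b by omega, show b - 1 + (n - b + 1) = n by omega] at this
    exact this.symm
  rw [h, List.filter_append, List.filter_cons]
  simp only [ne_eq, not_true_eq_false, decide_false, Bool.false_eq_true, if_false]
  congr 1
  · refine List.filter_eq_self.2 fun i hi => ?_
    rw [List.mem_range'_1] at hi
    simp only [decide_eq_true_eq]
    omega
  · refine List.filter_eq_self.2 fun i hi => ?_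
    rw [List.mem_range'_1] at hi
    simp only [decide_eq_true_eq]
    omega

/-- The missing row `b` shifts a prefix that passes it: if `b ≤ m`, the prefix reaches row `m + 1`,
otherwise it ends at row `m`. The bound on `m` keeps row `m + 1` within `n`. -/
theorem mem_prefixClause {n b m : ℕ} (hb : 1 ≤ b) (hbn : b ≤ n) (hm : m ≤ n - 1)
    {l : Literal (ℕ × ℕ)} : l ∈ prefixClause n b m ↔ ∃ i, InRow b m i ∧ l = pos i b := by
  have key : ∀ i, i ∈ ((List.range' 1 n).filter (fun i => i ≠ b)).take m ↔ InRow b m i := by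
    intro i
    rw [filter_range'_ne hb hbn, List.take_append, List.mem_append, List.length_range']
    rcases le_total m (b - 1) with h | h
    · rw [List.take_range'_of_length_ge h, show m - (b - 1) = 0 by omega, List.take_zero,
        List.mem_range'_1]
      simp only [List.not_mem_nil, or_false, InRow]
      omega
    · rw [List.take_range'_of_length_le h, List.take_range'_of_length_ge (by omega),
        List.mem_range'_1, List.mem_range'_1]
      simp only [InRow]
      omega
  simp only [prefixClause, List.mem_toFinset, List.mem_map, key]
  exact ⟨fun ⟨i, h, h'⟩ => ⟨i, h, h'.symm⟩, fun ⟨i, h, h'⟩ => ⟨i, h, h'.symm⟩⟩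

/-- The non-minimality clause of column `b` is read as the prefix clause `C(b, n-1)`, so that it can
be treated together with the learned clauses. -/
theorem mem_formula_iff {n : ℕ} {c : Clause (ℕ × ℕ)} : c ∈ formula n ↔
    (∃ a b d, (1 ≤ a ∧ a ≤ n) ∧ (1 ≤ b ∧ b ≤ n) ∧ (1 ≤ d ∧ d ≤ n) ∧
      (a ≠ b ∧ d ≠ a ∧ b ≠ d) ∧ c = transClause a b d) ∨
    (∃ a b, (1 ≤ a ∧ a ≤ n) ∧ (1 ≤ b ∧ b ≤ n) ∧ a ≠ b ∧ c = antiClause a b) ∨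
    ∃ b, (1 ≤ b ∧ b ≤ n) ∧ c = prefixClause n b (n - 1) := by
  have hcol : ∀ b, 1 ≤ b ∧ b ≤ n →
      ((Finset.Icc 1 n).filter (fun i => i ≠ b)).image (fun i => pos i b) =
        prefixClause n b (n - 1) := by
    rintro b ⟨h1, h2⟩
    ext l
    rw [mem_prefixClause h1 h2 le_rfl]
    simp only [Finset.mem_image, Finset.mem_filter, Finset.mem_Icc, InRow]
    constructor
    · rintro ⟨i, h, rfl⟩
      exact ⟨i, by omega, rfl⟩
    · rintro ⟨i, h, rfl⟩
      exact ⟨i, by omega, rfl⟩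
  simp only [formula, transitivity, antisymmetry, nonMinimality, Finset.mem_union,
    Finset.mem_image, Finset.mem_filter, Finset.mem_product, Finset.mem_Icc, Prod.exists, or_assoc]
  refine or_congr ?_ (or_congr ?_ ?_)
  · constructor
    · rintro ⟨a, b, d, ⟨⟨h1, h2, h3⟩, h4⟩, rfl⟩
      exact ⟨a, b, d, h1, h2, h3, h4, rfl⟩
    · rintro ⟨a, b, d, h1, h2, h3, h4, rfl⟩
      exact ⟨a, b, d, ⟨⟨h1, h2, h3⟩, h4⟩, rfl⟩
  · constructor
    · rintro ⟨a, b, ⟨⟨h1, h2⟩, h3⟩, rfl⟩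
      exact ⟨a, b, h1, h2, h3, rfl⟩
    · rintro ⟨a, b, h1, h2, h3, rfl⟩
      exact ⟨a, b, ⟨⟨h1, h2⟩, h3⟩, rfl⟩
  · constructor
    · rintro ⟨b, h, rfl⟩
      exact ⟨b, h, hcol b h⟩
    · rintro ⟨b, h, rfl⟩
      exact ⟨b, h, hcol b h⟩

/-- The prefix clause `C(b, m)` is a clause of the formula or has been learned. -/
def Avail (n : ℕ) (Γ : List (Clause (ℕ × ℕ))) (b m : ℕ) : Prop :=
  (1 ≤ b ∧ b ≤ n) ∧ m ≤ n - 1 ∧ (m = n - 1 ∨ prefixClause n b m ∈ Γ)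

/-- All learned clauses are prefix clauses. -/
def AllPrefix (n : ℕ) (Γ : List (Clause (ℕ × ℕ))) : Prop :=
  ∀ c ∈ Γ, ∃ b m, Avail n Γ b m ∧ c = prefixClause n b m

theorem mem_formulaVars {n : ℕ} {x : ℕ × ℕ} : x ∈ formulaVars (formula n) ↔
    (1 ≤ x.1 ∧ x.1 ≤ n) ∧ (1 ≤ x.2 ∧ x.2 ≤ n) ∧ x.1 ≠ x.2 := by
  obtain ⟨i, j⟩ := x
  simp only [formulaVars, Finset.mem_biUnion, clauseVars, Finset.mem_image]
  constructor
  · rintro ⟨c, hc, l, hl, h⟩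
    rcases mem_formula_iff.1 hc with ⟨a, b, d, h1, h2, h3, h4, rfl⟩ | ⟨a, b, h1, h2, h3, rfl⟩ |
      ⟨b, hb, rfl⟩
    · rcases mem_transClause.1 hl with rfl | rfl | rfl <;>
        simp only [negP, pos, Prod.mk.injEq] at h <;> obtain ⟨rfl, rfl⟩ := h <;>
        omega
    · rcases mem_antiClause.1 hl with rfl | rfl <;>
        simp only [negP, Prod.mk.injEq] at h <;> obtain ⟨rfl, rfl⟩ := h <;>
        omega
    · obtain ⟨r, hr, rfl⟩ := (mem_prefixClause hb.1 hb.2 le_rfl).1 hl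
      simp only [pos, Prod.mk.injEq] at h
      obtain ⟨rfl, rfl⟩ := h
      dsimp only [InRow] at *
      omega
  · rintro ⟨h1, h2, h3⟩
    exact ⟨antiClause i j, mem_formula_iff.2 (Or.inr (Or.inl ⟨i, j, h1, h2, h3, rfl⟩)), negP i j,
      by simp [mem_antiClause], rfl⟩

section

variable {n : ℕ} {Γ : List (Clause (ℕ × ℕ))}

theorem Avail.mem {b m : ℕ} (h : Avail n Γ b m) {l : Literal (ℕ × ℕ)} :
    l ∈ prefixClause n b m ↔ ∃ i, InRow b m i ∧ l = pos i b :=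
  mem_prefixClause h.1.1 h.1.2 h.2.1

theorem Avail.database {b m lvl : ℕ} {pr qu : List (Entry (ℕ × ℕ))} (h : Avail n Γ b m) :
    (State.mk Γ pr qu lvl false).Database (formula n) (prefixClause n b m) := by
  rcases h.2.2 with rfl | h'
  · exact Or.inl (mem_formula_iff.2 (Or.inr (Or.inr ⟨b, h.1, rfl⟩)))
  · exact Or.inr h'

theorem AllPrefix.clauseVars_subset (hΓ : AllPrefix n Γ) :
    ∀ c ∈ Γ, clauseVars c ⊆ formulaVars (formula n) := by
  intro c hc x hx
  obtain ⟨b, m, h, rfl⟩ := hΓ c hc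
  obtain ⟨l, hl, rfl⟩ := Finset.mem_image.1 hx
  obtain ⟨i, hi, rfl⟩ := h.mem.1 hl
  rw [mem_formulaVars]
  dsimp only [pos, InRow, Avail] at *
  omega

theorem database_cases (hΓ : AllPrefix n Γ) {c : Clause (ℕ × ℕ)} (hc : c ∈ formula n ∨ c ∈ Γ) :
    (∃ a b d, (1 ≤ a ∧ a ≤ n) ∧ (1 ≤ b ∧ b ≤ n) ∧ (1 ≤ d ∧ d ≤ n) ∧
      (a ≠ b ∧ d ≠ a ∧ b ≠ d) ∧ c = transClause a b d) ∨
    (∃ a b, (1 ≤ a ∧ a ≤ n) ∧ (1 ≤ b ∧ b ≤ n) ∧ a ≠ b ∧ c = antiClause a b) ∨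
    ∃ b m, Avail n Γ b m ∧ c = prefixClause n b m := by
  rcases hc with hc | hc
  · rcases mem_formula_iff.1 hc with h | h | ⟨b, hb, rfl⟩
    · exact Or.inl h
    · exact Or.inr (Or.inl h)
    · exact Or.inr (Or.inr ⟨b, n - 1, ⟨hb, le_rfl, Or.inl rfl⟩, rfl⟩)
  · exact Or.inr (Or.inr (hΓ c hc))

/-- In a state in which no two consecutive variables are true, except where transitivity allows it,
and in which every prefix clause has a literal that is not false, there is no conflict. -/
theorem not_falsified (hΓ : AllPrefix n Γ) {s : State (ℕ × ℕ)} (hs : s.learned = Γ)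
    (htrans : ∀ a b d, Has s.trail (pos a b) → Has s.trail (pos b d) → ¬ Has s.trail (negP a d))
    (hanti : ∀ a b, Has s.trail (pos a b) → ¬ Has s.trail (pos b a))
    (hpre : ∀ b m, Avail n Γ b m → ∃ i, InRow b m i ∧ ¬ Has s.trail (negP i b))
    {c : Clause (ℕ × ℕ)} (hc : s.Database (formula n) c) : ¬ s.Falsified c := by
  intro hf
  subst hs
  rcases database_cases hΓ hc with ⟨a, b, d, -, -, -, -, rfl⟩ | ⟨a, b, -, -, -, rfl⟩ |
    ⟨b, m, hbm, rfl⟩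
  · exact htrans a b d (hf (negP a b) (by simp [mem_transClause]))
      (hf (negP b d) (by simp [mem_transClause])) (hf (pos a d) (by simp [mem_transClause]))
  · exact hanti a b (hf (negP a b) (by simp [mem_antiClause]))
      (hf (negP b a) (by simp [mem_antiClause]))
  · obtain ⟨i, hi, h⟩ := hpre b m hbm
    exact h (hf _ (hbm.mem.2 ⟨i, hi, rfl⟩))

theorem falsified_cases (hΓ : AllPrefix n Γ) {s : State (ℕ × ℕ)} (hs : s.learned = Γ)
    (htrans : ∀ a b d, Has s.trail (pos a b) → Has s.trail (pos b d) → ¬ Has s.trail (negP a d))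
    (hanti : ∀ a b, Has s.trail (pos a b) → ¬ Has s.trail (pos b a))
    {c : Clause (ℕ × ℕ)} (hc : s.Database (formula n) c) (hf : s.Falsified c) :
    ∃ b m, Avail n Γ b m ∧ c = prefixClause n b m ∧
      ∀ i, InRow b m i → Has s.trail (negP i b) := by
  subst hs
  rcases database_cases hΓ hc with ⟨a, b, d, -, -, -, -, rfl⟩ | ⟨a, b, -, -, -, rfl⟩ |
    ⟨b, m, hbm, rfl⟩
  · exact absurd (hf (pos a d) (by simp [mem_transClause]))
      (htrans a b d (hf (negP a b) (by simp [mem_transClause]))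
        (hf (negP b d) (by simp [mem_transClause])))
  · exact absurd (hf (negP b a) (by simp [mem_antiClause]))
      (hanti a b (hf (negP a b) (by simp [mem_antiClause])))
  · exact ⟨b, m, hbm, rfl, fun i hi => hf _ (hbm.mem.2 ⟨i, hi, rfl⟩)⟩

/-! ### Which clauses can be unit. -/

/-- Every prefix clause in use has at least two literals or a true literal. -/
def NoOpenSingle (n : ℕ) (Γ : List (Clause (ℕ × ℕ))) (L : List (Entry (ℕ × ℕ))) : Prop :=
  ∀ b m, Avail n Γ b m → 2 ≤ m ∨ ∃ i, InRow b m i ∧ Has L (pos i b)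

theorem exists_two_rows {b m : ℕ} (hm : 2 ≤ m) :
    ∃ i i', InRow b m i ∧ InRow b m i' ∧ i ≠ i' := by
  by_cases h1 : b = 1
  · exact ⟨2, 3, by simp only [InRow]; omega, by simp only [InRow]; omega, by omega⟩
  · by_cases h2 : b = 2
    · exact ⟨1, 3, by simp only [InRow]; omega, by simp only [InRow]; omega, by omega⟩
    · exact ⟨1, 2, by simp only [InRow]; omega, by simp only [InRow]; omega, by omega⟩

theorem exists_row_ne {b m : ℕ} (hm : 2 ≤ m) (i : ℕ) : ∃ i', InRow b m i' ∧ i' ≠ i := by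
  obtain ⟨i₁, i₂, h₁, h₂, h⟩ := exists_two_rows (b := b) hm
  by_cases hi : i₁ = i
  · exact ⟨i₂, h₂, fun h' => h (hi.trans h'.symm)⟩
  · exact ⟨i₁, h₁, hi⟩

/-- Single-literal clauses are visited whatever literal is being propagated, so the other clauses
must be shown not to be of this kind. -/
theorem prefixClause_card_ne_one {b m : ℕ} (h : Avail n Γ b m) (hm : 2 ≤ m) :
    (prefixClause n b m).card ≠ 1 := by
  intro hc
  obtain ⟨l, hl⟩ := Finset.card_eq_one.1 hc
  obtain ⟨i, i', hi, hi', hne⟩ := exists_two_rows (b := b) hm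
  have h1 : pos i b ∈ prefixClause n b m := h.mem.2 ⟨i, hi, rfl⟩
  have h2 : pos i' b ∈ prefixClause n b m := h.mem.2 ⟨i', hi', rfl⟩
  rw [hl, Finset.mem_singleton] at h1 h2
  exact hne (pos_inj.1 (h1.trans h2.symm)).1

theorem transClause_card_ne_one {a b d : ℕ} : (transClause a b d).card ≠ 1 := by
  intro hc
  obtain ⟨l, hl⟩ := Finset.card_eq_one.1 hc
  have h1 : negP a b ∈ transClause a b d := by simp [mem_transClause]
  have h2 : pos a d ∈ transClause a b d := by simp [mem_transClause]
  rw [hl, Finset.mem_singleton] at h1 h2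
  exact negP_ne_pos (h1.trans h2.symm)

theorem antiClause_card_ne_one {a b : ℕ} (hab : a ≠ b) : (antiClause a b).card ≠ 1 := by
  rw [antiClause, Finset.card_pair (by simp [hab])]
  omega

/-- A unit clause has no true literal. -/
theorem not_has_of_isUnit {s : State (ℕ × ℕ)} {c : Clause (ℕ × ℕ)} {l m : Literal (ℕ × ℕ)}
    (hcons : ∀ l, Has s.trail l → ¬ Has s.trail (neg l)) (hu : s.IsUnit c l) (hm : m ∈ c) :
    ¬ Has s.trail m := by
  intro h
  by_cases hml : m = l
  · exact hu.2.1 (s.assigned_iff.2 (Or.inl (hml ▸ h)))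
  · exact hcons m h (hu.2.2 m hm hml)

/-- A visited unit clause that is not a prefix clause has the negation of the literal at the head of
the queue; a visited unit prefix clause is not a single literal. -/
theorem isUnit_cases (hΓ : AllPrefix n Γ) {pr qu : List (Entry (ℕ × ℕ))} {e : Entry (ℕ × ℕ)}
    {lvl : ℕ} {c : Clause (ℕ × ℕ)} {l : Literal (ℕ × ℕ)}
    (hcons : ∀ l, Has (pr ++ e :: qu) l → ¬ Has (pr ++ e :: qu) (neg l))
    (hsing : NoOpenSingle n Γ (pr ++ [e]))
    (hc : (State.mk Γ pr (e :: qu) lvl false).Database (formula n) c)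
    (hv : (State.mk Γ pr (e :: qu) lvl false).Visited c)
    (hu : (State.mk Γ pr (e :: qu) lvl false).IsUnit c l) :
    neg e.lit ∈ c ∧ (¬ Has (pr ++ e :: qu) l ∧ ¬ Has (pr ++ e :: qu) (neg l)) ∧
    ((∃ a b d, (a ≠ b ∧ d ≠ a ∧ b ≠ d) ∧ c = transClause a b d ∧
      ((l = pos a d ∧ Has (pr ++ e :: qu) (pos a b) ∧ Has (pr ++ e :: qu) (pos b d)) ∨
      (l = negP a b ∧ Has (pr ++ e :: qu) (pos b d) ∧ Has (pr ++ e :: qu) (negP a d)) ∨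
      (l = negP b d ∧ Has (pr ++ e :: qu) (pos a b) ∧ Has (pr ++ e :: qu) (negP a d)))) ∨
    (∃ a b, a ≠ b ∧ c = antiClause a b ∧ l = negP a b ∧ Has (pr ++ e :: qu) (pos b a)) ∨
    (∃ b m i, Avail n Γ b m ∧ c = prefixClause n b m ∧ InRow b m i ∧ l = pos i b ∧
      ∀ i', InRow b m i' → i' ≠ i → Has (pr ++ e :: qu) (negP i' b))) := by
  have hassigned : ¬ Has (pr ++ e :: qu) l ∧ ¬ Has (pr ++ e :: qu) (neg l) := by
    have := hu.2.1
    rw [State.assigned_iff, not_or] at this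
    exact this
  have hother : ∀ m ∈ c, m ≠ l → Has (pr ++ e :: qu) (neg m) := hu.2.2
  have hmem := hu.1
  have hne : c.card ≠ 1 → neg e.lit ∈ c := by
    intro h1
    rcases hv with hv | ⟨e', rest, hq, h⟩
    · exact absurd hv h1
    · obtain ⟨rfl, rfl⟩ := List.cons.inj hq
      exact h
  rcases database_cases hΓ hc with ⟨a, b, d, -, -, -, hd, rfl⟩ | ⟨a, b, -, -, hab, rfl⟩ |
    ⟨b, m, hbm, rfl⟩
  · refine ⟨hne transClause_card_ne_one, hassigned, Or.inl ⟨a, b, d, hd, rfl, ?_⟩⟩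
    have h1 := hother (negP a b) (by simp [mem_transClause])
    have h2 := hother (negP b d) (by simp [mem_transClause])
    have h3 := hother (pos a d) (by simp [mem_transClause])
    rcases mem_transClause.1 hmem with rfl | rfl | rfl
    · exact Or.inr (Or.inl ⟨rfl, h2 (by simp [hd.1.symm]), h3 (by simp)⟩)
    · exact Or.inr (Or.inr ⟨rfl, h1 (by simp [hd.1]), h3 (by simp)⟩)
    · exact Or.inl ⟨rfl, h1 (by simp), h2 (by simp)⟩
  · refine ⟨hne (antiClause_card_ne_one hab), hassigned, Or.inr (Or.inl ?_)⟩
    rcases mem_antiClause.1 hmem with rfl | rfl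
    · exact ⟨a, b, hab, rfl, rfl,
        hother (negP b a) (by simp [mem_antiClause]) (by simp [hab])⟩
    · exact ⟨b, a, hab.symm, antiClause_comm a b, rfl,
        hother (negP a b) (by simp [mem_antiClause]) (by simp [hab])⟩
  · have hm : (prefixClause n b m).card ≠ 1 := by
      rcases hsing b m hbm with h | ⟨i, hi, h⟩
      · exact prefixClause_card_ne_one hbm h
      · refine absurd ?_ (not_has_of_isUnit (s := ⟨Γ, pr, e :: qu, lvl, false⟩) hcons hu (hbm.mem.2 ⟨i, hi, rfl⟩))
        simp only [State.trail, has_append, has_cons] at h ⊢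
        have := has_nil (l := pos i b)
        tauto
    refine ⟨hne hm, hassigned, Or.inr (Or.inr ?_)⟩
    obtain ⟨i, hi, rfl⟩ := hbm.mem.1 hmem
    exact ⟨b, m, i, hbm, rfl, hi, rfl, fun i' hi' hne' =>
      hother (pos i' b) (hbm.mem.2 ⟨i', hi', rfl⟩) (by simp [hne'])⟩

/-- Prefix clauses have no negative literals, so they are not visited. In a transitivity clause `¬P
x y` is the first or the second literal, and either of the other two may be the unit one; this gives
four cases, and antisymmetry gives the fifth. -/
theorem isUnit_cases_of_pos (hΓ : AllPrefix n Γ) {pr qu : List (Entry (ℕ × ℕ))}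
    {e : Entry (ℕ × ℕ)} {lvl x y : ℕ} (he : e.lit = pos x y) {c : Clause (ℕ × ℕ)}
    {l : Literal (ℕ × ℕ)}
    (hcons : ∀ l, Has (pr ++ e :: qu) l → ¬ Has (pr ++ e :: qu) (neg l))
    (hsing : NoOpenSingle n Γ (pr ++ [e]))
    (hc : (State.mk Γ pr (e :: qu) lvl false).Database (formula n) c)
    (hv : (State.mk Γ pr (e :: qu) lvl false).Visited c)
    (hu : (State.mk Γ pr (e :: qu) lvl false).IsUnit c l) :
    (∃ z, l = pos x z ∧ c = transClause x y z ∧ Has (pr ++ e :: qu) (pos y z)) ∨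
    (∃ z, l = negP y z ∧ c = transClause x y z ∧ Has (pr ++ e :: qu) (negP x z)) ∨
    (∃ z, l = pos z y ∧ c = transClause z x y ∧ Has (pr ++ e :: qu) (pos z x)) ∨
    (∃ z, l = negP z x ∧ c = transClause z x y ∧ Has (pr ++ e :: qu) (negP z y)) ∨
    (l = negP y x ∧ c = antiClause y x) := by
  have hehas : Has (pr ++ e :: qu) (pos x y) := by simp [has_append, has_cons, he]
  obtain ⟨hmem, ⟨hn1, hn2⟩, h⟩ := isUnit_cases hΓ hcons hsing hc hv hu
  rw [he, neg_pos] at hmem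
  rcases h with ⟨a, b, d, hd, rfl, h⟩ | ⟨a, b, hab, rfl, rfl, h⟩ | ⟨b, m, i, hbm, rfl, -⟩
  · rw [mem_transClause] at hmem
    simp only [negP_inj, negP_ne_pos, or_false] at hmem
    rcases hmem with ⟨rfl, rfl⟩ | ⟨rfl, rfl⟩ <;>
      rcases h with ⟨rfl, h, h'⟩ | ⟨rfl, h, h'⟩ | ⟨rfl, h, h'⟩
    · exact Or.inl ⟨_, rfl, rfl, h'⟩
    · exact absurd hehas hn2
    · exact Or.inr (Or.inl ⟨_, rfl, rfl, h'⟩)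
    · exact Or.inr (Or.inr (Or.inl ⟨_, rfl, rfl, h⟩))
    · exact Or.inr (Or.inr (Or.inr (Or.inl ⟨_, rfl, rfl, h'⟩)))
    · exact absurd hehas hn2
  · rw [mem_antiClause] at hmem
    simp only [negP_inj] at hmem
    rcases hmem with ⟨rfl, rfl⟩ | ⟨rfl, rfl⟩
    · exact absurd hehas hn2
    · exact Or.inr (Or.inr (Or.inr (Or.inr ⟨rfl, rfl⟩)))
  · obtain ⟨i', -, h⟩ := hbm.mem.1 hmem
    exact absurd h negP_ne_pos

/-- The literal `P x y` occurs only as the conclusion of a transitivity clause or in a prefix clause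
of column `y`. -/
theorem isUnit_cases_of_negP (hΓ : AllPrefix n Γ) {pr qu : List (Entry (ℕ × ℕ))}
    {e : Entry (ℕ × ℕ)} {lvl x y : ℕ} (he : e.lit = negP x y) {c : Clause (ℕ × ℕ)}
    {l : Literal (ℕ × ℕ)}
    (hcons : ∀ l, Has (pr ++ e :: qu) l → ¬ Has (pr ++ e :: qu) (neg l))
    (hsing : NoOpenSingle n Γ (pr ++ [e]))
    (hc : (State.mk Γ pr (e :: qu) lvl false).Database (formula n) c)
    (hv : (State.mk Γ pr (e :: qu) lvl false).Visited c)
    (hu : (State.mk Γ pr (e :: qu) lvl false).IsUnit c l) :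
    (∃ z, l = negP x z ∧ c = transClause x z y ∧ Has (pr ++ e :: qu) (pos z y)) ∨
    (∃ z, l = negP z y ∧ c = transClause x z y ∧ Has (pr ++ e :: qu) (pos x z)) ∨
    (∃ m i, Avail n Γ y m ∧ InRow y m i ∧ i ≠ x ∧ l = pos i y ∧ c = prefixClause n y m ∧
      ∀ i', InRow y m i' → i' ≠ i → Has (pr ++ e :: qu) (negP i' y)) := by
  have hehas : Has (pr ++ e :: qu) (negP x y) := by simp [has_append, has_cons, he]
  obtain ⟨hmem, ⟨hn1, hn2⟩, h⟩ := isUnit_cases hΓ hcons hsing hc hv hu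
  rw [he, neg_negP] at hmem
  rcases h with ⟨a, b, d, hd, rfl, h⟩ | ⟨a, b, hab, rfl, rfl, h⟩ |
    ⟨b, m, i, hbm, rfl, hi, rfl, h⟩
  · rw [mem_transClause] at hmem
    simp only [pos_inj, pos_ne_negP, false_or] at hmem
    obtain ⟨rfl, rfl⟩ := hmem
    rcases h with ⟨rfl, h, h'⟩ | ⟨rfl, h, h'⟩ | ⟨rfl, h, h'⟩
    · exact absurd hehas hn2
    · exact Or.inl ⟨_, rfl, rfl, h⟩
    · exact Or.inr (Or.inl ⟨_, rfl, rfl, h⟩)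
  · rw [mem_antiClause] at hmem
    simp at hmem
  · obtain ⟨i', hi', h'⟩ := hbm.mem.1 hmem
    obtain ⟨rfl, rfl⟩ := pos_inj.1 h'
    refine Or.inr (Or.inr ⟨m, i, hbm, hi, ?_, rfl, rfl, h⟩)
    rintro rfl
    exact hn2 hehas

end

/-! ## Conflict analysis -/

section

variable {tr : List (Entry (ℕ × ℕ))} {lvl : ℕ}

theorem mem_literalsAtLevel {c : Clause (ℕ × ℕ)} {l : Literal (ℕ × ℕ)} :
    l ∈ literalsAtLevel tr lvl c ↔ l ∈ c ∧ ∃ e ∈ tr, e.lit = neg l ∧ e.level = lvl := by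
  simp [literalsAtLevel]

theorem not_card_le_one {c : Clause (ℕ × ℕ)} {l m : Literal (ℕ × ℕ)} (hne : l ≠ m) (hl : l ∈ c)
    (hm : m ∈ c) (hl' : ∃ e ∈ tr, e.lit = neg l ∧ e.level = lvl)
    (hm' : ∃ e ∈ tr, e.lit = neg m ∧ e.level = lvl) :
    ¬ (literalsAtLevel tr lvl c).card ≤ 1 := by
  rw [not_le]
  exact Finset.one_lt_card.2
    ⟨l, mem_literalsAtLevel.2 ⟨hl, hl'⟩, m, mem_literalsAtLevel.2 ⟨hm, hm'⟩, hne⟩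

theorem analyzeAux_resolve {c r : Clause (ℕ × ℕ)} {e : Entry (ℕ × ℕ)} {es : List (Entry (ℕ × ℕ))}
    (hcard : ¬ (literalsAtLevel tr lvl c).card ≤ 1) (he : neg e.lit ∈ c) (hr : e.reason = some r) :
    analyzeAux tr lvl (e :: es) c =
      analyzeAux tr lvl es (c.erase (neg e.lit) ∪ r.erase e.lit) := by
  rw [analyzeAux, if_neg hcard, if_pos he, hr]

theorem analyzeAux_skip {c : Clause (ℕ × ℕ)} {e : Entry (ℕ × ℕ)} {es : List (Entry (ℕ × ℕ))}
    (hcard : ¬ (literalsAtLevel tr lvl c).card ≤ 1) (he : neg e.lit ∉ c) :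
    analyzeAux tr lvl (e :: es) c = analyzeAux tr lvl es c := by
  rw [analyzeAux, if_neg hcard, if_neg he]

theorem analyzeAux_stop {c : Clause (ℕ × ℕ)} {es : List (Entry (ℕ × ℕ))}
    (hcard : (literalsAtLevel tr lvl c).card ≤ 1) : analyzeAux tr lvl es c = c := by
  cases es with
  | nil => rfl
  | cons e es => rw [analyzeAux, if_pos hcard]

/-- The analysis runs back through the entries implied by `P (k+1) j` and through this entry itself,
and turns `C(k+1, k)` into `C(j, k-1)`. -/
theorem analyzeAux_block {j k : ℕ} (hk : 2 ≤ k) (hjk : j ≤ k)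
    (hK : ∀ i, 1 ≤ i → i ≤ k → ∃ e ∈ tr, e.lit = negP i (k + 1) ∧ e.level = lvl)
    (ht : ∃ e ∈ tr, e.lit = pos (k + 1) j ∧ e.level = lvl)
    (hu : ∃ u, (1 ≤ u ∧ u ≤ k) ∧ u ≠ j ∧ ∃ e ∈ tr, e.lit = negP u j ∧ e.level = lvl)
    {t : Entry (ℕ × ℕ)} {rest : List (Entry (ℕ × ℕ))} {r c' : Clause (ℕ × ℕ)}
    (htl : t.lit = pos (k + 1) j) (htr : t.reason = some r)
    (hr : ∀ l, l ∈ r ↔ ∃ i, (1 ≤ i ∧ i ≤ k + 1) ∧ i ≠ j ∧ l = pos i j)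
    (hc' : ∀ l, l ∈ c' ↔ ∃ i, (1 ≤ i ∧ i ≤ k) ∧ i ≠ j ∧ l = pos i j)
    (es : List (Entry (ℕ × ℕ)))
    (hes : ∀ e ∈ es, (∃ i, (1 ≤ i ∧ i ≤ k) ∧ e.lit = negP i (k + 1) ∧
        ((i = j ∧ e.reason = some (antiClause i (k + 1))) ∨
          (i ≠ j ∧ e.reason = some (transClause i (k + 1) j)))) ∨
      ∃ q, q ≠ j ∧ e.lit = pos (k + 1) q)
    (hnd : es.Pairwise (fun e e' => e.lit ≠ e'.lit))
    (c : Clause (ℕ × ℕ))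
    (hc : ∀ l, l ∈ c ↔
      (∃ i, (1 ≤ i ∧ i ≤ k) ∧ Has es (negP i (k + 1)) ∧ l = pos i (k + 1)) ∨
      (∃ i, (1 ≤ i ∧ i ≤ k) ∧ ¬ Has es (negP i (k + 1)) ∧ i ≠ j ∧ l = pos i j) ∨
      ((∃ i, (1 ≤ i ∧ i ≤ k) ∧ ¬ Has es (negP i (k + 1))) ∧ l = negP (k + 1) j)) :
    analyzeAux tr lvl (es ++ t :: rest) c = analyzeAux tr lvl rest c' := by
  -- The list `es` holds the entries still to be inspected. By `hc`, a row whose entry is in `es`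
  -- contributes `P i (k+1)`, a resolved row contributes `P i j` instead, and the first resolved row
  -- brings in `¬P (k+1) j`.
  induction es generalizing c with
  | nil =>
    obtain ⟨u, hu1, huj, hu⟩ := hu
    -- All rows are resolved, but `¬P (k+1) j` and `P u j` are both of the last level, so the reason
    -- of `t` is still used.
    have hcard : ¬ (literalsAtLevel tr lvl c).card ≤ 1 := by
      refine not_card_le_one (l := negP (k + 1) j) (m := pos u j) (by simp) ?_ ?_ ht hu
      · exact (hc _).2 (Or.inr (Or.inr ⟨⟨u, hu1, has_nil⟩, rfl⟩))
      · exact (hc _).2 (Or.inr (Or.inl ⟨u, hu1, has_nil, huj, rfl⟩))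
    have htc : neg t.lit ∈ c := by
      rw [htl]
      exact (hc _).2 (Or.inr (Or.inr ⟨⟨u, hu1, has_nil⟩, rfl⟩))
    rw [List.nil_append, analyzeAux_resolve hcard htc htr]
    congr 1
    ext l
    rw [hc', Finset.mem_union, Finset.mem_erase, Finset.mem_erase, hc, hr, htl]
    constructor
    · rintro (⟨h, ⟨i, -, h', -⟩ | ⟨i, hi, -, hij, rfl⟩ | ⟨-, rfl⟩⟩ | ⟨h, i, hi, hij, rfl⟩)
      · exact absurd h' has_nil
      · exact ⟨i, hi, hij, rfl⟩
      · exact absurd rfl h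
      · refine ⟨i, ?_, hij, rfl⟩
        simp only [ne_eq, pos_inj, and_true] at h
        omega
    · rintro ⟨i, hi, hij, rfl⟩
      exact Or.inl ⟨by simp, Or.inr (Or.inl ⟨i, hi, has_nil, hij, rfl⟩)⟩
  | cons e es ih =>
    have hcard : ¬ (literalsAtLevel tr lvl c).card ≤ 1 := by
      -- Before the first resolution rows 1 and 2 of column `k + 1` are two literals of the level.
      -- Afterwards `¬P (k+1) j` is one, and the other is an unresolved row or, if there is none, `P
      -- u j`.
      by_cases hall : ∀ i, 1 ≤ i ∧ i ≤ k → Has (e :: es) (negP i (k + 1))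
      · refine not_card_le_one (l := pos 1 (k + 1)) (m := pos 2 (k + 1)) (by simp)
          ((hc _).2 (Or.inl ⟨1, by omega, hall _ (by omega), rfl⟩))
          ((hc _).2 (Or.inl ⟨2, by omega, hall _ (by omega), rfl⟩))
          (hK 1 (by omega) (by omega)) (hK 2 (by omega) (by omega))
      · push Not at hall
        obtain ⟨i, hi, hne⟩ := hall
        have h1 : negP (k + 1) j ∈ c := (hc _).2 (Or.inr (Or.inr ⟨⟨i, hi, hne⟩, rfl⟩))
        by_cases hex : ∃ i', (1 ≤ i' ∧ i' ≤ k) ∧ Has (e :: es) (negP i' (k + 1))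
        · obtain ⟨i', hi', h'⟩ := hex
          exact not_card_le_one (l := negP (k + 1) j) (m := pos i' (k + 1)) (by simp) h1
            ((hc _).2 (Or.inl ⟨i', hi', h', rfl⟩)) ht (hK i' hi'.1 hi'.2)
        · push Not at hex
          obtain ⟨u, hu1, huj, hu⟩ := hu
          exact not_card_le_one (l := negP (k + 1) j) (m := pos u j) (by simp) h1
            ((hc _).2 (Or.inr (Or.inl ⟨u, hu1, hex u hu1, huj, rfl⟩))) ht hu
    have hes' := fun e' he' => hes e' (List.mem_cons_of_mem _ he')
    rw [List.pairwise_cons] at hnd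
    rcases hes e List.mem_cons_self with ⟨i, hi, hel, her⟩ | ⟨q, hq, hel⟩
    · have hni : ¬ Has es (negP i (k + 1)) := by
        rintro ⟨e', he', h⟩
        exact hnd.1 e' he' (hel.trans h.symm)
      have hiff : ∀ x, Has (e :: es) (negP x (k + 1)) ↔ x = i ∨ Has es (negP x (k + 1)) := by
        intro x
        rw [has_cons, hel, negP_inj]
        simp only [and_true]
        exact or_congr_left eq_comm
      have hec : neg e.lit ∈ c := by
        rw [hel]
        exact (hc _).2 (Or.inl ⟨i, hi, (hiff i).2 (Or.inl rfl), rfl⟩)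
      -- For row `j` the antisymmetry clause is what remains of the transitivity clause without the
      -- meaningless literal `P j j`.
      obtain ⟨ρ, hρ, hρm⟩ : ∃ ρ, e.reason = some ρ ∧ ∀ l, l ∈ ρ ↔
          l = negP i (k + 1) ∨ l = negP (k + 1) j ∨ (i ≠ j ∧ l = pos i j) := by
        rcases her with ⟨rfl, her⟩ | ⟨hij, her⟩
        · exact ⟨_, her, fun l => by simp [mem_antiClause]⟩
        · exact ⟨_, her, fun l => by simp [mem_transClause, hij]⟩
      rw [List.cons_append, analyzeAux_resolve hcard hec hρ]
      refine ih hes' hnd.2 _ fun l => ?_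
      rw [Finset.mem_union, Finset.mem_erase, Finset.mem_erase, hc, hρm, hel]
      constructor
      · rintro (⟨h, ⟨x, hx, hxh, rfl⟩ | ⟨x, hx, hxh, hxj, rfl⟩ | ⟨-, rfl⟩⟩ |
          ⟨h, rfl | rfl | ⟨hij, rfl⟩⟩)
        · refine Or.inl ⟨x, hx, ?_, rfl⟩
          refine ((hiff x).1 hxh).resolve_left ?_
          rintro rfl
          exact h rfl
        · exact Or.inr (Or.inl ⟨x, hx, fun hh => hxh ((hiff x).2 (Or.inr hh)), hxj, rfl⟩)
        · exact Or.inr (Or.inr ⟨⟨i, hi, hni⟩, rfl⟩)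
        · exact absurd rfl h
        · exact Or.inr (Or.inr ⟨⟨i, hi, hni⟩, rfl⟩)
        · exact Or.inr (Or.inl ⟨i, hi, hni, hij, rfl⟩)
      · rintro (⟨x, hx, hxh, rfl⟩ | ⟨x, hx, hxh, hxj, rfl⟩ | ⟨-, rfl⟩)
        · refine Or.inl ⟨?_, Or.inl ⟨x, hx, (hiff x).2 (Or.inr hxh), rfl⟩⟩
          simp only [neg_negP, ne_eq, pos_inj, and_true]
          rintro rfl
          exact hni hxh
        · by_cases hxi : x = i
          · subst hxi
            exact Or.inr ⟨by simp, Or.inr (Or.inr ⟨hxj, rfl⟩)⟩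
          · refine Or.inl ⟨?_, Or.inr (Or.inl ⟨x, hx, ?_, hxj, rfl⟩)⟩
            · simp [hxi]
            · rw [hiff]
              tauto
        · exact Or.inr ⟨by simp; omega, Or.inr (Or.inl rfl)⟩
    -- The by-product `P (k+1) q` does not occur negated in the clause, because `q ≠ j`.
    · have hiff : ∀ x, Has (e :: es) (negP x (k + 1)) ↔ Has es (negP x (k + 1)) := by
        intro x
        rw [has_cons, hel]
        simp
      have hec : neg e.lit ∉ c := by
        rw [hel, hc]
        simp [hq]
      rw [List.cons_append, analyzeAux_skip hcard hec]
      refine ih hes' hnd.2 _ fun l => ?_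
      simp only [hc, hiff]

end

/-! ## The conflict -/

/-- Every maximal run of the solver from `s` reaches a state with property `P`. -/
abbrev Ends (n : ℕ) (δ : ℝ) (P : State (ℕ × ℕ) → Prop) (s : State (ℕ × ℕ)) : Prop :=
  Inevitable (Step (formula n) columnMajor δ) P s

/-- The available prefix clauses in the phase in which `C(j, k - 1)` is derived. If `q` is positive,
then `P j q` is true when `P j` is being falsified; `q = 0` means that no literal is true. -/
structure Phase (n : ℕ) (Γ : List (Clause (ℕ × ℕ))) (j k q : ℕ) : Prop where
  allPrefix : AllPrefix n Γ
  one_le : 1 ≤ j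
  le : j ≤ k
  two_le : 2 ≤ k
  lt : k + 1 ≤ n
  avail : Avail n Γ j k
  avail_min : ∀ m, Avail n Γ j m → k ≤ m
  -- All available clauses of column `q` contain the true literal `P j q`. Hence `large` may allow
  -- them to be single literals.
  true_row : 0 < q → q ≠ j ∧ q ≤ k ∧ ∀ m, Avail n Γ q m → InRow q m j
  large : ∀ b m, Avail n Γ b m → 2 ≤ m ∨ (0 < q ∧ b = q)

theorem consistent_of {L : List (Entry (ℕ × ℕ))}
    (h : ∀ a b, Has L (pos a b) → ¬ Has L (negP a b)) :
    ∀ l, Has L l → ¬ Has L (neg l) := by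
  rintro ⟨⟨a, b⟩, _ | _⟩ h1 h2
  · exact h a b h2 h1
  · exact h a b h1 h2

theorem trail_mk {Γ : List (Clause (ℕ × ℕ))} {pr qu : List (Entry (ℕ × ℕ))} {lvl : ℕ} {b : Bool} :
    (State.mk Γ pr qu lvl b).trail = pr ++ qu := rfl

section

variable {n : ℕ} {δ : ℝ} {P : State (ℕ × ℕ) → Prop} {Γ : List (Clause (ℕ × ℕ))} {j k q : ℕ}

theorem Phase.noOpenSingle (h : Phase n Γ j k q) {L : List (Entry (ℕ × ℕ))}
    (hT : 0 < q → Has L (pos j q)) : NoOpenSingle n Γ L := by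
  intro b m hbm
  rcases h.large b m hbm with hm | ⟨hq, rfl⟩
  · exact Or.inl hm
  · exact Or.inr ⟨j, (h.true_row hq).2.2 m hbm, hT hq⟩

/-- Entries implied by `P (k+1) j`. -/
def ImpliedEntries (k j q lvl : ℕ) (qu : List (Entry (ℕ × ℕ))) : Prop :=
  (∀ x ∈ qu, x.level = lvl ∧ ((∃ i, (1 ≤ i ∧ i ≤ k) ∧ x.lit = negP i (k + 1) ∧
      ((i = j ∧ x.reason = some (antiClause i (k + 1))) ∨
        (i ≠ j ∧ x.reason = some (transClause i (k + 1) j)))) ∨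
      (0 < q ∧ x.lit = pos (k + 1) q))) ∧
    qu.Pairwise (fun e e' => e.lit ≠ e'.lit)

theorem ImpliedEntries.has_pos {lvl : ℕ} {qu : List (Entry (ℕ × ℕ))}
    (h : ImpliedEntries k j q lvl qu) {a b : ℕ} (hab : Has qu (pos a b)) :
    0 < q ∧ a = k + 1 ∧ b = q := by
  obtain ⟨x, hx, hl⟩ := hab
  rcases (h.1 x hx).2 with ⟨i, -, h', -⟩ | ⟨h0, h'⟩
  · simp [hl] at h'
  · rw [hl, pos_inj] at h'
    exact ⟨h0, h'⟩

theorem ImpliedEntries.has_negP {lvl : ℕ} {qu : List (Entry (ℕ × ℕ))}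
    (h : ImpliedEntries k j q lvl qu) {a b : ℕ} (hab : Has qu (negP a b)) :
    (1 ≤ a ∧ a ≤ k) ∧ b = k + 1 := by
  obtain ⟨x, hx, hl⟩ := hab
  rcases (h.1 x hx).2 with ⟨i, hi, h', -⟩ | ⟨h0, h'⟩
  · rw [hl, negP_inj] at h'
    omega
  · simp [hl] at h'

theorem pairwise_append_singleton {qu : List (Entry (ℕ × ℕ))} {x : Entry (ℕ × ℕ)}
    (h : qu.Pairwise (fun e e' => e.lit ≠ e'.lit)) (hx : ¬ Has qu x.lit) :
    (qu ++ [x]).Pairwise (fun e e' => e.lit ≠ e'.lit) := by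
  rw [List.pairwise_append]
  refine ⟨h, List.pairwise_singleton _ _, fun e he e' he' => ?_⟩
  rw [List.mem_singleton] at he'
  subst he'
  exact fun hh => hx ⟨e, he, hh⟩

theorem reverse_pairwise_ne {qu : List (Entry (ℕ × ℕ))}
    (h : qu.Pairwise (fun e e' => e.lit ≠ e'.lit)) :
    qu.reverse.Pairwise (fun e e' => e.lit ≠ e'.lit) :=
  List.pairwise_reverse.2 (h.imp fun h => h.symm)

theorem has_reverse {L : List (Entry (ℕ × ℕ))} {l : Literal (ℕ × ℕ)} :
    Has L.reverse l ↔ Has L l := by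
  simp [Has]

/-- The situation when `P (k+1) j` is about to be propagated. -/
structure Situation (j k q : ℕ) (pr : List (Entry (ℕ × ℕ))) : Prop where
  true_iff : ∀ a b, Has pr (pos a b) ↔ 0 < q ∧ a = j ∧ b = q
  of_false : ∀ i b, Has pr (negP i b) →
    (1 ≤ i ∧ i ≤ k) ∧ i ≠ j ∧ (b = j ∨ (0 < q ∧ b = q ∧ i ≠ q))
  false_col : ∀ i, 1 ≤ i → i ≤ k → i ≠ j → Has pr (negP i j)

section

variable {pr qu : List (Entry (ℕ × ℕ))} {lvl : ℕ} {t : Entry (ℕ × ℕ)}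

/-- Together with `Situation.of_has_negP`, it turns questions about the trail into arithmetic of row
and column numbers. Consistency, transitivity and antisymmetry then become finite case checks. -/
theorem Situation.of_has_pos (hs : Situation j k q pr) (htl : t.lit = pos (k + 1) j)
    (hqu : ImpliedEntries k j q lvl qu) {a b : ℕ} (hab : Has (pr ++ t :: qu) (pos a b)) :
    (0 < q ∧ a = j ∧ b = q) ∨ (a = k + 1 ∧ b = j) ∨ (0 < q ∧ a = k + 1 ∧ b = q) := by
  rw [has_append, has_cons, htl, pos_inj, hs.true_iff] at hab
  rcases hab with hab | hab | hab
  · exact Or.inl hab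
  · exact Or.inr (Or.inl ⟨hab.1.symm, hab.2.symm⟩)
  · exact Or.inr (Or.inr (hqu.has_pos hab))

theorem Situation.of_has_negP (hs : Situation j k q pr) (htl : t.lit = pos (k + 1) j)
    (hqu : ImpliedEntries k j q lvl qu) {i b : ℕ} (hib : Has (pr ++ t :: qu) (negP i b)) :
    ((1 ≤ i ∧ i ≤ k) ∧ i ≠ j ∧ (b = j ∨ (0 < q ∧ b = q ∧ i ≠ q))) ∨
      ((1 ≤ i ∧ i ≤ k) ∧ b = k + 1) := by
  rw [has_append, has_cons, htl] at hib
  rcases hib with hib | hib | hib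
  · exact Or.inl (hs.of_false i b hib)
  · exact absurd hib (by simp)
  · exact Or.inr (hqu.has_negP hib)

theorem Phase.consistent (h : Phase n Γ j k q) (hs : Situation j k q pr)
    (htl : t.lit = pos (k + 1) j) (hqu : ImpliedEntries k j q lvl qu) :
    ∀ l, Has (pr ++ t :: qu) l → ¬ Has (pr ++ t :: qu) (neg l) := by
  have hjk := h.le
  have hqq : 0 < q → q ≠ j ∧ q ≤ k := fun h0 => ⟨(h.true_row h0).1, (h.true_row h0).2.1⟩
  refine consistent_of fun a b h1 h2 => ?_
  have h1 := hs.of_has_pos htl hqu h1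
  have h2 := hs.of_has_negP htl hqu h2
  omega

theorem Phase.transitive (h : Phase n Γ j k q) (hs : Situation j k q pr)
    (htl : t.lit = pos (k + 1) j) (hqu : ImpliedEntries k j q lvl qu) (a b d : ℕ)
    (h1 : Has (pr ++ t :: qu) (pos a b)) (h2 : Has (pr ++ t :: qu) (pos b d)) :
    ¬ Has (pr ++ t :: qu) (negP a d) := by
  have hjk := h.le
  have hqq : 0 < q → q ≠ j ∧ q ≤ k := fun h0 => ⟨(h.true_row h0).1, (h.true_row h0).2.1⟩
  intro h3
  have h1 := hs.of_has_pos htl hqu h1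
  have h2 := hs.of_has_pos htl hqu h2
  have h3 := hs.of_has_negP htl hqu h3
  omega

theorem Phase.antisymmetric (h : Phase n Γ j k q) (hs : Situation j k q pr)
    (htl : t.lit = pos (k + 1) j) (hqu : ImpliedEntries k j q lvl qu) (a b : ℕ)
    (h1 : Has (pr ++ t :: qu) (pos a b)) : ¬ Has (pr ++ t :: qu) (pos b a) := by
  have hjk := h.le
  have hqq : 0 < q → q ≠ j ∧ q ≤ k := fun h0 => ⟨(h.true_row h0).1, (h.true_row h0).2.1⟩
  intro h2
  have h1 := hs.of_has_pos htl hqu h1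
  have h2 := hs.of_has_pos htl hqu h2
  omega

/-- While `P (k+1) j` is being propagated, only the literals of `ImpliedEntries` are implied. -/
theorem Phase.impliedEntries_append (h : Phase n Γ j k q) (hs : Situation j k q pr)
    (htl : t.lit = pos (k + 1) j) (hqu : ImpliedEntries k j q lvl qu) {c : Clause (ℕ × ℕ)}
    {l : Literal (ℕ × ℕ)}
    (hc : (State.mk Γ pr (t :: qu) lvl false).Database (formula n) c)
    (hv : (State.mk Γ pr (t :: qu) lvl false).Visited c)
    (hu : (State.mk Γ pr (t :: qu) lvl false).IsUnit c l) :
    ImpliedEntries k j q lvl (qu ++ [⟨l, lvl, some c⟩]) := by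
  have hj := h.one_le
  have hjk := h.le
  have hqq : 0 < q → q ≠ j ∧ q ≤ k := fun h0 => ⟨(h.true_row h0).1, (h.true_row h0).2.1⟩
  have hun : ¬ Has qu l := fun hh =>
    hu.2.1 (State.assigned_iff.2 (Or.inl (by
      rw [trail_mk, has_append, has_cons]; exact Or.inr (Or.inr hh))))
  refine ⟨?_, pairwise_append_singleton hqu.2 hun⟩
  intro x hx
  rcases List.mem_append.1 hx with hx | hx
  · exact hqu.1 x hx
  rw [List.mem_singleton] at hx
  subst hx
  refine ⟨rfl, ?_⟩
  have hsing : NoOpenSingle n Γ (pr ++ [t]) := h.noOpenSingle fun h0 =>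
    has_append.2 (Or.inl ((hs.true_iff j q).2 ⟨h0, rfl, rfl⟩))
  -- Row `k + 1` has no false literal and column `k + 1` no true one, which excludes the second and
  -- the third case. In the first case `P j z` is true only for `z = q`.
  rcases isUnit_cases_of_pos h.allPrefix htl (h.consistent hs htl hqu) hsing hc hv hu with
    ⟨z, rfl, rfl, h1⟩ | ⟨z, rfl, rfl, h1⟩ | ⟨z, rfl, rfl, h1⟩ | ⟨z, rfl, rfl, h1⟩ | ⟨rfl, rfl⟩
  · have h1 := hs.of_has_pos htl hqu h1
    have : 0 < q ∧ z = q := by omega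
    exact Or.inr ⟨this.1, by rw [this.2]⟩
  · have h1 := hs.of_has_negP htl hqu h1
    omega
  · have h1 := hs.of_has_pos htl hqu h1
    omega
  · have h1 := hs.of_has_negP htl hqu h1
    exact Or.inl ⟨z, by omega, rfl, Or.inr ⟨by omega, rfl⟩⟩
  · exact Or.inl ⟨j, ⟨hj, hjk⟩, rfl, Or.inl ⟨rfl, rfl⟩⟩

/-- When `P (k+1) j` has been propagated, the first `k` variables of column `k + 1` are false. -/
theorem Phase.has_of_saturated (h : Phase n Γ j k q) (hs : Situation j k q pr)
    (htl : t.lit = pos (k + 1) j) (hqu : ImpliedEntries k j q lvl qu)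
    (hsat : (State.mk Γ pr (t :: qu) lvl false).Saturated (formula n)) {i : ℕ} (hi : 1 ≤ i)
    (hik : i ≤ k) : Has (pr ++ t :: qu) (negP i (k + 1)) := by
  have hj := h.one_le
  have hjk := h.le
  have hkn := h.lt
  have hqq : 0 < q → q ≠ j ∧ q ≤ k := fun h0 => ⟨(h.true_row h0).1, (h.true_row h0).2.1⟩
  have ht : Has (pr ++ t :: qu) (pos (k + 1) j) := by simp [has_append, has_cons, htl]
  have key : Has (pr ++ t :: qu) (negP i (k + 1)) ∨ Has (pr ++ t :: qu) (pos i (k + 1)) := by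
    by_cases hij : i = j
    · subst hij
      refine hsat.assigned (c := antiClause i (k + 1)) (l := negP i (k + 1)) (Or.inl ?_)
        (Or.inr ⟨t, qu, rfl, ?_⟩) (by simp [mem_antiClause]) ?_
      · exact mem_formula_iff.2 (Or.inr (Or.inl
          ⟨i, k + 1, by omega, by omega, by omega, rfl⟩))
      · simp [htl, mem_antiClause]
      · intro m hm hne
        rcases mem_antiClause.1 hm with rfl | rfl
        · exact absurd rfl hne
        · exact ht
    · refine hsat.assigned (c := transClause i (k + 1) j) (l := negP i (k + 1)) (Or.inl ?_)
        (Or.inr ⟨t, qu, rfl, ?_⟩) (by simp [mem_transClause]) ?_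
      · exact mem_formula_iff.2 (Or.inl
          ⟨i, k + 1, j, by omega, by omega, by omega, by omega, rfl⟩)
      · simp [htl, mem_transClause]
      · intro m hm hne
        rcases mem_transClause.1 hm with rfl | rfl | rfl
        · exact absurd rfl hne
        · exact ht
        · exact has_append.2 (Or.inl (hs.false_col i hi hik hij))
  refine key.resolve_right fun h1 => ?_
  have h1 := hs.of_has_pos htl hqu h1
  omega

/-- While `P (k+1) j` is being propagated, only `C(k+1, k)` can become false. -/
theorem Phase.eq_of_falsified (h : Phase n Γ j k q) (hKmin : ∀ m, Avail n Γ (k + 1) m → k ≤ m)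
    (hs : Situation j k q pr)
    (htl : t.lit = pos (k + 1) j) (hqu : ImpliedEntries k j q lvl qu) {c : Clause (ℕ × ℕ)}
    (hc : (State.mk Γ pr (t :: qu) lvl false).Database (formula n) c)
    (hf : (State.mk Γ pr (t :: qu) lvl false).Falsified c) :
    c = prefixClause n (k + 1) k ∧ Avail n Γ (k + 1) k ∧
      ∀ i, 1 ≤ i → i ≤ k → Has (pr ++ t :: qu) (negP i (k + 1)) := by
  have hj := h.one_le
  have hjk := h.le
  have hqq : 0 < q → q ≠ j ∧ q ≤ k := fun h0 => ⟨(h.true_row h0).1, (h.true_row h0).2.1⟩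
  obtain ⟨b, m, hbm, rfl, hrow⟩ := falsified_cases (s := ⟨Γ, pr, t :: qu, lvl, false⟩)
    h.allPrefix rfl
    (h.transitive hs htl hqu) (h.antisymmetric hs htl hqu) hc hf
  have hrow' := fun i hi => hs.of_has_negP htl hqu (hrow i hi)
  -- Every available clause of column `j` contains the true literal `P (k+1) j`.
  have hbj : b ≠ j := by
    rintro rfl
    have hm := h.avail_min m hbm
    have := hrow' (k + 1) (by simp only [InRow]; omega)
    omega
  have hbq : ¬ (0 < q ∧ b = q) := by
    rintro ⟨h0, rfl⟩
    have := hrow' j ((h.true_row h0).2.2 m hbm)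
    omega
  obtain ⟨i, -, hi, -⟩ := exists_two_rows (b := b) ((h.large b m hbm).resolve_right hbq)
  have hb : b = k + 1 := by
    have := hrow' i hi
    omega
  subst hb
  have hm := hKmin m hbm
  have hm' : m = k := by
    -- A longer clause of column `k + 1` would contain row `k + 2`, in which nothing is false.
    by_contra hne
    have := hrow' (k + 2) (by simp only [InRow]; omega)
    omega
  subst hm'
  exact ⟨rfl, hbm, fun i h1 h2 => hrow i (by simp only [InRow]; omega)⟩

/-- The propagation of `P (k+1) j` falsifies `C(k+1, k)` if this clause is available. The conflict
analysis is carried out up to the entry `P (k+1) j`. -/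
theorem Phase.ends_of_propagate (h : Phase n Γ j k q)
    (hK : Avail n Γ (k + 1) k) (hKmin : ∀ m, Avail n Γ (k + 1) m → k ≤ m)
    (hs : Situation j k q pr) (ht : t = ⟨pos (k + 1) j, lvl, some (prefixClause n j k)⟩)
    (hqu : ImpliedEntries k j q lvl qu)
    (hlevel : 0 < lvl → ∃ u, (1 ≤ u ∧ u ≤ k) ∧ u ≠ j ∧
      ∃ e ∈ pr, e.lit = negP u j ∧ e.level = lvl)
    (hlearn : ∀ qu', ImpliedEntries k j q lvl qu' → 0 < lvl →
      Ends n δ P (State.restart (Γ ++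
        [analyzeAux (pr ++ t :: qu') lvl pr.reverse (prefixClause n j (k - 1))])))
    (hunsat : lvl = 0 → ∀ s : State (ℕ × ℕ), s.learned = Γ → s.unsat = true → P s) :
    Ends n δ P ⟨Γ, pr, t :: qu, lvl, false⟩ := by
  have hj := h.one_le
  have hjk := h.le
  have hk := h.two_le
  have hkn := h.lt
  have htl : t.lit = pos (k + 1) j := by rw [ht]
  refine inevitable_of_head (ImpliedEntries k j q lvl) h.allPrefix.clauseVars_subset
    (fun qu c l hqu hc hv hu => h.impliedEntries_append hs htl hqu hc hv hu) ?_ ?_ qu hqu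
  · intro qu c hqu hc hf
    refine ⟨fun h0 => ?_, fun h0 => Inevitable.now _ (hunsat h0 _ rfl rfl)⟩
    obtain ⟨rfl, -, hall⟩ := h.eq_of_falsified hKmin hs htl hqu hc hf
    have hall' : ∀ i, 1 ≤ i → i ≤ k → Has qu (negP i (k + 1)) := by
      intro i h1 h2
      have := hall i h1 h2
      rw [has_append, has_cons, htl] at this
      rcases this with this | this | this
      · have hq2 : 0 < q → q ≤ k := fun h0 => (h.true_row h0).2.1
        have := hs.of_false _ _ this
        omega
      · simp at this
      · exact this
    have hrev : (pr ++ t :: qu).reverse = qu.reverse ++ t :: pr.reverse := by simp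
    rw [State.analyze, trail_mk, hrev]
    have := analyzeAux_block (tr := pr ++ t :: qu) (lvl := lvl) (j := j) (k := k) hk hjk
      ?_ ⟨t, by simp, htl, by rw [ht]⟩ ?_ (rest := pr.reverse) htl
      (r := prefixClause n j k) (c' := prefixClause n j (k - 1)) (by rw [ht]) ?_ ?_
      qu.reverse ?_ (reverse_pairwise_ne hqu.2) (prefixClause n (k + 1) k) ?_
    · dsimp only
      rw [this]
      exact hlearn qu hqu h0
    · intro i h1 h2
      obtain ⟨x, hx, hxl⟩ := hall' i h1 h2
      exact ⟨x, by simp [hx], hxl, (hqu.1 x hx).1⟩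
    · obtain ⟨u, h1, h2, e, he, hel⟩ := hlevel h0
      exact ⟨u, h1, h2, e, by simp [he], hel⟩
    · intro l
      rw [h.avail.mem]
      refine exists_congr fun i => ?_
      rw [← and_assoc]
      refine and_congr_left fun _ => ?_
      simp only [InRow]
      omega
    · intro l
      rw [mem_prefixClause hj (by omega) (by omega)]
      refine exists_congr fun i => ?_
      rw [← and_assoc]
      refine and_congr_left fun _ => ?_
      simp only [InRow]
      omega
    · intro e he
      rw [List.mem_reverse] at he
      refine (hqu.1 e he).2.imp_right fun ⟨h0, h1⟩ => ⟨q, (h.true_row h0).1, h1⟩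
    · intro l
      rw [hK.mem]
      constructor
      · rintro ⟨i, hi, rfl⟩
        simp only [InRow] at hi
        exact Or.inl ⟨i, by omega, has_reverse.2 (hall' i (by omega) (by omega)), rfl⟩
      · rintro (⟨i, hi, -, rfl⟩ | ⟨i, hi, hn, -⟩ | ⟨⟨i, hi, hn⟩, -⟩)
        · exact ⟨i, by simp only [InRow]; omega, rfl⟩
        · exact absurd (has_reverse.2 (hall' i hi.1 hi.2)) hn
        · exact absurd (has_reverse.2 (hall' i hi.1 hi.2)) hn
  · intro qu hqu hsat
    -- Saturation cannot be reached: by then all of `C(k+1, k)` would be false.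
    refine absurd ?_ (hsat.1 _ hK.database)
    intro l hl
    obtain ⟨i, hi, rfl⟩ := hK.mem.1 hl
    simp only [InRow] at hi
    exact h.has_of_saturated hs htl hqu hsat (by omega) (by omega)

/-- The analysis stops right after `P (k+1) j`: of the rows in `C(j, k-1)`, only the row `u`
falsified last has the current level. -/
theorem Phase.ends_of_conflict (h : Phase n Γ j k q)
    (hK : Avail n Γ (k + 1) k) (hKmin : ∀ m, Avail n Γ (k + 1) m → k ≤ m)
    (hs : Situation j k q pr) (hqu : ImpliedEntries k j q lvl qu)
    (hlevel : 0 < lvl → ∃ u, (1 ≤ u ∧ u ≤ k) ∧ u ≠ j ∧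
      (∃ e ∈ pr, e.lit = negP u j ∧ e.level = lvl) ∧
      ∀ i, i ≠ u → ∀ e ∈ pr, e.lit = negP i j → e.level < lvl)
    (hlearn : 0 < lvl → Ends n δ P (State.restart (Γ ++ [prefixClause n j (k - 1)])))
    (hunsat : lvl = 0 → ∀ s : State (ℕ × ℕ), s.learned = Γ → s.unsat = true → P s) :
    Ends n δ P ⟨Γ, pr, ⟨pos (k + 1) j, lvl, some (prefixClause n j k)⟩ :: qu, lvl, false⟩ := by
  refine h.ends_of_propagate hK hKmin hs rfl hqu
    (fun h0 => ?_) (fun qu hqu h0 => ?_) hunsat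
  · obtain ⟨u, h1, h2, h3, -⟩ := hlevel h0
    exact ⟨u, h1, h2, h3⟩
  · rw [analyzeAux_stop]
    · exact hlearn h0
    · obtain ⟨u, h1, h2, h3, hlt⟩ := hlevel h0
      have hjk := h.le
      have hkn := h.lt
      refine Finset.card_le_one_iff_subset_singleton.2 ⟨pos u j, fun l hl => ?_⟩
      rw [mem_literalsAtLevel, mem_prefixClause h.one_le (by omega) (by omega)] at hl
      obtain ⟨⟨i, hi, rfl⟩, e, he, hel, hev⟩ := hl
      rw [Finset.mem_singleton]
      by_contra hne
      have hiu : i ≠ u := by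
        rintro rfl
        exact hne rfl
      rw [List.mem_append, List.mem_cons] at he
      rcases he with he | rfl | he
      · have := hlt i hiu e he hel
        omega
      · simp at hel
      · have := hqu.has_negP ⟨e, he, hel⟩
        omega

end

end

/-! ## The conflict that goes through the last two columns -/

section

variable {n : ℕ} {δ : ℝ} {P : State (ℕ × ℕ) → Prop} {Γ : List (Clause (ℕ × ℕ))} {j k lvl : ℕ}
  {pr A : List (Entry (ℕ × ℕ))} {t g : Entry (ℕ × ℕ)}

/-- The stopping condition for a clause inside one column, used when the analysis has run through
two blocks. -/
theorem analyzeAux_of_levels {tr es : List (Entry (ℕ × ℕ))} {c : Clause (ℕ × ℕ)} {u : ℕ}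
    (hc : ∀ l ∈ c, ∃ i, l = pos i j)
    (hlt : ∀ i, i ≠ u → ∀ e ∈ tr, e.lit = negP i j → e.level ≠ lvl) :
    analyzeAux tr lvl es c = c := by
  refine analyzeAux_stop (Finset.card_le_one_iff_subset_singleton.2 ⟨pos u j, fun l hl => ?_⟩)
  rw [mem_literalsAtLevel] at hl
  obtain ⟨hl, e, he, hel, hev⟩ := hl
  obtain ⟨i, rfl⟩ := hc l hl
  rw [Finset.mem_singleton]
  by_contra hne
  exact hlt i (by rintro rfl; exact hne rfl) e he hel hev

/-- The phase in the analysis of which `P n (n-1)` plays the role of `P (k+1) j`. -/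
theorem Phase.shift (h : Phase n Γ j k 0) (hn : n = k + 2)
    (hpen : ∀ m, Avail n Γ (k + 1) m → m = k + 1) : Phase n Γ (k + 1) (k + 1) j := by
  have hj := h.one_le
  have hjk := h.le
  -- The new column is `k + 1 = n - 1` with its full clause. The true literal is now `P (k+1) j`, so
  -- `j` takes the place of `q`; a clause `C(j, m)` with `m ≥ k` contains row `k + 1`.
  refine ⟨h.allPrefix, by omega, le_rfl, by omega, by omega,
    ⟨by omega, by omega, Or.inl (by omega)⟩, fun m hm => (hpen m hm).ge,
    fun _ => ⟨by omega, by omega, fun m hm => ?_⟩,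
    fun b m hbm => Or.inl ((h.large b m hbm).resolve_right (by omega))⟩
  have := h.avail_min m hm
  simp only [InRow]
  omega

/-- The entries behind the literals implied by `P (n-1) j`, while these are propagated. -/
def PenultimateTail (k j lvl : ℕ) (g : Entry (ℕ × ℕ)) (x : List (Entry (ℕ × ℕ))) : Prop :=
  x = [] ∨ ∃ y, x = g :: y ∧ ImpliedEntries (k + 1) (k + 1) j lvl y ∧
    ∀ e ∈ y, ∃ i, (1 ≤ i ∧ i ≤ k) ∧ e.lit = negP i (k + 2)

theorem PenultimateTail.has_pos {x : List (Entry (ℕ × ℕ))} (h : PenultimateTail k j lvl g x)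
    (hg : g.lit = pos (k + 2) (k + 1)) {a b : ℕ} (hab : Has x (pos a b)) :
    (a = k + 2 ∧ b = k + 1) ∧ x ≠ [] := by
  rcases h with rfl | ⟨y, rfl, -, hy⟩
  · exact absurd hab has_nil
  · refine ⟨?_, by simp⟩
    rcases has_cons.1 hab with hab | ⟨e, he, hab⟩
    · rw [hg, pos_inj] at hab
      omega
    · obtain ⟨i, -, hi⟩ := hy e he
      simp [hi] at hab

theorem PenultimateTail.has_negP {x : List (Entry (ℕ × ℕ))} (h : PenultimateTail k j lvl g x)
    (hg : g.lit = pos (k + 2) (k + 1)) {a b : ℕ} (hab : Has x (negP a b)) :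
    (1 ≤ a ∧ a ≤ k) ∧ b = k + 2 := by
  rcases h with rfl | ⟨y, rfl, -, hy⟩
  · exact absurd hab has_nil
  · rcases has_cons.1 hab with hab | ⟨e, he, hab⟩
    · simp [hg] at hab
    · obtain ⟨i, hi, hi'⟩ := hy e he
      rw [hi', negP_inj] at hab
      omega

/-- The propagation of `P n (n-1)` falsifies column `n`. The first block of the analysis, at `P n
(n-1)`, yields `C(n-1, n-2)`; the second one, at `P (n-1) j`, turns this clause into `C(j, k-1)`. -/
theorem Phase.ends_of_last (h : Phase n Γ j k 0) (hn : n = k + 2)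
    (hpen : ∀ m, Avail n Γ (k + 1) m → m = k + 1)
    (hlast : ∀ m, Avail n Γ (k + 2) m → m = k + 1) (hs : Situation j k 0 pr)
    (ht : t = ⟨pos (k + 1) j, lvl, some (prefixClause n j k)⟩)
    (hg : g = ⟨pos (k + 2) (k + 1), lvl, some (prefixClause n (k + 1) (k + 1))⟩)
    (hA : ImpliedEntries k j 0 lvl A) (hAall : ∀ i, 1 ≤ i → i ≤ k → Has A (negP i (k + 1)))
    (hlevel : 0 < lvl → ∃ u, (1 ≤ u ∧ u ≤ k) ∧ u ≠ j ∧
      (∃ e ∈ pr, e.lit = negP u j ∧ e.level = lvl) ∧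
      ∀ i, i ≠ u → ∀ e ∈ pr, e.lit = negP i j → e.level < lvl)
    (hlearn : 0 < lvl → Ends n δ P (State.restart (Γ ++ [prefixClause n j (k - 1)])))
    (hunsat : lvl = 0 → ∀ s : State (ℕ × ℕ), s.learned = Γ → s.unsat = true → P s)
    {y : List (Entry (ℕ × ℕ))} (hy : ImpliedEntries (k + 1) (k + 1) j lvl y) :
    Ends n δ P ⟨Γ, pr ++ t :: A, g :: y, lvl, false⟩ := by
  have hj := h.one_le
  have hjk := h.le
  have hk := h.two_le
  have htl : t.lit = pos (k + 1) j := by rw [ht]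
  have h' := h.shift hn hpen
  have hs' : Situation (k + 1) (k + 1) j (pr ++ t :: A) := by
    refine ⟨fun a b => ?_, fun i b hib => ?_, fun i h1 h2 h3 => ?_⟩
    · constructor
      · intro hab
        have := hs.of_has_pos htl hA hab
        omega
      · rintro ⟨-, rfl, rfl⟩
        simp [has_append, has_cons, htl]
    · have := hs.of_has_negP htl hA hib
      omega
    · rw [has_append, has_cons]
      exact Or.inr (Or.inr (hAall i h1 (by omega)))
  have hAlevel : ∀ i, 1 ≤ i → i ≤ k → ∃ e ∈ A, e.lit = negP i (k + 1) ∧ e.level = lvl := by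
    intro i h1 h2
    obtain ⟨e, he, hel⟩ := hAall i h1 h2
    exact ⟨e, he, hel, (hA.1 e he).1⟩
  -- In the first block row 1 of column `k + 1` serves as the second literal of the level: the rows
  -- of this column up to `k` were all falsified at level `lvl`.
  refine h'.ends_of_propagate ⟨by omega, by omega, Or.inl (by omega)⟩
    (fun m hm => (hlast m hm).ge) hs' hg hy (fun _ => ⟨1, by omega, by omega, ?_⟩)
    (fun qu hqu h0 => ?_) hunsat
  · obtain ⟨e, he, hel⟩ := hAlevel 1 le_rfl (by omega)
    exact ⟨e, by simp [he], hel⟩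
  · obtain ⟨u, hu1, hu2, ⟨e, he, hel⟩, hlt⟩ := hlevel h0
    have hrev : (pr ++ t :: A).reverse = A.reverse ++ t :: pr.reverse := by simp
    have hc' : ∀ l, l ∈ prefixClause n j (k - 1) ↔
        ∃ i, (1 ≤ i ∧ i ≤ k) ∧ i ≠ j ∧ l = pos i j := by
      intro l
      rw [mem_prefixClause hj (by omega) (by omega)]
      refine exists_congr fun i => ?_
      rw [← and_assoc]
      refine and_congr_left fun _ => ?_
      simp only [InRow]
      omega
    rw [hrev, analyzeAux_block (j := j) (k := k) hk hjk ?_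
      ⟨t, by simp, htl, by rw [ht]⟩ ⟨u, hu1, hu2, e, by simp [he], hel⟩ htl
      (r := prefixClause n j k) (c' := prefixClause n j (k - 1)) (by rw [ht]) ?_ hc' A.reverse
      ?_ (reverse_pairwise_ne hA.2) _ ?_, analyzeAux_of_levels (j := j) (u := u)]
    · exact hlearn h0
    · intro l hl
      obtain ⟨i, -, -, rfl⟩ := (hc' l).1 hl
      exact ⟨i, rfl⟩
    · intro i hi e' he' hel'
      rw [List.mem_append, List.mem_append, List.mem_cons, List.mem_cons] at he'
      rcases he' with (he' | rfl | he') | rfl | he'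
      · exact (hlt i hi e' he' hel').ne
      · simp [htl] at hel'
      · have := hA.has_negP ⟨e', he', hel'⟩
        omega
      · simp [hg] at hel'
      · have := hqu.has_negP ⟨e', he', hel'⟩
        omega
    · intro i h1 h2
      obtain ⟨e, he, hel⟩ := hAlevel i h1 h2
      exact ⟨e, by simp [he], hel⟩
    · intro l
      rw [h.avail.mem]
      refine exists_congr fun i => ?_
      rw [← and_assoc]
      refine and_congr_left fun _ => ?_
      simp only [InRow]
      omega
    · intro e he
      rw [List.mem_reverse] at he
      exact (hA.1 e he).2.imp_right fun ⟨h0, h1⟩ => absurd h0 (lt_irrefl 0)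
    · intro l
      rw [mem_prefixClause (by omega) (by omega) (by omega)]
      constructor
      · rintro ⟨i, hi, rfl⟩
        simp only [InRow] at hi
        exact Or.inl ⟨i, by omega, has_reverse.2 (hAall i (by omega) (by omega)), by simp⟩
      · rintro (⟨i, hi, -, rfl⟩ | ⟨i, hi, hn, -⟩ | ⟨⟨i, hi, hn⟩, -⟩)
        · exact ⟨i, by simp only [InRow]; omega, rfl⟩
        · exact absurd (has_reverse.2 (hAall i hi.1 hi.2)) hn
        · exact absurd (has_reverse.2 (hAall i hi.1 hi.2)) hn

/-- All of `A` is on the trail, so in column `n - 1` only row `n` is open, and the first literal of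
`A` to be propagated forces `P n (n-1)`. With that literal on the trail, `¬P i (n-1)` also implies
`¬P i n` by transitivity. -/
theorem Phase.ends_of_penultimate_head (h : Phase n Γ j k 0) (hn : n = k + 2)
    (hpen : ∀ m, Avail n Γ (k + 1) m → m = k + 1)
    (hlast : ∀ m, Avail n Γ (k + 2) m → m = k + 1) (hs : Situation j k 0 pr)
    (htl : t.lit = pos (k + 1) j)
    (hg : g = ⟨pos (k + 2) (k + 1), lvl, some (prefixClause n (k + 1) (k + 1))⟩)
    (hA : ImpliedEntries k j 0 lvl A) (hAall : ∀ i, 1 ≤ i → i ≤ k → Has A (negP i (k + 1)))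
    {a : Entry (ℕ × ℕ)} {A₁ A₂ x : List (Entry (ℕ × ℕ))} (hsplit : A = A₁ ++ a :: A₂)
    (hx : PenultimateTail k j lvl g x)
    (hnext : ∀ y, PenultimateTail k j lvl g (g :: y) →
      Ends n δ P ⟨Γ, pr ++ t :: (A₁ ++ [a]), A₂ ++ g :: y, lvl, false⟩) :
    Ends n δ P ⟨Γ, pr ++ t :: A₁, a :: (A₂ ++ x), lvl, false⟩ := by
  have hj := h.one_le
  have hjk := h.le
  have hk := h.two_le
  have hgl : g.lit = pos (k + 2) (k + 1) := by rw [hg]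
  obtain ⟨i₀, hi₀, hal⟩ : ∃ i, (1 ≤ i ∧ i ≤ k) ∧ a.lit = negP i (k + 1) := by
    rcases (hA.1 a (by simp [hsplit])).2 with ⟨i, hi, h1, -⟩ | ⟨h0, -⟩
    · exact ⟨i, hi, h1⟩
    · omega
  have hhas : ∀ x l, Has (pr ++ t :: A₁ ++ a :: (A₂ ++ x)) l ↔ Has (pr ++ t :: A) l ∨ Has x l := by
    intro x l
    simp only [hsplit, has_append, has_cons]
    tauto
  have hpos : ∀ x, PenultimateTail k j lvl g x → ∀ a' b,
      Has (pr ++ t :: A₁ ++ a :: (A₂ ++ x)) (pos a' b) →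
      (a' = k + 1 ∧ b = j) ∨ ((a' = k + 2 ∧ b = k + 1) ∧ x ≠ []) := by
    intro x hx a' b hab
    rcases (hhas _ _).1 hab with hab | hab
    · have := hs.of_has_pos htl hA hab
      omega
    · exact Or.inr (hx.has_pos hgl hab)
  have hneg : ∀ x, PenultimateTail k j lvl g x → ∀ i b,
      Has (pr ++ t :: A₁ ++ a :: (A₂ ++ x)) (negP i b) →
      (1 ≤ i ∧ i ≤ k) ∧ ((b = j ∧ i ≠ j) ∨ b = k + 1 ∨ b = k + 2) := by
    intro x hx i b hib
    rcases (hhas _ _).1 hib with hib | hib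
    · have := hs.of_has_negP htl hA hib
      omega
    · have := hx.has_negP hgl hib
      omega
  have hrow : ∀ x i, 1 ≤ i → i ≤ k →
      Has (pr ++ t :: A₁ ++ a :: (A₂ ++ x)) (negP i (k + 1)) := by
    intro x i h1 h2
    rw [hhas, has_append, has_cons]
    exact Or.inl (Or.inr (Or.inr (hAall i h1 h2)))
  have hcolumn : Avail n Γ (k + 1) (k + 1) := ⟨by omega, by omega, Or.inl (by omega)⟩
  refine inevitable_of_quiet (fun qu => ∃ x, qu = A₂ ++ x ∧ PenultimateTail k j lvl g x)
    h.allPrefix.clauseVars_subset ?_ ?_ ?_ _ ⟨x, rfl, hx⟩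
  · rintro _ c l ⟨x, rfl, hx⟩ hc hv hu
    have hun : ¬ Has (pr ++ t :: A₁ ++ a :: (A₂ ++ x)) l ∧
        ¬ Has (pr ++ t :: A₁ ++ a :: (A₂ ++ x)) (neg l) := by
      have := hu.2.1
      rw [State.assigned_iff, not_or] at this
      exact this
    refine ⟨x ++ [⟨l, lvl, some c⟩], by simp, ?_⟩
    have hcons : ∀ l, Has (pr ++ t :: A₁ ++ a :: (A₂ ++ x)) l →
        ¬ Has (pr ++ t :: A₁ ++ a :: (A₂ ++ x)) (neg l) := by
      refine consistent_of fun a' b h1 h2 => ?_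
      have h1 := hpos x hx a' b h1
      have h2 := hneg x hx a' b h2
      omega
    rcases isUnit_cases_of_negP h.allPrefix hal hcons
        (h.noOpenSingle fun h0 => absurd h0 (lt_irrefl 0)) hc hv hu with
      ⟨z, rfl, rfl, h1⟩ | ⟨z, rfl, rfl, h1⟩ | ⟨m, i, hm, hi, hne, rfl, rfl, -⟩
    · have h1 := hpos x hx _ _ h1
      obtain ⟨hz, hx0⟩ : z = k + 2 ∧ x ≠ [] := by
        rcases h1 with h1 | h1
        · omega
        · exact ⟨h1.1.1, h1.2⟩
      subst hz
      rcases hx with rfl | ⟨y, rfl, hy, hy'⟩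
      · exact absurd rfl hx0
      · refine Or.inr ⟨_, rfl, ⟨?_, pairwise_append_singleton hy.2 fun hh => hun.1 ?_⟩, ?_⟩
        · intro e he
          rcases List.mem_append.1 he with he | he
          · exact hy.1 e he
          · rw [List.mem_singleton] at he
            subst he
            exact ⟨rfl, Or.inl ⟨i₀, by omega, rfl, Or.inr ⟨by omega, rfl⟩⟩⟩
        · rw [hhas, has_cons]
          exact Or.inr (Or.inr hh)
        · intro e he
          rcases List.mem_append.1 he with he | he
          · exact hy' e he
          · rw [List.mem_singleton] at he
            subst he
            exact ⟨i₀, hi₀, rfl⟩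
    · have h1 := hpos x hx _ _ h1
      omega
    · obtain rfl := hpen m hm
      have hik : i = k + 2 := by
        simp only [InRow] at hi
        by_contra hik
        exact hun.2 (hrow x i (by omega) (by omega))
      subst hik
      rcases hx with rfl | ⟨y, rfl, -, -⟩
      · exact Or.inr ⟨[], by rw [hg]; rfl, ⟨by simp, List.Pairwise.nil⟩, by simp⟩
      · exact absurd ((hhas _ _).2 (Or.inr (has_cons.2 (Or.inl hgl)))) hun.1
  · rintro _ c ⟨x, rfl, hx⟩ hc
    refine not_falsified (s := ⟨Γ, pr ++ t :: A₁, a :: (A₂ ++ x), lvl, false⟩) h.allPrefix rfl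
      ?_ ?_ ?_ hc
    · intro a' b d h1 h2 h3
      have h1 := hpos x hx _ _ h1
      have h2 := hpos x hx _ _ h2
      have h3 := hneg x hx _ _ h3
      omega
    · intro a' b h1 h2
      have h1 := hpos x hx _ _ h1
      have h2 := hpos x hx _ _ h2
      omega
    · intro b m hbm
      have hex : ∃ i, InRow b m i ∧ ¬ ((1 ≤ i ∧ i ≤ k) ∧ ((b = j ∧ i ≠ j) ∨ b = k + 1 ∨
          b = k + 2)) := by
        by_cases hbj : b = j
        · subst hbj
          have := h.avail_min m hbm
          exact ⟨k + 1, by simp only [InRow]; omega, by omega⟩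
        · by_cases hb1 : b = k + 1
          · subst hb1
            have := hpen m hbm
            exact ⟨k + 2, by simp only [InRow]; omega, by omega⟩
          · by_cases hb2 : b = k + 2
            · subst hb2
              have := hlast m hbm
              exact ⟨k + 1, by simp only [InRow]; omega, by omega⟩
            · obtain ⟨i, -, hi, -⟩ :=
                exists_two_rows (b := b) ((h.large b m hbm).resolve_right (by omega))
              exact ⟨i, hi, by omega⟩
      obtain ⟨i, hi, hni⟩ := hex
      exact ⟨i, hi, fun hh => hni (hneg x hx i b hh)⟩
  · rintro _ ⟨x, rfl, hx⟩ hsat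
    have key := hsat.assigned (c := prefixClause n (k + 1) (k + 1)) (l := pos (k + 2) (k + 1))
      hcolumn.database (Or.inr ⟨a, _, rfl, by
        rw [hal, neg_negP, hcolumn.mem]
        exact ⟨i₀, by simp only [InRow]; omega, rfl⟩⟩)
      (hcolumn.mem.2 ⟨k + 2, ⟨by omega, by omega, Or.inr ⟨rfl, le_rfl⟩⟩, rfl⟩) (by
        intro m hm hne
        obtain ⟨i, hi, rfl⟩ := hcolumn.mem.1 hm
        simp only [ne_eq, pos_inj, and_true] at hne
        simp only [InRow] at hi
        exact hrow x i (by omega) (by omega))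
    have hx0 : x ≠ [] := by
      rcases key with key | key
      · have := hpos x hx _ _ key
        rcases this with h1 | h1
        · omega
        · exact h1.2
      · have := hneg x hx _ _ key
        omega
    rcases hx with rfl | ⟨y, rfl, hy⟩
    · exact absurd rfl hx0
    · have := hnext y (Or.inr ⟨y, rfl, hy⟩)
      simpa using this

/-- The queue is first in, first out: `g` waits until all of `A` has been propagated, and some
literals `¬P i n` are derived before the turn of `g`. -/
theorem Phase.ends_of_penultimate (h : Phase n Γ j k 0) (hn : n = k + 2)
    (hpen : ∀ m, Avail n Γ (k + 1) m → m = k + 1)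
    (hlast : ∀ m, Avail n Γ (k + 2) m → m = k + 1) (hs : Situation j k 0 pr)
    (htl : t.lit = pos (k + 1) j)
    (hg : g = ⟨pos (k + 2) (k + 1), lvl, some (prefixClause n (k + 1) (k + 1))⟩)
    (hA : ImpliedEntries k j 0 lvl A) (hAall : ∀ i, 1 ≤ i → i ≤ k → Has A (negP i (k + 1)))
    (hnext : ∀ y, ImpliedEntries (k + 1) (k + 1) j lvl y →
      Ends n δ P ⟨Γ, pr ++ t :: A, g :: y, lvl, false⟩)
    (a : Entry (ℕ × ℕ)) (A₁ A₂ x : List (Entry (ℕ × ℕ))) (hsplit : A = A₁ ++ a :: A₂)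
    (hx : PenultimateTail k j lvl g x) :
    Ends n δ P ⟨Γ, pr ++ t :: A₁, a :: (A₂ ++ x), lvl, false⟩ := by
  induction A₂ generalizing a A₁ x with
  | nil =>
    refine h.ends_of_penultimate_head hn hpen hlast hs htl hg hA hAall hsplit hx fun y hy => ?_
    rcases hy with hy | ⟨y', hy, hy', -⟩
    · simp at hy
    · obtain ⟨-, rfl⟩ := List.cons.inj hy
      rw [← hsplit]
      exact hnext y hy'
  | cons a' A₂ ih =>
    refine h.ends_of_penultimate_head hn hpen hlast hs htl hg hA hAall hsplit hx fun y hy => ?_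
    exact ih a' (A₁ ++ [a]) (g :: y) (by simp [hsplit]) hy

/-- The conflict if `k + 1 = n - 1`: the propagation of `P (n-1) j` implies `P n (n-1)`, whose
propagation falsifies column `n`. -/
theorem Phase.ends_of_conflict_last (h : Phase n Γ j k 0) (hn : n = k + 2)
    (hpen : ∀ m, Avail n Γ (k + 1) m → m = k + 1)
    (hlast : ∀ m, Avail n Γ (k + 2) m → m = k + 1) (hs : Situation j k 0 pr)
    {qu : List (Entry (ℕ × ℕ))} (hqu : ImpliedEntries k j 0 lvl qu)
    (hlevel : 0 < lvl → ∃ u, (1 ≤ u ∧ u ≤ k) ∧ u ≠ j ∧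
      (∃ e ∈ pr, e.lit = negP u j ∧ e.level = lvl) ∧
      ∀ i, i ≠ u → ∀ e ∈ pr, e.lit = negP i j → e.level < lvl)
    (hlearn : 0 < lvl → Ends n δ P (State.restart (Γ ++ [prefixClause n j (k - 1)])))
    (hunsat : lvl = 0 → ∀ s : State (ℕ × ℕ), s.learned = Γ → s.unsat = true → P s) :
    Ends n δ P ⟨Γ, pr, ⟨pos (k + 1) j, lvl, some (prefixClause n j k)⟩ :: qu, lvl, false⟩ := by
  have hj := h.one_le
  have hjk := h.le
  have hk := h.two_le
  set t : Entry (ℕ × ℕ) := ⟨pos (k + 1) j, lvl, some (prefixClause n j k)⟩ with ht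
  have htl : t.lit = pos (k + 1) j := rfl
  refine inevitable_of_quiet (ImpliedEntries k j 0 lvl) h.allPrefix.clauseVars_subset
    (fun qu c l hqu hc hv hu => h.impliedEntries_append hs htl hqu hc hv hu) ?_ ?_ qu
    hqu
  · intro qu c hqu hc hf
    have := (h.eq_of_falsified (fun m hm => by have := hpen m hm; omega) hs htl hqu hc hf).2.1
    have := hpen k this
    omega
  · intro A hA hsat
    have hAall : ∀ i, 1 ≤ i → i ≤ k → Has A (negP i (k + 1)) := by
      intro i h1 h2
      have := h.has_of_saturated hs htl hA hsat h1 h2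
      rw [has_append, has_cons, htl] at this
      rcases this with this | this | this
      · have := hs.of_false _ _ this
        omega
      · simp at this
      · exact this
    obtain ⟨a, A₂, rfl⟩ : ∃ a A₂, A = a :: A₂ := by
      cases A with
      | nil => exact absurd (hAall 1 le_rfl (by omega)) has_nil
      | cons a A₂ => exact ⟨a, A₂, rfl⟩
    have := h.ends_of_penultimate (δ := δ) (P := P) hn hpen hlast hs htl rfl hA hAall
      (fun y hy => h.ends_of_last hn hpen hlast hs ht rfl hA hAall hlevel hlearn hunsat hy)
      a [] A₂ [] rfl (Or.inl rfl)
    simpa using this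

end

/-! ## Propagation and branching before the conflict -/

section

variable {n : ℕ} {δ : ℝ} {P : State (ℕ × ℕ) → Prop} {Γ : List (Clause (ℕ × ℕ))} {lvl : ℕ}
  {pr qu : List (Entry (ℕ × ℕ))}

/-- With an empty queue only single-literal clauses are visited, and `NoOpenSingle` provides a true
literal in them. -/
theorem saturated_of_queue_nil (hΓ : AllPrefix n Γ)
    (hcons : ∀ a b, Has pr (pos a b) → ¬ Has pr (negP a b)) (hsing : NoOpenSingle n Γ pr)
    (hfalse : ∀ c, (State.mk Γ pr [] lvl false).Database (formula n) c →
      ¬ (State.mk Γ pr [] lvl false).Falsified c) :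
    (State.mk Γ pr [] lvl false).Saturated (formula n) := by
  refine ⟨hfalse, fun c l hc hv hu => ?_⟩
  have hv1 : c.card = 1 := by
    rcases hv with hv | ⟨e, rest, hq, -⟩
    · exact hv
    · cases hq
  rcases database_cases hΓ hc with ⟨a, b, d, -, -, -, -, rfl⟩ | ⟨a, b, -, -, hab, rfl⟩ |
    ⟨b, m, hbm, rfl⟩
  · exact transClause_card_ne_one hv1
  · exact antiClause_card_ne_one hab hv1
  · rcases hsing b m hbm with hm | ⟨i, hi, hh⟩
    · exact prefixClause_card_ne_one hbm hm hv1
    · refine not_has_of_isUnit (s := ⟨Γ, pr, [], lvl, false⟩) ?_ hu (hbm.mem.2 ⟨i, hi, rfl⟩) ?_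
      · rw [trail_mk, List.append_nil]
        exact consistent_of hcons
      · rw [trail_mk, List.append_nil]
        exact hh

/-- A false literal whose propagation implies nothing. -/
theorem ends_of_quiet_negP (hΓ : AllPrefix n Γ) {v : Entry (ℕ × ℕ)} {x y : ℕ}
    (hv : v.lit = negP x y)
    (hcons : ∀ a b, Has (pr ++ v :: qu) (pos a b) → ¬ Has (pr ++ v :: qu) (negP a b))
    (hsing : NoOpenSingle n Γ (pr ++ [v]))
    (hfalse : ∀ c, (State.mk Γ pr (v :: qu) lvl false).Database (formula n) c →
      ¬ (State.mk Γ pr (v :: qu) lvl false).Falsified c)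
    (hcol : ∀ z, ¬ Has (pr ++ v :: qu) (pos z y)) (hrow : ∀ z, ¬ Has (pr ++ v :: qu) (pos x z))
    (hpre : ∀ m, Avail n Γ y m → ∃ i i', i ≠ i' ∧ InRow y m i ∧ InRow y m i' ∧
      ¬ Has (pr ++ v :: qu) (negP i y) ∧ ¬ Has (pr ++ v :: qu) (negP i' y))
    (hnext : Ends n δ P ⟨Γ, pr ++ [v], qu, lvl, false⟩) :
    Ends n δ P ⟨Γ, pr, v :: qu, lvl, false⟩ := by
  refine inevitable_of_quiet (fun qu' => qu' = qu) hΓ.clauseVars_subset ?_ ?_ ?_ qu rfl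
  · rintro _ c l rfl hc hvis hu
    exfalso
    rcases isUnit_cases_of_negP hΓ hv (consistent_of hcons) hsing hc hvis hu with
      ⟨z, -, -, h⟩ | ⟨z, -, -, h⟩ | ⟨m, i, hm, -, -, -, -, h⟩
    · exact hcol z h
    · exact hrow z h
    · obtain ⟨i₁, i₂, hne, h1, h2, h3, h4⟩ := hpre m hm
      by_cases hi : i₁ = i
      · exact h4 (h i₂ h2 (fun hh => hne (hi.trans hh.symm)))
      · exact h3 (h i₁ h1 hi)
  · rintro _ c rfl hc
    exact hfalse c hc
  · rintro _ rfl -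
    exact hnext

/-- The propagation of the last but one variable of `C(p, m)` implies the last one, `P w p`. -/
theorem ends_of_forced (hΓ : AllPrefix n Γ) {p w m₀ q u : ℕ} (hpw : p ≠ w)
    (hav : Avail n Γ p m₀) (hrows : ∀ i, InRow p m₀ i ↔ 1 ≤ i ∧ i ≤ w ∧ i ≠ p)
    (hmore : ∀ m, Avail n Γ p m → m ≠ m₀ → InRow p m w ∧ ∃ i, w < i ∧ InRow p m i)
    (hlarge : ∀ b m, Avail n Γ b m → 2 ≤ m ∨ (0 < q ∧ b = q))
    (hq : 0 < q → q ≠ p ∧ q ≠ w ∧ ∀ m, Avail n Γ q m → InRow q m p)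
    (hu1 : 1 ≤ u) (huw : u < w) (hup : u ≠ p) (hpn : p ≤ n) (hp1 : 1 ≤ p) (hwn : w ≤ n)
    {v : Entry (ℕ × ℕ)} (hv : v.lit = negP u p)
    (hT : ∀ a b, Has pr (pos a b) ↔ 0 < q ∧ a = p ∧ b = q)
    (hF : ∀ i b, Has (pr ++ [v]) (negP i b) →
      (1 ≤ i ∧ i < w) ∧ i ≠ p ∧ (b = p ∨ (0 < q ∧ b = q ∧ i ≠ q)))
    (hFp : ∀ i, 1 ≤ i → i < w → i ≠ p → Has (pr ++ [v]) (negP i p))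
    (hnext : ∀ y, y = [] ∨ y = [⟨negP u w, lvl, some (transClause u w p)⟩] →
      Ends n δ P ⟨Γ, pr ++ [v], ⟨pos w p, lvl, some (prefixClause n p m₀)⟩ :: y, lvl, false⟩) :
    Ends n δ P ⟨Γ, pr, [v], lvl, false⟩ := by
  set τ : Entry (ℕ × ℕ) := ⟨pos w p, lvl, some (prefixClause n p m₀)⟩ with hτ
  set ε : Entry (ℕ × ℕ) := ⟨negP u w, lvl, some (transClause u w p)⟩ with hε
  -- Besides `P w p`, the literal `¬P u w` may appear: it follows from `P w p` and `¬P u p` while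
  -- the latter is still being propagated. Its absence at the end need not be excluded.
  let I : List (Entry (ℕ × ℕ)) → Prop := fun y => y = [] ∨ y = [τ] ∨ y = [τ, ε]
  have hhas : ∀ y l, Has (pr ++ v :: y) l ↔ Has (pr ++ [v]) l ∨ Has y l := by
    intro y l
    have := has_nil (l := l)
    simp only [has_append, has_cons]
    tauto
  have hpos : ∀ y, I y → ∀ a b, Has (pr ++ v :: y) (pos a b) →
      (0 < q ∧ a = p ∧ b = q) ∨ (a = w ∧ b = p ∧ y ≠ []) := by
    intro y hy a b hab
    rw [has_append, has_cons, hT, hv] at hab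
    rcases hab with hab | hab | hab
    · exact Or.inl hab
    · simp at hab
    · rcases hy with rfl | rfl | rfl
      · exact absurd hab has_nil
      all_goals
        simp [Has, hτ, hε] at hab
        exact Or.inr ⟨hab.1.symm, hab.2.symm, by simp⟩
  have hneg : ∀ y, I y → ∀ i b, Has (pr ++ v :: y) (negP i b) →
      (1 ≤ i ∧ i < w) ∧ i ≠ p ∧ (b = p ∨ (0 < q ∧ b = q ∧ i ≠ q) ∨ (b = w ∧ i = u)) := by
    intro y hy i b hib
    rw [hhas] at hib
    rcases hib with hib | hib
    · have := hF i b hib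
      tauto
    · rcases hy with rfl | rfl | rfl
      · exact absurd hib has_nil
      · simp [Has, hτ] at hib
      · simp [Has, hτ, hε] at hib
        omega
  have hcons : ∀ y, I y → ∀ a b, Has (pr ++ v :: y) (pos a b) →
      ¬ Has (pr ++ v :: y) (negP a b) := by
    intro y hy a b h1 h2
    have h1 := hpos y hy a b h1
    have h2 := hneg y hy a b h2
    omega
  have hq' : 0 < q → q ≠ p ∧ q ≠ w := fun h0 => ⟨(hq h0).1, (hq h0).2.1⟩
  have hsing : NoOpenSingle n Γ (pr ++ [v]) := by
    intro b m hbm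
    rcases hlarge b m hbm with hm | ⟨h0, rfl⟩
    · exact Or.inl hm
    · exact Or.inr ⟨p, (hq h0).2.2 m hbm, has_append.2 (Or.inl ((hT p b).2 ⟨h0, rfl, rfl⟩))⟩
  refine inevitable_of_quiet I hΓ.clauseVars_subset ?_ ?_ ?_ [] (Or.inl rfl)
  · intro y c l hy hc hvis hu
    have hun : ¬ Has (pr ++ v :: y) l ∧ ¬ Has (pr ++ v :: y) (neg l) := by
      have := hu.2.1
      rw [State.assigned_iff, not_or] at this
      exact this
    rcases isUnit_cases_of_negP hΓ hv (consistent_of (hcons y hy)) hsing hc hvis hu with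
      ⟨z, rfl, rfl, h⟩ | ⟨z, rfl, rfl, h⟩ | ⟨m, i, hm, hi, hne, rfl, rfl, h⟩
    · have h := hpos y hy _ _ h
      obtain ⟨hz, hy0⟩ : z = w ∧ y ≠ [] := by
        rcases h with h | h
        · have := hq' h.1
          omega
        · exact ⟨h.1, h.2.2⟩
      subst hz
      rcases hy with rfl | rfl | rfl
      · exact absurd rfl hy0
      · exact Or.inr (Or.inr rfl)
      · refine absurd ?_ hun.1
        simp [has_append, has_cons, hε]
    · have h := hpos y hy _ _ h
      omega
    · have hiw : w ≤ i := by
        by_contra hlt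
        refine hun.2 ((hhas _ _).2 (Or.inl (hFp i hi.1 (by omega) hi.2.1)))
      -- Any other clause of column `p` has two rows that are not false, `w` and one beyond it, and
      -- so is not unit.
      have hm0 : m = m₀ := by
        by_contra hm0
        obtain ⟨h1, i', hi', h2⟩ := hmore m hm hm0
        by_cases hii : i = w
        · have := hneg y hy _ _ (h i' h2 (by omega))
          omega
        · have := hneg y hy _ _ (h w h1 (by omega))
          omega
      subst hm0
      have hiw' : i = w := by
        have := (hrows i).1 hi
        omega
      subst hiw'
      rcases hy with rfl | rfl | rfl
      · exact Or.inr (Or.inl rfl)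
      all_goals
        refine absurd ?_ hun.1
        simp [has_append, has_cons, hτ]
  · intro y c hy hc
    refine not_falsified (s := ⟨Γ, pr, v :: y, lvl, false⟩) hΓ rfl ?_ ?_ ?_ hc
    · intro a b d h1 h2 h3
      have h1 := hpos y hy _ _ h1
      have h2 := hpos y hy _ _ h2
      have h3 := hneg y hy _ _ h3
      omega
    · intro a b h1 h2
      have h1 := hpos y hy _ _ h1
      have h2 := hpos y hy _ _ h2
      omega
    · intro b m hbm
      by_cases hbp : b = p
      · subst hbp
        refine ⟨w, ?_, fun hh => ?_⟩
        · by_cases hm0 : m = m₀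
          · subst hm0
            exact (hrows w).2 (by omega)
          · exact (hmore m hbm hm0).1
        · have := hneg y hy _ _ hh
          omega
      · by_cases hbq : 0 < q ∧ b = q
        · obtain ⟨h0, rfl⟩ := hbq
          refine ⟨p, (hq h0).2.2 m hbm, fun hh => ?_⟩
          have := hneg y hy _ _ hh
          omega
        · obtain ⟨i, hi, hiu⟩ := exists_row_ne (b := b) ((hlarge b m hbm).resolve_right hbq) u
          refine ⟨i, hi, fun hh => ?_⟩
          have := hneg y hy _ _ hh
          omega
  · intro y hy hsat
    have key := hsat.assigned (c := prefixClause n p m₀) (l := pos w p) hav.database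
      (Or.inr ⟨v, _, rfl, by
        rw [hv, neg_negP, hav.mem]
        exact ⟨u, (hrows u).2 (by omega), rfl⟩⟩)
      (hav.mem.2 ⟨w, (hrows w).2 (by omega), rfl⟩) (by
        intro m hm hne
        obtain ⟨i, hi, rfl⟩ := hav.mem.1 hm
        simp only [ne_eq, pos_inj, and_true] at hne
        have := (hrows i).1 hi
        exact (hhas _ _).2 (Or.inl (hFp i (by omega) (by omega) (by omega))))
    rcases hy with rfl | rfl | rfl
    · exfalso
      rcases key with key | key
      · have := hpos [] (Or.inl rfl) _ _ key
        rcases this with h | h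
        · omega
        · exact h.2.2 rfl
      · have := hneg [] (Or.inl rfl) _ _ key
        omega
    · exact hnext [] (Or.inl rfl)
    · exact hnext [ε] (Or.inr rfl)

end

/-! ## Descending along a column -/

section

variable {n : ℕ} {δ : ℝ} {P : State (ℕ × ℕ) → Prop} {Γ : List (Clause (ℕ × ℕ))} {j k q lvl : ℕ}
  {pr qu : List (Entry (ℕ × ℕ))}

/-- The way in which `P (k+1) j` leads to a conflict: either `C(k+1, k)` is available, or
`k + 1 = n - 1` and no clause has been learned in the last two columns. -/
def Closing (n : ℕ) (Γ : List (Clause (ℕ × ℕ))) (k q : ℕ) : Prop :=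
  (Avail n Γ (k + 1) k ∧ ∀ m, Avail n Γ (k + 1) m → k ≤ m) ∨
    (q = 0 ∧ n = k + 2 ∧ (∀ m, Avail n Γ (k + 1) m → m = k + 1) ∧
      ∀ m, Avail n Γ (k + 2) m → m = k + 1)

/-- When the last of the variables `P i j` with `i ≤ k` has become false, the solver learns
`C(j, k-1)`. -/
theorem Phase.ends_of_last_false (h : Phase n Γ j k q) (hK : Closing n Γ k q) {u : ℕ}
    (hu1 : 1 ≤ u) (huk : u ≤ k) (huj : u ≠ j) {v : Entry (ℕ × ℕ)} (hv : v.lit = negP u j)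
    (hvl : v.level = lvl) (hs : Situation j k q (pr ++ [v]))
    (hlevel : 0 < lvl → ∀ i, i ≠ u → ∀ e ∈ pr, e.lit = negP i j → e.level < lvl)
    (hlearn : 0 < lvl → Ends n δ P (State.restart (Γ ++ [prefixClause n j (k - 1)])))
    (hunsat : lvl = 0 → ∀ s : State (ℕ × ℕ), s.learned = Γ → s.unsat = true → P s) :
    Ends n δ P ⟨Γ, pr, [v], lvl, false⟩ := by
  have hj := h.one_le
  have hjk := h.le
  have hkn := h.lt
  have hlevel' : 0 < lvl → ∃ u, (1 ≤ u ∧ u ≤ k) ∧ u ≠ j ∧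
      (∃ e ∈ pr ++ [v], e.lit = negP u j ∧ e.level = lvl) ∧
      ∀ i, i ≠ u → ∀ e ∈ pr ++ [v], e.lit = negP i j → e.level < lvl := by
    refine fun h0 => ⟨u, ⟨hu1, huk⟩, huj, ⟨v, by simp, hv, hvl⟩, fun i hi e he hel => ?_⟩
    rcases List.mem_append.1 he with he | he
    · exact hlevel h0 i hi e he hel
    · rw [List.mem_singleton] at he
      subst he
      rw [hv, negP_inj] at hel
      exact absurd hel.1.symm hi
  refine ends_of_forced h.allPrefix (p := j) (w := k + 1) (m₀ := k) (q := q) (u := u) (by omega)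
    h.avail (fun i => ?_) (fun m hm hne => ?_) h.large
    (fun h0 => ⟨(h.true_row h0).1, ?_, (h.true_row h0).2.2⟩) hu1 (by omega) huj (by omega) hj
    (by omega) hv (fun a b => ?_) (fun i b hib => ?_) (fun i h1 h2 h3 => ?_) (fun y hy => ?_)
  · simp only [InRow]
    omega
  · have := h.avail_min m hm
    exact ⟨by simp only [InRow]; omega, k + 2, by omega, by simp only [InRow]; omega⟩
  · have := (h.true_row h0).2.1
    omega
  · rw [← hs.true_iff, has_append, has_cons, hv]
    have := has_nil (l := pos a b)
    have := negP_ne_pos (i := u) (j := j) (a := a) (b := b)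
    tauto
  · have := hs.of_false i b hib
    omega
  · exact hs.false_col i h1 (by omega) h3
  · have hy' : ImpliedEntries k j q lvl y := by
      rcases hy with rfl | rfl
      · exact ⟨by simp, List.Pairwise.nil⟩
      · refine ⟨fun x hx => ?_, List.pairwise_singleton _ _⟩
        rw [List.mem_singleton] at hx
        subst hx
        exact ⟨rfl, Or.inl ⟨u, ⟨hu1, huk⟩, rfl, Or.inr ⟨huj, rfl⟩⟩⟩
    rcases hK with ⟨hK, hKmin⟩ | ⟨rfl, hn, hpen, hlast⟩
    · exact h.ends_of_conflict hK hKmin hs hy' hlevel' hlearn hunsat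
    · exact h.ends_of_conflict_last hn hpen hlast hs hy' hlevel' hlearn hunsat

/-- The first `r` variables of column `p`, as far as they are unassigned, are those on which the
solver branches, in order. -/
def BranchOrder (n : ℕ) (δ : ℝ) (Γ : List (Clause (ℕ × ℕ))) (p r : ℕ) : Prop :=
  ∀ a, 1 ≤ a → a ≤ r → a ≠ p → ∀ y ∈ formulaVars (formula n), (y.2 ≠ p ∨ a < y.1) →
    score δ Γ y < score δ Γ (a, p) ∨ (score δ Γ y = score δ Γ (a, p) ∧ columnMajor (a, p) y)

/-- `BranchOrder` compares row `a` only with other columns and with later rows; the earlier rows are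
out of the question because they are assigned. -/
theorem ends_of_branch {p r a : ℕ} (hbr : BranchOrder n δ Γ p r) (hp1 : 1 ≤ p) (hpn : p ≤ n)
    (hrn : r ≤ n) (ha1 : 1 ≤ a) (har : a ≤ r) (hap : a ≠ p)
    (hsat : (State.mk Γ pr [] lvl false).Saturated (formula n))
    (hun : ¬ Has pr (pos a p) ∧ ¬ Has pr (negP a p))
    (hbefore : ∀ b, 1 ≤ b → b < a → b ≠ p → Has pr (pos b p) ∨ Has pr (negP b p))
    (hnext : Ends n δ P ⟨Γ, pr, [⟨negP a p, lvl + 1, none⟩], lvl + 1, false⟩) :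
    Ends n δ P ⟨Γ, pr, [], lvl, false⟩ := by
  have hassigned : ∀ b p, (State.mk Γ pr [] lvl false).Assigned (b, p) ↔
      Has pr (pos b p) ∨ Has pr (negP b p) := by
    intro b p
    have := State.assigned_iff (s := ⟨Γ, pr, [], lvl, false⟩) (l := pos b p)
    rw [trail_mk, List.append_nil] at this
    exact this
  refine inevitable_of_decide (x := (a, p)) ?_ hsat ⟨?_, ?_, ?_⟩ hnext
  · rintro ⟨a, b⟩ ⟨c, d⟩ h1 h2
    simp only [columnMajor] at h1 h2
    omega
  · rw [mem_formulaVars]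
    dsimp only
    omega
  · rw [hassigned]
    tauto
  · rintro ⟨b, c⟩ hy hyun hne
    refine hbr a ha1 har hap _ hy ?_
    by_contra hcon
    push Not at hcon
    dsimp only at hcon
    obtain ⟨rfl, hba⟩ := hcon
    have hba' : b ≠ a := by
      rintro rfl
      exact hne rfl
    rw [mem_formulaVars] at hy
    dsimp only at hy
    exact hyun ((hassigned _ _).2 (hbefore b (by omega) (by omega) (by omega)))

/-- As long as no literal is true, the solver falsifies the variables of a column in order, until
only one variable of the shortest available clause of this column is left, `P w p`. -/
theorem ends_of_descent (hΓ : AllPrefix n Γ) {p w u r : ℕ} (hbr : BranchOrder n δ Γ p r)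
    (hp1 : 1 ≤ p) (hpn : p ≤ n) (hrn : r ≤ n)
    (hrows : ∀ m, Avail n Γ p m → ∀ i, 1 ≤ i → i ≤ w → i ≠ p → InRow p m i)
    (hlarge : ∀ b m, Avail n Γ b m → 2 ≤ m)
    (huw : u < w) (hup : u ≠ p) (hwp : w ≠ p) (hur : u ≤ r)
    (hnext : ∀ pr lvl, (∀ l, Has pr l ↔ ∃ i, (1 ≤ i ∧ i < u) ∧ i ≠ p ∧ l = negP i p) →
      (∀ e ∈ pr, e.level ≤ lvl) →
      Ends n δ P ⟨Γ, pr, [⟨negP u p, lvl + 1, none⟩], lvl + 1, false⟩)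
    {a : ℕ} (ha1 : 1 ≤ a) (hau : a ≤ u)
    (hpr : ∀ l, Has pr l ↔ ∃ i, (1 ≤ i ∧ i < a) ∧ i ≠ p ∧ l = negP i p)
    (hlevel : ∀ e ∈ pr, e.level ≤ lvl) :
    Ends n δ P ⟨Γ, pr, [], lvl, false⟩ := by
  induction hN : u - a using Nat.strong_induction_on generalizing a pr lvl with
  | _ N ih =>
  -- There is no variable in row `p` of column `p`; this row takes no decision.
  by_cases hap : a = p
  · refine ih (u - (a + 1)) (by omega) (a := a + 1) (by omega) (by omega) (fun l => ?_) hlevel rfl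
    rw [hpr]
    refine exists_congr fun i => ?_
    rw [← and_assoc, ← and_assoc]
    refine and_congr_left fun _ => ?_
    omega
  have hT : ∀ x y, ¬ Has pr (pos x y) := by
    intro x y hh
    obtain ⟨i, -, -, hh⟩ := (hpr _).1 hh
    exact pos_ne_negP hh
  have hF : ∀ x y, Has pr (negP x y) → (1 ≤ x ∧ x < a) ∧ x ≠ p ∧ y = p := by
    intro x y hh
    obtain ⟨i, h1, h2, hh⟩ := (hpr _).1 hh
    rw [negP_inj] at hh
    omega
  have hdb : ∀ b m, Avail n Γ b m → ∃ i, InRow b m i ∧ (b = p → i = w) := by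
    intro b m hbm
    by_cases hbp : b = p
    · subst hbp
      exact ⟨w, hrows m hbm w (by omega) le_rfl hwp, fun _ => rfl⟩
    · obtain ⟨i, -, hi, -⟩ := exists_two_rows (b := b) (hlarge b m hbm)
      exact ⟨i, hi, fun hh => absurd hh hbp⟩
  refine ends_of_branch hbr hp1 hpn hrn ha1 (by omega) hap ?_ ⟨hT a p, fun hh => ?_⟩ ?_ ?_
  · refine saturated_of_queue_nil hΓ (fun x y h => absurd h (hT x y))
      (fun b m hbm => Or.inl (hlarge b m hbm)) fun c hc =>
      not_falsified (s := ⟨Γ, pr, [], lvl, false⟩) hΓ rfl ?_ ?_ ?_ hc <;>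
      simp only [trail_mk, List.append_nil]
    · exact fun x y z h => absurd h (hT x y)
    · exact fun x y h => absurd h (hT x y)
    · intro b m hbm
      obtain ⟨i, hi, hiw⟩ := hdb b m hbm
      refine ⟨i, hi, fun hh => ?_⟩
      have := hF _ _ hh
      have := hiw this.2.2
      omega
  · have := hF _ _ hh
    omega
  · intro b hb1 hba hbp
    exact Or.inr ((hpr _).2 ⟨b, ⟨hb1, hba⟩, hbp, rfl⟩)
  · rcases hau.eq_or_lt with rfl | hau
    · exact hnext pr lvl hpr hlevel
    · set v : Entry (ℕ × ℕ) := ⟨negP a p, lvl + 1, none⟩ with hv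
      have hhas : ∀ l, Has (pr ++ [v]) l ↔ ∃ i, (1 ≤ i ∧ i < a + 1) ∧ i ≠ p ∧ l = negP i p := by
        intro l
        rw [has_append, has_cons, hpr]
        constructor
        · rintro (⟨i, h1, h2, h3⟩ | h | h)
          · exact ⟨i, by omega, h2, h3⟩
          · exact ⟨a, by omega, hap, h.symm⟩
          · exact absurd h has_nil
        · rintro ⟨i, h1, h2, rfl⟩
          by_cases hia : i = a
          · subst hia
            exact Or.inr (Or.inl rfl)
          · exact Or.inl ⟨i, by omega, h2, rfl⟩
      have hT' : ∀ x y, ¬ Has (pr ++ [v]) (pos x y) := by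
        intro x y hh
        obtain ⟨i, -, -, hh⟩ := (hhas _).1 hh
        exact pos_ne_negP hh
      have hF' : ∀ x y, Has (pr ++ [v]) (negP x y) → (1 ≤ x ∧ x ≤ a) ∧ x ≠ p ∧ y = p := by
        intro x y hh
        obtain ⟨i, h1, h2, hh⟩ := (hhas _).1 hh
        rw [negP_inj] at hh
        omega
      refine ends_of_quiet_negP hΓ (v := v) rfl (fun x y h => absurd h (hT' x y))
        (fun b m hbm => Or.inl (hlarge b m hbm)) (fun c hc =>
        not_falsified (s := ⟨Γ, pr, [v], lvl + 1, false⟩) hΓ rfl ?_ ?_ ?_ hc)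
        (fun z => hT' z p) (fun z => hT' a z) (fun m hm => ?_) ?_
      · exact fun x y z h => absurd h (hT' x y)
      · exact fun x y h => absurd h (hT' x y)
      · intro b m hbm
        obtain ⟨i, hi, hiw⟩ := hdb b m hbm
        refine ⟨i, hi, fun hh => ?_⟩
        have := hF' _ _ hh
        have := hiw this.2.2
        omega
      -- Rows `u` and `w` belong to every available clause of the column and are still open.
      · refine ⟨u, w, by omega, hrows m hm u (by omega) (by omega) hup,
          hrows m hm w (by omega) le_rfl hwp, fun hh => ?_, fun hh => ?_⟩ <;>
        · have := hF' _ _ hh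
          omega
      · refine ih (u - (a + 1)) (by omega) (a := a + 1) (by omega) hau hhas (fun e he => ?_) rfl
        rcases List.mem_append.1 he with he | he
        · have := hlevel e he
          omega
        · rw [List.mem_singleton] at he
          rw [he]

/-! ### Column `j` after `P j q` has become true. -/

/-- The entries implied by `P j q` before anything else is known about column `j`. -/
def ColumnEntries (j q lvl : ℕ) (y : List (Entry (ℕ × ℕ))) : Prop :=
  (∀ x ∈ y, x.level = lvl ∧ ∃ i, 1 ≤ i ∧ (i < j ∨ i = q) ∧ i ≠ j ∧ x.lit = negP i j) ∧
    y.Pairwise (fun e e' => e.lit ≠ e'.lit)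

theorem ColumnEntries.has {y : List (Entry (ℕ × ℕ))} (h : ColumnEntries j q lvl y)
    {l : Literal (ℕ × ℕ)} (hl : Has y l) :
    ∃ i, 1 ≤ i ∧ (i < j ∨ i = q) ∧ i ≠ j ∧ l = negP i j := by
  obtain ⟨x, hx, rfl⟩ := hl
  exact (h.1 x hx).2

/-- The propagation of `P j q` when the variables `P i q` with `i < j` are false. -/
theorem Phase.ends_of_true (h : Phase n Γ j k q) (hq : 0 < q) {τ : Entry (ℕ × ℕ)}
    (hτ : τ.lit = pos j q)
    (hpr : ∀ l, Has pr l ↔ ∃ i, (1 ≤ i ∧ i < j) ∧ i ≠ q ∧ l = negP i q)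
    (hnext : ∀ y, ColumnEntries j q lvl y →
      (∀ i, 1 ≤ i → (i < j ∨ i = q) → i ≠ j → Has y (negP i j)) →
      Ends n δ P ⟨Γ, pr ++ [τ], y, lvl, false⟩)
    (hqu : ColumnEntries j q lvl qu) : Ends n δ P ⟨Γ, pr, τ :: qu, lvl, false⟩ := by
  have hj := h.one_le
  have hjk := h.le
  have hkn := h.lt
  obtain ⟨hqj, hqk, hqrow⟩ := h.true_row hq
  have hpos : ∀ y, ColumnEntries j q lvl y → ∀ a b, Has (pr ++ τ :: y) (pos a b) →
      a = j ∧ b = q := by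
    intro y hy a b hab
    rw [has_append, has_cons, hτ, pos_inj] at hab
    rcases hab with hab | hab | hab
    · obtain ⟨i, -, -, hh⟩ := (hpr _).1 hab
      exact absurd hh pos_ne_negP
    · omega
    · obtain ⟨i, -, -, -, hh⟩ := hy.has hab
      exact absurd hh pos_ne_negP
  have hneg : ∀ y, ColumnEntries j q lvl y → ∀ i b, Has (pr ++ τ :: y) (negP i b) →
      1 ≤ i ∧ i ≠ j ∧ ((b = q ∧ i < j ∧ i ≠ q) ∨ (b = j ∧ (i < j ∨ i = q))) := by
    intro y hy i b hib
    rw [has_append, has_cons, hτ] at hib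
    rcases hib with hib | hib | hib
    · obtain ⟨i', h1, h2, hh⟩ := (hpr _).1 hib
      rw [negP_inj] at hh
      omega
    · exact absurd hib pos_ne_negP
    · obtain ⟨i', h1, h2, h3, hh⟩ := hy.has hib
      rw [negP_inj] at hh
      omega
  have hcons : ∀ y, ColumnEntries j q lvl y → ∀ a b, Has (pr ++ τ :: y) (pos a b) →
      ¬ Has (pr ++ τ :: y) (negP a b) := by
    intro y hy a b h1 h2
    have h1 := hpos y hy a b h1
    have h2 := hneg y hy a b h2
    omega
  have hτhas : ∀ y, Has (pr ++ τ :: y) (pos j q) := fun y => by simp [has_append, has_cons, hτ]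
  refine inevitable_of_quiet (ColumnEntries j q lvl) h.allPrefix.clauseVars_subset ?_ ?_ ?_ qu hqu
  · intro y c l hy hc hvis hu
    have hun : ¬ Has y l := fun hh =>
      hu.2.1 (State.assigned_iff.2 (Or.inl (by
        rw [trail_mk, has_append, has_cons]; exact Or.inr (Or.inr hh))))
    refine ⟨fun x hx => ?_, pairwise_append_singleton hy.2 hun⟩
    rcases List.mem_append.1 hx with hx | hx
    · exact hy.1 x hx
    rw [List.mem_singleton] at hx
    subst hx
    refine ⟨rfl, ?_⟩
    have hsing : NoOpenSingle n Γ (pr ++ [τ]) := h.noOpenSingle fun _ => hτhas []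
    rcases isUnit_cases_of_pos h.allPrefix hτ (consistent_of (hcons y hy)) hsing hc hvis hu with
      ⟨z, rfl, rfl, h1⟩ | ⟨z, rfl, rfl, h1⟩ | ⟨z, rfl, rfl, h1⟩ | ⟨z, rfl, rfl, h1⟩ | ⟨rfl, rfl⟩
    · have h1 := hpos y hy _ _ h1
      omega
    · have h1 := hneg y hy _ _ h1
      omega
    · have h1 := hpos y hy _ _ h1
      omega
    -- From `P j q` and `¬P z q` with `z < j`, transitivity gives `¬P z j`.
    · have h1 := hneg y hy _ _ h1
      exact ⟨z, by omega, by omega, by omega, rfl⟩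
    · exact ⟨q, by omega, Or.inr rfl, hqj, rfl⟩
  · intro y c hy hc
    refine not_falsified (s := ⟨Γ, pr, τ :: y, lvl, false⟩) h.allPrefix rfl ?_ ?_ ?_ hc
    · intro a b d h1 h2 h3
      have h1 := hpos y hy _ _ h1
      have h2 := hpos y hy _ _ h2
      omega
    · intro a b h1 h2
      have h1 := hpos y hy _ _ h1
      have h2 := hpos y hy _ _ h2
      omega
    · intro b m hbm
      by_cases hbq : b = q
      · subst hbq
        refine ⟨j, hqrow m hbm, fun hh => ?_⟩
        have := hneg y hy _ _ hh
        omega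
      · by_cases hbj : b = j
        · subst hbj
          have := h.avail_min m hbm
          refine ⟨k + 1, by simp only [InRow]; omega, fun hh => ?_⟩
          have := hneg y hy _ _ hh
          omega
        · obtain ⟨i, -, hi, -⟩ := exists_two_rows (b := b) ((h.large b m hbm).resolve_right
            fun hh => hbq hh.2)
          refine ⟨i, hi, fun hh => ?_⟩
          have := hneg y hy _ _ hh
          omega
  · intro y hy hsat
    refine hnext y hy fun i hi1 hi2 hij => ?_
    have key : Has (pr ++ τ :: y) (negP i j) ∨ Has (pr ++ τ :: y) (pos i j) := by
      by_cases hiq : i = q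
      · subst hiq
        refine hsat.assigned (c := antiClause i j) (l := negP i j) (Or.inl ?_)
          (Or.inr ⟨τ, y, rfl, ?_⟩) (by simp [mem_antiClause]) ?_
        · exact mem_formula_iff.2 (Or.inr (Or.inl ⟨i, j, by omega, by omega, by omega, rfl⟩))
        · simp [hτ, mem_antiClause]
        · intro m hm hne
          rcases mem_antiClause.1 hm with rfl | rfl
          · exact absurd rfl hne
          · exact hτhas y
      · refine hsat.assigned (c := transClause i j q) (l := negP i j) (Or.inl ?_)
          (Or.inr ⟨τ, y, rfl, ?_⟩) (by simp [mem_transClause]) ?_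
        · exact mem_formula_iff.2 (Or.inl
            ⟨i, j, q, by omega, by omega, by omega, by omega, rfl⟩)
        · simp [hτ, mem_transClause]
        · intro m hm hne
          rcases mem_transClause.1 hm with rfl | rfl | rfl
          · exact absurd rfl hne
          · exact hτhas y
          · exact has_append.2 (Or.inl ((hpr _).2 ⟨i, by omega, hiq, rfl⟩))
    have key := key.resolve_right fun hh => by
      have := hpos y hy _ _ hh
      omega
    rw [has_append, has_cons, hτ] at key
    rcases key with key | key | key
    · obtain ⟨i', h1, h2, hh⟩ := (hpr _).1 key
      rw [negP_inj] at hh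
      omega
    · exact absurd key.symm negP_ne_pos
    · exact key

/-- The trail when `P j q` is true and the variables of column `j` up to row `a - 1` are false; if
`c = q`, the solver branches on column `q`, and otherwise on column `j`. -/
structure Descending (j q c a : ℕ) (L : List (Entry (ℕ × ℕ))) : Prop where
  true_iff : ∀ x y, Has L (pos x y) ↔ x = j ∧ y = q
  false_iff : ∀ x y, Has L (negP x y) ↔
    1 ≤ x ∧ x ≠ j ∧ ((y = j ∧ (x < a ∨ x = q)) ∨ (y = q ∧ c = q ∧ x < a ∧ x ≠ q))

end

section

variable {n : ℕ} {δ : ℝ} {P : State (ℕ × ℕ) → Prop} {Γ : List (Clause (ℕ × ℕ))}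
  {j k q c a lvl : ℕ} {pr qu : List (Entry (ℕ × ℕ))}

/-- Column `q` is satisfied by `P j q`, every available clause of column `j` contains the open row
`k + 1`, and other columns have no false literal. -/
theorem Phase.not_falsified_of_descending (h : Phase n Γ j k q) (hq : 0 < q) (hak : a ≤ k + 1)
    {s : State (ℕ × ℕ)} (hs : s.learned = Γ) (hd : Descending j q c a s.trail)
    {d : Clause (ℕ × ℕ)} (hdb : s.Database (formula n) d) : ¬ s.Falsified d := by
  have hjk := h.le
  obtain ⟨hqj, hqk, hqrow⟩ := h.true_row hq
  refine not_falsified h.allPrefix hs ?_ ?_ ?_ hdb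
  · intro x y z h1 h2
    rw [hd.true_iff] at h1 h2
    omega
  · intro x y h1 h2
    rw [hd.true_iff] at h1 h2
    omega
  · intro b m hbm
    by_cases hbq : b = q
    · subst hbq
      refine ⟨j, hqrow m hbm, fun hh => ?_⟩
      rw [hd.false_iff] at hh
      omega
    · by_cases hbj : b = j
      · subst hbj
        have := h.avail_min m hbm
        refine ⟨k + 1, by simp only [InRow]; omega, fun hh => ?_⟩
        rw [hd.false_iff] at hh
        omega
      · obtain ⟨i, -, hi, -⟩ := exists_two_rows (b := b) ((h.large b m hbm).resolve_right
          fun hh => hbq hh.2)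
        refine ⟨i, hi, fun hh => ?_⟩
        rw [hd.false_iff] at hh
        omega

theorem Descending.consistent {L : List (Entry (ℕ × ℕ))} (hd : Descending j q c a L) (x y : ℕ)
    (h1 : Has L (pos x y)) : ¬ Has L (negP x y) := by
  intro h2
  rw [hd.true_iff] at h1
  rw [hd.false_iff] at h2
  omega

/-- Rows `k` and `k + 1` of column `j` are open, so no prefix clause becomes unit. The only true
literal, `P j q`, is neither in column `j` nor in row `x`, so transitivity is not triggered. -/
theorem Phase.ends_of_quiet_descending (h : Phase n Γ j k q) (hq : 0 < q) (hqk : q < k)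
    (hja : j < a) (hak : a ≤ k) {v : Entry (ℕ × ℕ)} {x : ℕ} (hx : x ≠ j)
    (hv : v.lit = negP x j) (hpr : Has pr (pos j q)) (hd : Descending j q c a (pr ++ v :: qu))
    (hnext : Ends n δ P ⟨Γ, pr ++ [v], qu, lvl, false⟩) :
    Ends n δ P ⟨Γ, pr, v :: qu, lvl, false⟩ := by
  have hj := h.one_le
  have hqj := (h.true_row hq).1
  refine ends_of_quiet_negP h.allPrefix hv hd.consistent
    (h.noOpenSingle fun _ => has_append.2 (Or.inl hpr))
    (fun d hdb => h.not_falsified_of_descending (s := ⟨Γ, pr, v :: qu, lvl, false⟩) hq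
      (by omega) rfl hd hdb) (fun z hh => ?_) (fun z hh => ?_) (fun m hm => ?_) hnext
  · rw [hd.true_iff] at hh
    omega
  · rw [hd.true_iff] at hh
    omega
  · have := h.avail_min m hm
    refine ⟨k, k + 1, by omega, by simp only [InRow]; omega, by simp only [InRow]; omega,
      fun hh => ?_, fun hh => ?_⟩ <;>
    · rw [hd.false_iff] at hh
      omega

theorem Phase.ends_of_drain (h : Phase n Γ j k q) (hq : 0 < q) (hqk : q < k) (hjk : j < k)
    (hqu : ∀ x ∈ qu, ∃ i, i ≠ j ∧ x.lit = negP i j) (hpr : Has pr (pos j q))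
    (hd : Descending j q c (j + 1) (pr ++ qu))
    (hnext : Ends n δ P ⟨Γ, pr ++ qu, [], lvl, false⟩) :
    Ends n δ P ⟨Γ, pr, qu, lvl, false⟩ := by
  induction qu generalizing pr with
  | nil => simpa using hnext
  | cons v qu ih =>
    obtain ⟨i, hi, hv⟩ := hqu v (by simp)
    refine h.ends_of_quiet_descending hq hqk (by omega) (by omega) hi hv hpr hd ?_
    exact ih (fun x hx => hqu x (by simp [hx])) (has_append.2 (Or.inl hpr)) (by simpa using hd)
      (by simpa using hnext)

/-- Branching on column `q` when `P j q` is true: the decision `¬ P a q` implies `¬ P a j`. -/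
theorem Phase.ends_of_branch_true (h : Phase n Γ j k q) (hq : 0 < q) (haj : j < a) (hak : a ≤ k)
    (haq : a ≠ q) (hd : Descending j q q a pr) {d : Entry (ℕ × ℕ)} (hdl : d.lit = negP a q)
    (hnext : ∀ r, Ends n δ P ⟨Γ, pr ++ [d], [⟨negP a j, lvl, r⟩], lvl, false⟩) :
    Ends n δ P ⟨Γ, pr, [d], lvl, false⟩ := by
  have hj := h.one_le
  have hkn := h.lt
  obtain ⟨hqj, hqk, hqrow⟩ := h.true_row hq
  let I : List (Entry (ℕ × ℕ)) → Prop := fun y => y = [] ∨ ∃ r, y = [⟨negP a j, lvl, r⟩]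
  have hpos : ∀ y, I y → ∀ x z, Has (pr ++ d :: y) (pos x z) ↔ x = j ∧ z = q := by
    intro y hy x z
    rw [has_append, has_cons, hd.true_iff, hdl]
    constructor
    · rintro (hh | hh | hh)
      · exact hh
      · exact absurd hh negP_ne_pos
      · rcases hy with rfl | ⟨r, rfl⟩
        · exact absurd hh has_nil
        · simp [Has] at hh
    · exact Or.inl
  have hneg : ∀ y, I y → ∀ x z, Has (pr ++ d :: y) (negP x z) →
      1 ≤ x ∧ x ≤ k ∧ x ≠ j ∧ (z = j ∨ (z = q ∧ x ≠ q)) := by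
    intro y hy x z hh
    rw [has_append, has_cons, hd.false_iff, hdl, negP_inj] at hh
    rcases hh with hh | hh | hh
    · omega
    · omega
    · rcases hy with rfl | ⟨r, rfl⟩
      · exact absurd hh has_nil
      · simp [Has] at hh
        omega
  have hcons : ∀ y, I y → ∀ x z, Has (pr ++ d :: y) (pos x z) →
      ¬ Has (pr ++ d :: y) (negP x z) := by
    intro y hy x z h1 h2
    rw [hpos y hy] at h1
    have h2 := hneg y hy _ _ h2
    omega
  refine inevitable_of_quiet I h.allPrefix.clauseVars_subset ?_ ?_ ?_ [] (Or.inl rfl)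
  · intro y e l hy hc hvis hu
    have hun : ¬ Has (pr ++ d :: y) l ∧ ¬ Has (pr ++ d :: y) (neg l) := by
      have := hu.2.1
      rw [State.assigned_iff, not_or] at this
      exact this
    have hsing : NoOpenSingle n Γ (pr ++ [d]) := h.noOpenSingle fun _ =>
      has_append.2 (Or.inl ((hd.true_iff j q).2 ⟨rfl, rfl⟩))
    rcases isUnit_cases_of_negP h.allPrefix hdl (consistent_of (hcons y hy)) hsing hc hvis hu with
      ⟨z, rfl, rfl, h1⟩ | ⟨z, rfl, rfl, h1⟩ | ⟨m, i, hm, hi, hne, rfl, rfl, h1⟩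
    · rw [hpos y hy] at h1
      obtain ⟨rfl, -⟩ := h1
      rcases hy with rfl | ⟨r, rfl⟩
      · exact Or.inr ⟨_, rfl⟩
      · refine absurd ?_ hun.1
        simp [has_append, has_cons]
    · rw [hpos y hy] at h1
      omega
    -- A clause of column `q` cannot be unit, since it contains the true literal `P j q`.
    · exfalso
      by_cases hij : i = j
      · subst hij
        exact hun.1 ((hpos y hy _ _).2 ⟨rfl, rfl⟩)
      · have := hneg y hy _ _ (h1 j (hqrow m hm) (Ne.symm hij))
        omega
  · intro y e hy hc
    refine not_falsified (s := ⟨Γ, pr, d :: y, lvl, false⟩) h.allPrefix rfl ?_ ?_ ?_ hc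
    · intro x y' z h1 h2 h3
      rw [trail_mk, hpos y hy] at h1 h2
      omega
    · intro x y' h1 h2
      rw [trail_mk, hpos y hy] at h1 h2
      omega
    · intro b m hbm
      by_cases hbq : b = q
      · subst hbq
        refine ⟨j, hqrow m hbm, fun hh => ?_⟩
        have := hneg y hy _ _ hh
        omega
      · by_cases hbj : b = j
        · subst hbj
          have := h.avail_min m hbm
          refine ⟨k + 1, by simp only [InRow]; omega, fun hh => ?_⟩
          have := hneg y hy _ _ hh
          omega
        · obtain ⟨i, -, hi, -⟩ := exists_two_rows (b := b) ((h.large b m hbm).resolve_right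
            fun hh => hbq hh.2)
          refine ⟨i, hi, fun hh => ?_⟩
          have := hneg y hy _ _ hh
          omega
  · intro y hy hsat
    rcases hy with rfl | ⟨r, rfl⟩
    · exfalso
      have key := hsat.assigned (c := transClause a j q) (l := negP a j) (Or.inl
        (mem_formula_iff.2 (Or.inl ⟨a, j, q, by omega, by omega, by omega, by omega, rfl⟩)))
        (Or.inr ⟨d, [], rfl, by simp [hdl, mem_transClause]⟩) (by simp [mem_transClause]) (by
          intro m hm hne
          rcases mem_transClause.1 hm with rfl | rfl | rfl
          · exact absurd rfl hne
          · exact (hpos [] (Or.inl rfl) _ _).2 ⟨rfl, rfl⟩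
          · simp [trail_mk, has_append, has_cons, hdl])
      rw [trail_mk, neg_negP, hpos [] (Or.inl rfl), has_append, has_cons, hd.false_iff, hdl,
        negP_inj] at key
      have := has_nil (l := negP a j)
      rcases key with (key | key | key) | key
      · omega
      · omega
      · exact this key
      · omega
    · exact hnext r

/-- When `P j q` is true, the solver falsifies the variables of column `j` in order, and finally
learns `C(j, k-1)`. -/
theorem Phase.ends_of_descending (h : Phase n Γ j k q) (hq : 0 < q) (hqk : q < k)
    (hK : Closing n Γ k q) (hc : c = q ∨ c = j) (hbr : BranchOrder n δ Γ c k)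
    (hlearn : Ends n δ P (State.restart (Γ ++ [prefixClause n j (k - 1)])))
    (hja : j < a) (hak : a ≤ k) (hd : Descending j q c a pr) (hlevel : ∀ e ∈ pr, e.level ≤ lvl) :
    Ends n δ P ⟨Γ, pr, [], lvl, false⟩ := by
  induction hN : k - a using Nat.strong_induction_on generalizing a pr lvl with
  | _ N ih =>
  have hj := h.one_le
  have hkn := h.lt
  have hqj := (h.true_row hq).1
  -- Row `q` takes no decision: `P q j` has been false since `P j q` was propagated, and column `q`
  -- has no row `q`.
  by_cases haq : a = q
  · refine ih (k - (a + 1)) (by omega) (a := a + 1) (by omega) (by omega)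
      ⟨hd.true_iff, fun x y => ?_⟩ hlevel rfl
    rw [hd.false_iff]
    omega
  have hsat : (State.mk Γ pr [] lvl false).Saturated (formula n) := by
    refine saturated_of_queue_nil h.allPrefix hd.consistent
      (h.noOpenSingle fun _ => (hd.true_iff j q).2 ⟨rfl, rfl⟩) fun e he =>
      h.not_falsified_of_descending (c := c) (a := a) hq (by omega) rfl ?_ he
    rw [trail_mk, List.append_nil]
    exact hd
  -- Common continuation for the two ways in which `¬P a j` gets into the queue, as a decision or
  -- implied by the decision `¬P a q`. It is the only literal of column `j` at the new level, so in
  -- the second case the first UIP is not the decision.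
  have hstep : ∀ (pr' : List (Entry (ℕ × ℕ))) (v : Entry (ℕ × ℕ)), v.lit = negP a j →
      v.level = lvl + 1 → (∀ e ∈ pr', e.level ≤ lvl + 1) →
      (∀ i, ∀ e ∈ pr', e.lit = negP i j → e.level < lvl + 1) →
      Descending j q c (a + 1) (pr' ++ [v]) →
      Ends n δ P ⟨Γ, pr', [v], lvl + 1, false⟩ := by
    intro pr' v hv hvl hl1 hl2 hd'
    rcases hak.eq_or_lt with rfl | hak
    · refine h.ends_of_last_false hK (u := a) (by omega) le_rfl (by omega) hv hvl
        ⟨fun x y => ?_, fun x y hh => ?_, fun i h1 h2 h3 => ?_⟩ (fun _ i _ => hl2 i)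
        (fun _ => hlearn) (fun h0 => absurd h0 (by omega))
      · rw [hd'.true_iff]
        omega
      · rw [hd'.false_iff] at hh
        omega
      · rw [hd'.false_iff]
        omega
    · have hpq : Has pr' (pos j q) := by
        have := (hd'.true_iff j q).2 ⟨rfl, rfl⟩
        rw [has_append, has_cons, hv] at this
        rcases this with hh | hh | hh
        · exact hh
        · exact absurd hh negP_ne_pos
        · exact absurd hh has_nil
      refine h.ends_of_quiet_descending hq hqk (a := a + 1) (by omega) (by omega) (by omega) hv
        hpq hd' (ih (k - (a + 1)) (by omega) (by omega) (by omega) hd' (fun e he => ?_) rfl)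
      rcases List.mem_append.1 he with he | he
      · exact hl1 e he
      · rw [List.mem_singleton] at he
        rw [he, hvl]
  have hnil : ∀ l : Literal (ℕ × ℕ), ¬ Has [] l := fun l => has_nil
  rcases hc with rfl | rfl
  · refine ends_of_branch hbr hq (by omega) (by omega) (by omega) hak haq hsat ⟨?_, ?_⟩ ?_ ?_
    · rw [hd.true_iff]
      omega
    · rw [hd.false_iff]
      omega
    · intro b h1 h2 h3
      rw [hd.true_iff, hd.false_iff]
      omega
    · refine h.ends_of_branch_true hq hja hak haq hd rfl fun r => hstep _ _ rfl rfl ?_ ?_ ?_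
      · intro e he
        rcases List.mem_append.1 he with he | he
        · have := hlevel e he
          omega
        · rw [List.mem_singleton] at he
          rw [he]
      · intro i e he hel
        rcases List.mem_append.1 he with he | he
        · have := hlevel e he
          omega
        · rw [List.mem_singleton] at he
          subst he
          rw [negP_inj] at hel
          omega
      · refine ⟨fun x y => ?_, fun x y => ?_⟩
        · simp only [has_append, has_cons, hd.true_iff, negP_ne_pos, hnil, or_false]
        · simp only [has_append, has_cons, hd.false_iff, negP_inj, hnil, or_false, true_and]
          omega
  · refine ends_of_branch hbr hj (by omega) (by omega) (by omega) hak (by omega) hsat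
      ⟨?_, ?_⟩ ?_ ?_
    · rw [hd.true_iff]
      omega
    · rw [hd.false_iff]
      omega
    · intro b h1 h2 h3
      rw [hd.true_iff, hd.false_iff]
      omega
    · refine hstep _ _ rfl rfl (fun e he => ?_) (fun i e he _ => ?_) ?_
      · have := hlevel e he
        omega
      · have := hlevel e he
        omega
      · refine ⟨fun x y => ?_, fun x y => ?_⟩
        · simp only [has_append, has_cons, hd.true_iff, negP_ne_pos, hnil, or_false]
        · simp only [has_append, has_cons, hd.false_iff, negP_inj, hnil, or_false]
          omega

/-- The propagation of `P j q`, followed by the descent in column `j`. -/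
theorem Phase.ends_of_true_descending (h : Phase n Γ j k q) (hq : 0 < q) (hqk : q < k)
    (hjk : j < k) (hK : Closing n Γ k q) (hc : (c = q) ∨ (c = j ∧ j = 1 ∧ q = 2))
    (hbr : BranchOrder n δ Γ c k)
    (hlearn : Ends n δ P (State.restart (Γ ++ [prefixClause n j (k - 1)])))
    {τ : Entry (ℕ × ℕ)} (hτ : τ.lit = pos j q) (hτl : τ.level = lvl)
    (hpr : ∀ l, Has pr l ↔ ∃ i, (1 ≤ i ∧ i < j) ∧ i ≠ q ∧ l = negP i q)
    (hlevel : ∀ e ∈ pr, e.level ≤ lvl) (hqu : ColumnEntries j q lvl qu) :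
    Ends n δ P ⟨Γ, pr, τ :: qu, lvl, false⟩ := by
  have hqj := (h.true_row hq).1
  have hnil : ∀ l : Literal (ℕ × ℕ), ¬ Has [] l := fun l => has_nil
  refine h.ends_of_true hq hτ hpr (fun y hy hall => ?_) hqu
  -- If `c = j`, then `j = 1` and `pr` is empty, so nothing in column `q` is false, as `Descending`
  -- requires.
  have hd : Descending j q c (j + 1) (pr ++ [τ] ++ y) := by
    refine ⟨fun x z => ?_, fun x z => ?_⟩
    · simp only [has_append, has_cons, hτ, pos_inj, hpr, hnil]
      constructor
      · rintro ((⟨i, -, -, hh⟩ | hh | hh) | hh)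
        · exact absurd hh pos_ne_negP
        · omega
        · exact hh.elim
        · obtain ⟨i, -, -, -, hh⟩ := hy.has hh
          exact absurd hh pos_ne_negP
      · rintro ⟨rfl, rfl⟩
        exact Or.inl (Or.inr (Or.inl ⟨rfl, rfl⟩))
    · simp only [has_append, has_cons, hτ, pos_ne_negP, hpr, hnil, negP_inj]
      constructor
      · rintro ((⟨i, h1, h2, hh⟩ | hh | hh) | hh)
        · omega
        · exact hh.elim
        · exact hh.elim
        · obtain ⟨i, h1, h2, h3, hh⟩ := hy.has hh
          rw [negP_inj] at hh
          omega
      · rintro ⟨h1, h2, ⟨rfl, h3⟩ | ⟨rfl, h3, h4, h5⟩⟩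
        · exact Or.inr (hall x h1 (by omega) h2)
        · exact Or.inl (Or.inl ⟨x, by omega, by omega, rfl, rfl⟩)
  refine h.ends_of_drain (c := c) hq hqk hjk (fun x hx => ?_)
    (has_append.2 (Or.inr (has_cons.2 (Or.inl hτ)))) hd
    (h.ends_of_descending hq hqk hK (hc.imp_right And.left) hbr hlearn (by omega) (by omega) hd
      fun e he => ?_)
  · obtain ⟨i, -, -, h1, h2⟩ := (hy.1 x hx).2
    exact ⟨i, h1, h2⟩
  · rw [List.mem_append, List.mem_append, List.mem_singleton] at he
    rcases he with (he | rfl) | he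
    · exact hlevel e he
    · exact hτl.le
    · exact (hy.1 e he).1.le

end

/-! ## The phases of the run -/

section

variable {n : ℕ} {δ : ℝ} {P : State (ℕ × ℕ) → Prop} {Γ : List (Clause (ℕ × ℕ))} {j k q : ℕ}

/-- A phase in which the solver branches on column `j` and no literal is true before. -/
theorem Phase.ends_of_restart (h : Phase n Γ j k 0) (hK : Closing n Γ k 0)
    (hbr : BranchOrder n δ Γ j k)
    (hlearn : Ends n δ P (State.restart (Γ ++ [prefixClause n j (k - 1)]))) :
    Ends n δ P (State.restart Γ) := by
  have hj := h.one_le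
  have hjk := h.le
  have hk := h.two_le
  have hkn := h.lt
  have hlarge : ∀ b m, Avail n Γ b m → 2 ≤ m := fun b m hbm =>
    (h.large b m hbm).resolve_right fun hh => absurd hh.1 (lt_irrefl 0)
  -- Here `u` is the last row up to `k` different from `j`; deciding it leaves row `k + 1` alone
  -- open in `C(j, k)`.
  obtain ⟨u, hu1, huk, huj, hlast⟩ : ∃ u, 1 ≤ u ∧ u ≤ k ∧ u ≠ j ∧ ∀ i, u < i → i ≤ k → i = j := by
    by_cases hjk' : j = k
    · exact ⟨k - 1, by omega, by omega, by omega, by omega⟩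
    · exact ⟨k, by omega, by omega, by omega, by omega⟩
  refine ends_of_descent (pr := []) (lvl := 0) (a := 1) (w := k + 1) (u := u) h.allPrefix hbr hj
    (by omega) (by omega) (fun m hm i h1 h2 h3 => ?_) hlarge (by omega) huj (by omega) huk
    (fun pr lvl hpr hlevel => ?_) le_rfl hu1 (fun l => ?_) (by simp)
  · have := h.avail_min m hm
    simp only [InRow]
    omega
  · have hnil : ∀ l : Literal (ℕ × ℕ), ¬ Has [] l := fun l => has_nil
    refine h.ends_of_last_false hK hu1 huk huj rfl rfl ⟨fun x y => ?_, fun x y hh => ?_,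
      fun i h1 h2 h3 => ?_⟩ (fun _ i _ e he _ => Nat.lt_succ_of_le (hlevel e he))
      (fun _ => hlearn) (fun h0 => absurd h0 (by omega))
    · simp only [has_append, has_cons, negP_ne_pos, hnil, or_false, hpr]
      refine ⟨fun ⟨i, _, _, hh⟩ => absurd hh pos_ne_negP, fun hh => absurd hh.1 (lt_irrefl 0)⟩
    · simp only [has_append, has_cons, negP_inj, hnil, or_false, hpr] at hh
      rcases hh with ⟨i, h1, h2, h3, h4⟩ | hh <;> omega
    · simp only [has_append, has_cons, negP_inj, hnil, or_false, hpr]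
      by_cases hiu : i = u
      · exact Or.inr ⟨hiu.symm, trivial⟩
      · refine Or.inl ⟨i, ⟨h1, ?_⟩, h3, rfl, trivial⟩
        by_contra hlt
        exact h3 (hlast i (by omega) h2)
  · refine ⟨fun hh => absurd hh has_nil, fun ⟨i, h1, _⟩ => by omega⟩

/-- A phase in which the solver first branches on column `q`, which makes `P j q` true. -/
theorem Phase.ends_of_restart_true (h : Phase n Γ j k q) (hK : Closing n Γ k q) (hq : 0 < q)
    (hqk : q < k) (hjk : j < k) (hj2 : 2 ≤ j) (hjq : j - 1 ≠ q)
    (hbr : BranchOrder n δ Γ q k) {m₀ : ℕ} (hav : Avail n Γ q m₀)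
    (hmin : ∀ m, Avail n Γ q m → m₀ ≤ m)
    (hrows : ∀ i, InRow q m₀ i ↔ 1 ≤ i ∧ i ≤ j ∧ i ≠ q)
    (hlarge : ∀ b m, Avail n Γ b m → 2 ≤ m)
    (hlearn : Ends n δ P (State.restart (Γ ++ [prefixClause n j (k - 1)]))) :
    Ends n δ P (State.restart Γ) := by
  have hkn := h.lt
  have hqj := (h.true_row hq).1
  have hrowj : ∀ m, Avail n Γ q m → InRow q m j := (h.true_row hq).2.2
  have hnil : ∀ l : Literal (ℕ × ℕ), ¬ Has [] l := fun l => has_nil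
  have hmono : ∀ m, Avail n Γ q m → ∀ i, 1 ≤ i → i ≤ j → i ≠ q → InRow q m i := by
    intro m hm i h1 h2 h3
    have h4 := hmin m hm
    have h5 := (hrows i).2 ⟨h1, h2, h3⟩
    simp only [InRow] at h5 ⊢
    omega
  refine ends_of_descent (pr := []) (lvl := 0) (a := 1) (w := j) (u := j - 1) h.allPrefix hbr hq
    (by omega) (by omega) hmono hlarge (by omega) hjq hqj.symm (by omega)
    (fun pr lvl hpr hlevel => ?_) le_rfl (by omega) (fun l => ?_) (by simp)
  · set v : Entry (ℕ × ℕ) := ⟨negP (j - 1) q, lvl + 1, none⟩ with hv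
    have hall : ∀ l, Has (pr ++ [v]) l ↔ ∃ i, (1 ≤ i ∧ i < j) ∧ i ≠ q ∧ l = negP i q := by
      intro l
      simp only [has_append, has_cons, hnil, or_false, hpr]
      constructor
      · rintro (⟨i, h1, h2, h3⟩ | hh)
        · exact ⟨i, by omega, h2, h3⟩
        · exact ⟨j - 1, by omega, hjq, hh.symm⟩
      · rintro ⟨i, h1, h2, rfl⟩
        by_cases hij : i = j - 1
        · subst hij
          exact Or.inr rfl
        · exact Or.inl ⟨i, by omega, h2, rfl⟩
    -- No literal is true so far, hence the parameter `q := 0`; the literal that gets forced is `P j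
    -- q`.
    refine ends_of_forced h.allPrefix (p := q) (w := j) (m₀ := m₀) (q := 0) (u := j - 1) hqj hav
      hrows (fun m hm hne => ?_) (fun b m hbm => Or.inl (hlarge b m hbm))
      (fun h0 => absurd h0 (lt_irrefl 0)) (by omega) (by omega) hjq (by omega) hq (by omega) rfl
      (fun x y => ?_) (fun x y hh => ?_) (fun i h1 h2 h3 => (hall _).2 ⟨i, ⟨h1, h2⟩, h3, rfl⟩)
      (fun y hy => ?_)
    · have h1 := hmin m hm
      refine ⟨hrowj m hm, ?_⟩
      have h2 : ∀ i, j < i → i ≠ q → ¬ InRow q m₀ i := fun i hi hiq hh => by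
        have := (hrows i).1 hh
        omega
      have h3 := h2 (j + 1) (by omega)
      have h4 := h2 (j + 2) (by omega)
      have h5 := (hrows j).2 (by omega)
      simp only [InRow] at h3 h4 h5 ⊢
      -- The row that follows `j` in column `q` is `j + 1`, unless this number is `q` itself.
      by_cases hq1 : j + 1 = q
      · exact ⟨j + 2, by omega, by omega⟩
      · exact ⟨j + 1, by omega, by omega⟩
    · rw [hpr]
      refine ⟨fun ⟨i, _, _, hh⟩ => absurd hh pos_ne_negP, fun hh => absurd hh.1 (lt_irrefl 0)⟩
    · obtain ⟨i, h1, h2, h3⟩ := (hall _).1 hh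
      rw [negP_inj] at h3
      omega
    · refine h.ends_of_true_descending hq hqk hjk hK (Or.inl rfl) hbr hlearn rfl rfl hall
        (fun e he => ?_) ?_
      · rcases List.mem_append.1 he with he | he
        · have := hlevel e he
          omega
        · rw [List.mem_singleton] at he
          rw [he]
      · rcases hy with rfl | rfl
        · exact ⟨by simp, List.Pairwise.nil⟩
        · refine ⟨fun x hx => ?_, List.pairwise_singleton _ _⟩
          rw [List.mem_singleton] at hx
          subst hx
          exact ⟨rfl, j - 1, by omega, by omega, by omega, rfl⟩
  · refine ⟨fun hh => absurd hh has_nil, fun ⟨i, h1, _⟩ => by omega⟩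

/-- As `C(2, 1)` is the only single-literal clause, the one possible first step is to imply `P 1 2`
at level 0. -/
theorem Phase.ends_of_single (h : Phase n Γ 1 k 2) (hav : Avail n Γ 2 1)
    (hlarge : ∀ b m, Avail n Γ b m → 2 ≤ m ∨ (b = 2 ∧ m = 1))
    (hnext : Ends n δ P ⟨Γ, [], [⟨pos 1 2, 0, some (prefixClause n 2 1)⟩], 0, false⟩) :
    Ends n δ P (State.restart Γ) := by
  have hmem : ∀ l, l ∈ prefixClause n 2 1 ↔ l = pos 1 2 := by
    intro l
    rw [hav.mem]
    constructor
    · rintro ⟨i, hi, rfl⟩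
      simp only [InRow] at hi
      rw [show i = 1 by omega]
    · rintro rfl
      exact ⟨1, by simp only [InRow]; omega, rfl⟩
  refine inevitable_of_single (d := prefixClause n 2 1) (l := pos 1 2)
    (hav.database (pr := []) (qu := []) (lvl := 0)) ?_ ?_ ?_ hnext
  · ext l
    rw [hmem, Finset.mem_singleton]
  · intro c hc
    rcases database_cases h.allPrefix hc with ⟨a, b, d, -, -, -, -, rfl⟩ | ⟨a, b, -, -, -, rfl⟩ |
      ⟨b, m, hbm, rfl⟩
    · exact ⟨negP a b, by simp [mem_transClause]⟩
    · exact ⟨negP a b, by simp [mem_antiClause]⟩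
    · rcases hlarge b m hbm with hm | ⟨rfl, rfl⟩
      · obtain ⟨i, -, hi, -⟩ := exists_two_rows (b := b) hm
        exact ⟨pos i b, hbm.mem.2 ⟨i, hi, rfl⟩⟩
      · exact ⟨pos 1 2, (hmem _).2 rfl⟩
  · intro c hc h1
    rcases database_cases h.allPrefix hc with ⟨a, b, d, -, -, -, -, rfl⟩ |
      ⟨a, b, -, -, hab, rfl⟩ | ⟨b, m, hbm, rfl⟩
    · exact absurd h1 transClause_card_ne_one
    · exact absurd h1 (antiClause_card_ne_one hab)
    · rcases hlarge b m hbm with hm | ⟨rfl, rfl⟩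
      · exact absurd h1 (prefixClause_card_ne_one hbm hm)
      · rfl

/-- A phase that starts with the propagation of the learned unit clause `P 1 2`. -/
theorem Phase.ends_of_restart_single (h : Phase n Γ 1 k 2) (hK : Closing n Γ k 2) (hk : 2 < k)
    (hav : Avail n Γ 2 1) (hlarge : ∀ b m, Avail n Γ b m → 2 ≤ m ∨ (b = 2 ∧ m = 1)) {c : ℕ}
    (hc : c = 2 ∨ c = 1) (hbr : BranchOrder n δ Γ c k)
    (hlearn : Ends n δ P (State.restart (Γ ++ [prefixClause n 1 (k - 1)]))) :
    Ends n δ P (State.restart Γ) := by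
  refine h.ends_of_single hav hlarge (h.ends_of_true_descending (by omega) hk (by omega) hK
    (hc.imp_right fun h => ⟨h, rfl, rfl⟩) hbr hlearn rfl rfl (fun l => ?_) (by simp)
    ⟨by simp, List.Pairwise.nil⟩)
  refine ⟨fun hh => absurd hh has_nil, fun ⟨i, h1, _⟩ => by omega⟩

/-- The last phase, in which UNSAT is derived without a decision. -/
theorem Phase.ends_of_unsat (h : Phase n Γ 1 2 2) (hK : Closing n Γ 2 2)
    (hav : Avail n Γ 2 1) (hlarge : ∀ b m, Avail n Γ b m → 2 ≤ m ∨ (b = 2 ∧ m = 1))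
    (hunsat : ∀ s : State (ℕ × ℕ), s.learned = Γ → s.unsat = true → P s) :
    Ends n δ P (State.restart Γ) := by
  have hnil : ∀ l : Literal (ℕ × ℕ), ¬ Has [] l := fun l => has_nil
  refine h.ends_of_single hav hlarge (h.ends_of_true (by omega) rfl (fun l => ?_)
    (fun y hy hall => ?_) ⟨by simp, List.Pairwise.nil⟩)
  · refine ⟨fun hh => absurd hh has_nil, fun ⟨i, h1, _⟩ => by omega⟩
  -- For `j = 1` only row `q = 2` is possible, and entries do not repeat, so the queue is exactly
  -- `¬P 2 1`.
  · have hlit : ∀ x ∈ y, x.lit = negP 2 1 ∧ x.level = 0 := by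
      intro x hx
      obtain ⟨h0, i, h1, h2, h3, h4⟩ := hy.1 x hx
      rw [h4, show i = 2 by omega]
      exact ⟨rfl, h0⟩
    have hy2 := hy.2
    obtain ⟨v, rfl⟩ : ∃ v, y = [v] := by
      match y with
      | [] => exact absurd (hall 2 (by omega) (Or.inr rfl) (by omega)) has_nil
      | [v] => exact ⟨v, rfl⟩
      | v :: v' :: y =>
        exfalso
        rw [List.pairwise_cons] at hy2
        exact hy2.1 v' (by simp) ((hlit v (by simp)).1.trans (hlit v' (by simp)).1.symm)
    obtain ⟨hv, hvl⟩ := hlit v (by simp)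
    refine h.ends_of_last_false hK (u := 2) (by omega) le_rfl (by omega) hv hvl
      ⟨fun a b => ?_, fun a b hh => ?_, fun i h1 h2 h3 => ?_⟩ (fun h0 => absurd h0 (lt_irrefl 0))
      (fun h0 => absurd h0 (lt_irrefl 0)) (fun _ => hunsat)
    · simp only [has_append, has_cons, hv, pos_inj, negP_ne_pos, hnil, or_false, false_or,
        Nat.ofNat_pos, true_and]
      omega
    · simp only [has_append, has_cons, hv, negP_inj, pos_ne_negP, hnil, or_false, false_or] at hh
      omega
    · simp only [has_append, has_cons, hv, negP_inj, pos_ne_negP, hnil, or_false, false_or]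
      exact ⟨by omega, trivial⟩

/-! ## Branching -/

theorem mem_clauseVars_prefixClause {b m : ℕ} (hb : 1 ≤ b) (hbn : b ≤ n) (hm : m ≤ n - 1)
    {x : ℕ × ℕ} : x ∈ clauseVars (prefixClause n b m) ↔ x.2 = b ∧ InRow b m x.1 := by
  obtain ⟨i, c⟩ := x
  simp only [clauseVars, Finset.mem_image, mem_prefixClause hb hbn hm]
  constructor
  · rintro ⟨l, ⟨i', hi, rfl⟩, h⟩
    simp only [pos, Prod.mk.injEq] at h
    obtain ⟨rfl, rfl⟩ := h
    exact ⟨rfl, hi⟩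
  · rintro ⟨rfl, hi⟩
    exact ⟨_, ⟨i, hi, rfl⟩, rfl⟩

/-- Prefix clauses of column `p` are nested, so within the column scores do not increase with the
row, and ties go to the smaller row. A variable of another column occurs neither in `C(p, m)` nor
later, so it is strictly behind. -/
theorem branchOrder_of_append (hδ₀ : 0 < δ) (hδ : δ ≤ 1 / 2) {Γ₀ Δ : List (Clause (ℕ × ℕ))}
    {p m r : ℕ} (hp1 : 1 ≤ p) (hpn : p ≤ n) (hm : m ≤ n - 1)
    (hΓ : AllPrefix n (Γ₀ ++ prefixClause n p m :: Δ))
    (hΔ : ∀ c ∈ Δ, ∃ m' ≤ n - 1, c = prefixClause n p m')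
    (hr : ∀ a, 1 ≤ a → a ≤ r → a ≠ p → InRow p m a) :
    BranchOrder n δ (Γ₀ ++ prefixClause n p m :: Δ) p r := by
  rintro a ha1 har hap ⟨y, z⟩ - hyz
  by_cases hz : z = p
  · subst hz
    have hay : a < y := by simpa using hyz
    have hle := score_mono (x := (a, z)) (y := (y, z)) hδ₀ (Γ₀ ++ prefixClause n z m :: Δ) ?_
    · rcases hle.lt_or_eq with h | h
      · exact Or.inl h
      · exact Or.inr ⟨h, Or.inr ⟨rfl, hay⟩⟩
    · intro c hc hy
      obtain ⟨b, m', hbm, rfl⟩ := hΓ c hc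
      rw [mem_clauseVars_prefixClause hbm.1.1 hbm.1.2 hbm.2.1] at hy ⊢
      obtain ⟨rfl, hy⟩ := hy
      refine ⟨rfl, ?_⟩
      simp only [InRow] at hy ⊢
      omega
  · refine Or.inl (score_lt_of_later hδ₀ hδ Γ₀ Δ _ ?_ ?_ ?_)
    · exact (mem_clauseVars_prefixClause hp1 hpn hm).2 ⟨rfl, hr a ha1 har hap⟩
    · rw [mem_clauseVars_prefixClause hp1 hpn hm]
      exact fun h => hz h.1
    · intro d hd
      obtain ⟨m', hm', rfl⟩ := hΔ d hd
      rw [mem_clauseVars_prefixClause hp1 hpn hm']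
      exact fun h => hz h.1

/-- All scores are 0, and column 1 comes first in the tie-breaking order. -/
theorem branchOrder_nil {r : ℕ} : BranchOrder n δ [] 1 r := by
  rintro a - - - ⟨y, z⟩ hy hyz
  rw [mem_formulaVars] at hy
  refine Or.inr ⟨rfl, ?_⟩
  simp only [columnMajor]
  dsimp only at hy hyz
  omega

/-! ## The learned clauses -/

theorem prefixClause_inj {b m b' m' : ℕ} (hb : 1 ≤ b ∧ b ≤ n) (hm : m ≤ n - 1)
    (hb' : 1 ≤ b' ∧ b' ≤ n) (hm1 : 1 ≤ m') (hm' : m' ≤ n - 1)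
    (h : prefixClause n b m = prefixClause n b' m') : b = b' ∧ m = m' := by
  have key : ∀ i c, (InRow b m i ∧ c = b) ↔ (InRow b' m' i ∧ c = b') := by
    intro i c
    have := Finset.ext_iff.1 h (pos i c)
    rw [mem_prefixClause hb.1 hb.2 hm, mem_prefixClause hb'.1 hb'.2 hm'] at this
    constructor
    · rintro ⟨h1, rfl⟩
      obtain ⟨i', h2, h3⟩ := this.1 ⟨i, h1, rfl⟩
      rw [pos_inj] at h3
      rw [h3.1]
      exact ⟨h2, h3.2⟩
    · rintro ⟨h1, rfl⟩
      obtain ⟨i', h2, h3⟩ := this.2 ⟨i, h1, rfl⟩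
      rw [pos_inj] at h3
      rw [h3.1]
      exact ⟨h2, h3.2⟩
  have hbb : b = b' := by
    -- As `1 ≤ m'`, the second clause contains row 1, or row 2 if `b' = 1`; this row determines the
    -- column.
    have h1 := key 1 b'
    have h2 := key 2 b'
    unfold InRow at h1 h2
    omega
  subst hbb
  refine ⟨rfl, ?_⟩
  -- The first row other than `b` that is missing from `C(b, m)` is `m + 1` or `m + 2`.
  have h1 := key (m + 1) b
  have h2 := key (m + 2) b
  have h3 := key (m' + 1) b
  have h4 := key (m' + 2) b
  unfold InRow at h1 h2 h3 h4
  omega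

/-- The learned clauses are the prefix clauses `C(b, m)` with `S b m`. -/
structure Learned (n : ℕ) (Γ : List (Clause (ℕ × ℕ))) (S : ℕ → ℕ → Prop) : Prop where
  range : ∀ b m, S b m → (1 ≤ b ∧ b ≤ n) ∧ 1 ≤ m ∧ m ≤ n - 1
  mem_iff : ∀ c, c ∈ Γ ↔ ∃ b m, S b m ∧ c = prefixClause n b m

theorem Learned.avail_iff {S : ℕ → ℕ → Prop} (h : Learned n Γ S) {b m : ℕ} :
    Avail n Γ b m ↔ (1 ≤ b ∧ b ≤ n) ∧ m ≤ n - 1 ∧ (m = n - 1 ∨ S b m) := by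
  refine and_congr_right fun hb => and_congr_right fun hm => or_congr_right ?_
  rw [h.mem_iff]
  constructor
  · rintro ⟨b', m', hs, heq⟩
    have := h.range _ _ hs
    obtain ⟨rfl, rfl⟩ := prefixClause_inj hb hm this.1 this.2.1 this.2.2 heq
    exact hs
  · exact fun hs => ⟨b, m, hs, rfl⟩

theorem Learned.allPrefix {S : ℕ → ℕ → Prop} (h : Learned n Γ S) : AllPrefix n Γ := by
  intro c hc
  obtain ⟨b, m, hs, rfl⟩ := (h.mem_iff c).1 hc
  have := h.range b m hs
  exact ⟨b, m, h.avail_iff.2 ⟨this.1, this.2.2, Or.inr hs⟩, rfl⟩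

end

/-! ## The lists of learned clauses -/

/-- The numbers `N - 1, N - 2, …, K`. -/
def down (K N : ℕ) : List ℕ := (List.range' K (N - K)).reverse

theorem mem_down {K N m : ℕ} : m ∈ down K N ↔ K ≤ m ∧ m < N := by
  rw [down, List.mem_reverse, List.mem_range'_1]
  omega

theorem down_eq_append {K N : ℕ} (h : K < N) : down K N = down (K + 1) N ++ [K] := by
  rw [down, down, show N - K = N - (K + 1) + 1 by omega, List.range'_succ, List.reverse_cons]

theorem down_self (N : ℕ) : down N N = [] := by
  simp [down]

/-- The clauses `C(j, n - 2), …, C(j, K)`. -/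
def columnClauses (n j K : ℕ) : List (Clause (ℕ × ℕ)) :=
  (down K (n - 1)).map fun m => prefixClause n j m

/-- The Cascade clauses of the columns from `n - 2` down to `J`. -/
def cascadeFrom (n J : ℕ) : List (Clause (ℕ × ℕ)) :=
  (down J (n - 1)).flatMap fun j => columnClauses n j (j - 1)

/-- The clauses `C(1, n - 4), …, C(1, K)`. -/
def tailFrom (n K : ℕ) : List (Clause (ℕ × ℕ)) :=
  (down K (n - 3)).map fun m => prefixClause n 1 m

section

variable {n : ℕ} {δ : ℝ} {P : State (ℕ × ℕ) → Prop} {J K : ℕ}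

theorem mem_columnClauses {j : ℕ} {c : Clause (ℕ × ℕ)} :
    c ∈ columnClauses n j K ↔ ∃ m, (K ≤ m ∧ m < n - 1) ∧ c = prefixClause n j m := by
  simp only [columnClauses, List.mem_map, mem_down, eq_comm]

theorem mem_tailFrom {c : Clause (ℕ × ℕ)} :
    c ∈ tailFrom n K ↔ ∃ m, (K ≤ m ∧ m < n - 3) ∧ c = prefixClause n 1 m := by
  simp only [tailFrom, List.mem_map, mem_down, eq_comm]

theorem mem_cascadeFrom {c : Clause (ℕ × ℕ)} : c ∈ cascadeFrom n J ↔
    ∃ b m, (J ≤ b ∧ b < n - 1) ∧ (b - 1 ≤ m ∧ m < n - 1) ∧ c = prefixClause n b m := by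
  simp only [cascadeFrom, List.mem_flatMap, mem_down, mem_columnClauses]
  exact ⟨fun ⟨b, h1, m, h2, h3⟩ => ⟨b, m, h1, h2, h3⟩, fun ⟨b, m, h1, h2, h3⟩ => ⟨b, h1, m, h2, h3⟩⟩

theorem mem_headClauses {c : Clause (ℕ × ℕ)} :
    c ∈ headClauses n ↔ c = prefixClause n 1 (n - 2) ∨ c = prefixClause n 1 (n - 3) := by
  simp [headClauses]

theorem columnClauses_eq_append {j : ℕ} (h : K < n - 1) :
    columnClauses n j K = columnClauses n j (K + 1) ++ [prefixClause n j K] := by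
  simp [columnClauses, down_eq_append h]

theorem columnClauses_last (j : ℕ) : columnClauses n j (n - 1) = [] := by
  simp [columnClauses, down_self]

theorem tailFrom_eq_append (h : K < n - 3) :
    tailFrom n K = tailFrom n (K + 1) ++ [prefixClause n 1 K] := by
  simp [tailFrom, down_eq_append h]

theorem tailFrom_last : tailFrom n (n - 3) = [] := by
  simp [tailFrom, down_self]

theorem cascadeFrom_eq_append (h : J < n - 1) :
    cascadeFrom n J = cascadeFrom n (J + 1) ++ columnClauses n J (J - 1) := by
  simp [cascadeFrom, down_eq_append h]

theorem cascadeFrom_last : cascadeFrom n (n - 1) = [] := by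
  simp [cascadeFrom, down_self]

theorem cascadeClauses_eq : cascadeClauses n = cascadeFrom n 2 := by
  rw [cascadeClauses, cascadeFrom, down, show n - 1 - 2 = n - 3 by omega]
  refine List.flatMap_congr fun j hj => ?_
  rw [List.mem_reverse, List.mem_range'_1] at hj
  rw [columnClauses, down, show n - 1 - (j - 1) = n - j by omega]

theorem tailClauses_eq : tailClauses n = tailFrom n 2 := by
  rw [tailClauses, tailFrom, down, show n - 3 - 2 = n - 5 by omega]

/-- The clauses learned when the last one is `C(J, K)`, in the Cascade phase. -/
def cascadeState (n J K : ℕ) : List (Clause (ℕ × ℕ)) :=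
  headClauses n ++ cascadeFrom n (J + 1) ++ columnClauses n J K

/-- The clauses learned when the last one is `C(1, K)`, in the Tail phase. -/
def tailState (n K : ℕ) : List (Clause (ℕ × ℕ)) :=
  headClauses n ++ cascadeFrom n 2 ++ tailFrom n K

theorem learned_nil : Learned n [] (fun _ _ => False) :=
  ⟨fun _ _ h => h.elim, fun c => by simp⟩

theorem learned_singleton (hn : 6 ≤ n) :
    Learned n [prefixClause n 1 (n - 2)] (fun b m => b = 1 ∧ m = n - 2) := by
  refine ⟨fun b m h => by omega, fun c => ?_⟩
  rw [List.mem_singleton]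
  constructor
  · rintro rfl
    exact ⟨1, n - 2, ⟨rfl, rfl⟩, rfl⟩
  · rintro ⟨_, _, ⟨rfl, rfl⟩, rfl⟩
    rfl

/-- The value `K = n - 1` is admitted; it means that column `J` has not been started. -/
theorem learned_cascadeState (hn : 6 ≤ n) (hJ : 2 ≤ J) (hJn : J ≤ n - 2) (hJK : J - 1 ≤ K) :
    Learned n (cascadeState n J K) (fun b m => (b = 1 ∧ n - 3 ≤ m ∧ m ≤ n - 2) ∨
      (J < b ∧ b ≤ n - 2 ∧ b - 1 ≤ m ∧ m ≤ n - 2) ∨ (b = J ∧ K ≤ m ∧ m ≤ n - 2)) := by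
  refine ⟨fun b m h => by omega, fun c => ?_⟩
  rw [cascadeState, List.mem_append, List.mem_append, mem_headClauses, mem_cascadeFrom,
    mem_columnClauses]
  constructor
  · rintro (((rfl | rfl) | ⟨b, m, h1, h2, rfl⟩) | ⟨m, h, rfl⟩)
    · exact ⟨1, n - 2, by omega, rfl⟩
    · exact ⟨1, n - 3, by omega, rfl⟩
    · exact ⟨b, m, by omega, rfl⟩
    · exact ⟨J, m, by omega, rfl⟩
  · rintro ⟨b, m, ⟨rfl, h1, h2⟩ | h | ⟨rfl, h⟩, rfl⟩
    · rcases h2.eq_or_lt with rfl | h2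
      · exact Or.inl (Or.inl (Or.inl rfl))
      · rw [show m = n - 3 by omega]
        exact Or.inl (Or.inl (Or.inr rfl))
    · exact Or.inl (Or.inr ⟨b, m, by omega, by omega, rfl⟩)
    · exact Or.inr ⟨m, by omega, rfl⟩

/-- For `K = n - 3` the Tail is still empty, and `C(1, n-3)` comes from the Head. -/
theorem learned_tailState (hn : 6 ≤ n) (hK : 2 ≤ K) (hKn : K ≤ n - 3) :
    Learned n (tailState n K) (fun b m => (b = 1 ∧ K ≤ m ∧ m ≤ n - 2) ∨
      (2 ≤ b ∧ b ≤ n - 2 ∧ b - 1 ≤ m ∧ m ≤ n - 2)) := by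
  refine ⟨fun b m h => by omega, fun c => ?_⟩
  rw [tailState, List.mem_append, List.mem_append, mem_headClauses, mem_cascadeFrom,
    mem_tailFrom]
  constructor
  · rintro (((rfl | rfl) | ⟨b, m, h1, h2, rfl⟩) | ⟨m, h, rfl⟩)
    · exact ⟨1, n - 2, by omega, rfl⟩
    · exact ⟨1, n - 3, by omega, rfl⟩
    · exact ⟨b, m, by omega, rfl⟩
    · exact ⟨1, m, by omega, rfl⟩
  · rintro ⟨b, m, ⟨rfl, h1, h2⟩ | h, rfl⟩
    · by_cases h3 : m = n - 2
      · subst h3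
        exact Or.inl (Or.inl (Or.inl rfl))
      · by_cases h4 : m = n - 3
        · subst h4
          exact Or.inl (Or.inl (Or.inr rfl))
        · exact Or.inr ⟨m, by omega, rfl⟩
    · exact Or.inl (Or.inr ⟨b, m, by omega, by omega, rfl⟩)

/-- The solver branches on the column of the clauses that have been learned last. -/
theorem branchOrder_of_column (hδ₀ : 0 < δ) (hδ : δ ≤ 1 / 2) {Γ₀ B : List (Clause (ℕ × ℕ))}
    {p m r : ℕ} (hp1 : 1 ≤ p) (hpn : p ≤ n) (hm : m ≤ n - 1) (hΓ : AllPrefix n (Γ₀ ++ B))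
    (hB : ∀ c ∈ B, ∃ m' ≤ n - 1, c = prefixClause n p m') (hmB : prefixClause n p m ∈ B)
    (hr : ∀ a, 1 ≤ a → a ≤ r → a ≠ p → InRow p m a) : BranchOrder n δ (Γ₀ ++ B) p r := by
  obtain ⟨B₁, B₂, rfl⟩ := List.append_of_mem hmB
  rw [← List.append_assoc] at hΓ ⊢
  exact branchOrder_of_append hδ₀ hδ hp1 hpn hm hΓ (fun c hc => hB c (by simp [hc])) hr

/-! ## The run -/

/-- The column is `j = 1`, and `q = 2` because `C(2, 1)` makes `P 1 2` true. The clause `C(K+1, K)`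
to be falsified is the last Cascade clause of column `K + 1`. -/
theorem phase_tailState (hn : 6 ≤ n) (hK : 2 ≤ K) (hKn : K ≤ n - 3) :
    Phase n (tailState n K) 1 K 2 ∧ Closing n (tailState n K) K 2 ∧
      Avail n (tailState n K) 2 1 ∧
      ∀ b m, Avail n (tailState n K) b m → 2 ≤ m ∨ (b = 2 ∧ m = 1) := by
  have hL := learned_tailState hn hK hKn
  refine ⟨⟨hL.allPrefix, le_rfl, by omega, hK, by omega, hL.avail_iff.2 (by omega),
    fun m hm => ?_, fun _ => ⟨by omega, hK, fun m hm => ?_⟩, fun b m hm => ?_⟩,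
    Or.inl ⟨hL.avail_iff.2 (by omega), fun m hm => ?_⟩, hL.avail_iff.2 (by omega),
    fun b m hm => ?_⟩ <;> rw [hL.avail_iff] at hm
  · omega
  · unfold InRow
    omega
  · omega
  · omega
  · omega

/-- The induction goes backwards in time: the state with `C(1, K)` learned is reached from the one
whose last clause is `C(1, K+1)`. -/
theorem ends_tailState (hn : 6 ≤ n) (hδ₀ : 0 < δ) (hδ : δ ≤ 1 / 2)
    (hP : ∀ s : State (ℕ × ℕ), s.learned = tailState n 2 → s.unsat = true → P s)
    (hK : 2 ≤ K) (hKn : K ≤ n - 3) : Ends n δ P (State.restart (tailState n K)) := by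
  induction K, hK using Nat.le_induction with
  | base =>
    obtain ⟨h, hC, hav, hlarge⟩ := phase_tailState hn le_rfl hKn
    exact h.ends_of_unsat hC hav hlarge hP
  | succ K hK ih =>
    have hL := learned_tailState hn (K := K + 1) (by omega) hKn
    obtain ⟨h, hC, hav, hlarge⟩ := phase_tailState hn (K := K + 1) (by omega) hKn
    have hlearn : Ends n δ P (State.restart (tailState n (K + 1) ++
        [prefixClause n 1 (K + 1 - 1)])) := by
      have := ih (by omega)
      rw [tailState, tailFrom_eq_append (by omega), ← List.append_assoc] at this
      exact this
    -- For the first Tail conflict the latest learned clauses are those of column 2, and the solver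
    -- branches there; later it branches on column 1.
    rcases hKn.eq_or_lt with hKn | hKn
    · refine h.ends_of_restart_single hC (by omega) hav hlarge (Or.inl rfl) ?_ hlearn
      have heq : tailState n (K + 1) =
          (headClauses n ++ cascadeFrom n 3) ++ columnClauses n 2 1 := by
        rw [tailState, hKn, tailFrom_last, List.append_nil,
          cascadeFrom_eq_append (by omega), List.append_assoc]
      have hall := hL.allPrefix
      rw [heq] at hall ⊢
      refine branchOrder_of_column hδ₀ hδ (m := n - 2) (by omega) (by omega) (by omega) hall
        (fun c hc => ?_) (mem_columnClauses.2 ⟨n - 2, by omega, rfl⟩) fun a h1 h2 h3 => ?_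
      · obtain ⟨m, hm, rfl⟩ := mem_columnClauses.1 hc
        exact ⟨m, by omega, rfl⟩
      · unfold InRow
        omega
    · refine h.ends_of_restart_single hC (by omega) hav hlarge (Or.inr rfl) ?_ hlearn
      refine branchOrder_of_column hδ₀ hδ (m := K + 1) (by omega) (by omega) (by omega)
        hL.allPrefix (fun c hc => ?_) (mem_tailFrom.2 ⟨K + 1, by omega, rfl⟩) fun a h1 h2 h3 => ?_
      · obtain ⟨m, hm, rfl⟩ := mem_tailFrom.1 hc
        exact ⟨m, by omega, rfl⟩
      · unfold InRow
        omega

/-- One conflict of the Cascade phase other than the first one of a column. -/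
theorem ends_cascadeState_succ (hn : 6 ≤ n) (hδ₀ : 0 < δ) (hδ : δ ≤ 1 / 2) (hJ : 2 ≤ J)
    (hJn : J ≤ n - 2) (hJK : J ≤ K + 1) (hKn : K + 1 ≤ n - 2)
    (hlearn : Ends n δ P (State.restart (cascadeState n J K))) :
    Ends n δ P (State.restart (cascadeState n J (K + 1))) := by
  have hL := learned_cascadeState hn hJ hJn (K := K + 1) (by omega)
  have h : Phase n (cascadeState n J (K + 1)) J (K + 1) 0 := by
    refine ⟨hL.allPrefix, by omega, hJK, by omega, by omega, hL.avail_iff.2 (by omega),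
      fun m hm => ?_, fun h0 => absurd h0 (lt_irrefl 0), fun b m hm => Or.inl ?_⟩ <;>
    · rw [hL.avail_iff] at hm
      omega
  refine h.ends_of_restart ?_ ?_ ?_
  -- For `K + 1 = n - 2` the conflict goes through the last two columns. Otherwise `C(K+2, K+1)` is
  -- the last Cascade clause of column `K + 2`, which lies beyond `J`.
  · rcases hKn.eq_or_lt with hKn | hKn
    · refine Or.inr ⟨rfl, by omega, fun m hm => ?_, fun m hm => ?_⟩ <;>
      · rw [hL.avail_iff] at hm
        omega
    · refine Or.inl ⟨hL.avail_iff.2 (by omega), fun m hm => ?_⟩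
      rw [hL.avail_iff] at hm
      omega
  · refine branchOrder_of_column hδ₀ hδ (m := n - 2) (by omega) (by omega) (by omega)
      hL.allPrefix (fun c hc => ?_) (mem_columnClauses.2 ⟨n - 2, by omega, rfl⟩)
      fun a h1 h2 h3 => ?_
    · obtain ⟨m, hm, rfl⟩ := mem_columnClauses.1 hc
      exact ⟨m, by omega, rfl⟩
    · unfold InRow
      omega
  · rw [cascadeState, columnClauses_eq_append (by omega), ← List.append_assoc] at hlearn
    exact hlearn

/-- The first conflict of the Cascade phase in column `J`. -/
theorem ends_cascadeState_first (hn : 6 ≤ n) (hδ₀ : 0 < δ) (hδ : δ ≤ 1 / 2) (hJ : 2 ≤ J)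
    (hJn : J ≤ n - 2)
    (hlearn : Ends n δ P (State.restart (cascadeState n J (n - 2)))) :
    Ends n δ P (State.restart (cascadeState n J (n - 1))) := by
  have hL := learned_cascadeState hn hJ hJn (K := n - 1) (by omega)
  have hlearn' : Ends n δ P (State.restart (cascadeState n J (n - 1) ++
      [prefixClause n J (n - 1 - 1)])) := by
    rw [cascadeState, columnClauses_eq_append (by omega), show n - 2 + 1 = n - 1 by omega,
      ← List.append_assoc] at hlearn
    exact hlearn
  have hlarge : ∀ b m, Avail n (cascadeState n J (n - 1)) b m → 2 ≤ m := by
    intro b m hm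
    rw [hL.avail_iff] at hm
    omega
  -- The clause to be falsified is the non-minimality clause of column `n`.
  have hC : ∀ q, Closing n (cascadeState n J (n - 1)) (n - 1) q := by
    intro q
    refine Or.inl ⟨hL.avail_iff.2 (by omega), fun m hm => ?_⟩
    rw [hL.avail_iff] at hm
    omega
  have hphase : ∀ q, q ≠ J → q ≤ n - 1 →
      (∀ m, Avail n (cascadeState n J (n - 1)) q m → InRow q m J) →
      Phase n (cascadeState n J (n - 1)) J (n - 1) q := by
    intro q hqJ hqn hrow
    refine ⟨hL.allPrefix, by omega, by omega, by omega, by omega, hL.avail_iff.2 (by omega),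
      fun m hm => ?_, fun _ => ⟨hqJ, hqn, hrow⟩, fun b m hm => Or.inl (hlarge b m hm)⟩
    rw [hL.avail_iff] at hm
    omega
  -- For `J = n - 2` the latest clauses are the Head, so `q = 1` and `C(1, n-3)` forces `P J 1`.
  -- Otherwise `q = J + 1`, and `C(J+1, J)` forces `P J (J+1)`.
  rcases hJn.eq_or_lt with hJn' | hJn'
  · refine (hphase 1 (by omega) (by omega) fun m hm => ?_).ends_of_restart_true (hC 1) (by omega)
      (by omega) (by omega) hJ (by omega) ?_ (m₀ := n - 3) (hL.avail_iff.2 (by omega))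
      (fun m hm => ?_) (fun i => ?_) hlarge hlearn'
    · rw [hL.avail_iff] at hm
      unfold InRow
      omega
    · have heq : cascadeState n J (n - 1) = [] ++ headClauses n := by
        rw [cascadeState, columnClauses_last, show J + 1 = n - 1 by omega, cascadeFrom_last]
        simp
      have hall := hL.allPrefix
      rw [heq] at hall ⊢
      refine branchOrder_of_column hδ₀ hδ (m := n - 2) (by omega) (by omega) (by omega) hall
        (fun c hc => ?_) (mem_headClauses.2 (Or.inl rfl)) fun a h1 h2 h3 => ?_
      · rcases mem_headClauses.1 hc with rfl | rfl
        · exact ⟨_, by omega, rfl⟩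
        · exact ⟨_, by omega, rfl⟩
      · unfold InRow
        omega
    · rw [hL.avail_iff] at hm
      omega
    · unfold InRow
      omega
  · refine (hphase (J + 1) (by omega) (by omega) fun m hm => ?_).ends_of_restart_true
      (hC (J + 1)) (by omega) (by omega) (by omega) hJ (by omega) ?_ (m₀ := J)
      (hL.avail_iff.2 (by omega)) (fun m hm => ?_) (fun i => ?_) hlarge hlearn'
    · rw [hL.avail_iff] at hm
      unfold InRow
      omega
    · have heq : cascadeState n J (n - 1) =
          (headClauses n ++ cascadeFrom n (J + 2)) ++ columnClauses n (J + 1) J := by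
        rw [cascadeState, columnClauses_last, List.append_nil,
          cascadeFrom_eq_append (J := J + 1) (by omega), List.append_assoc, Nat.add_sub_cancel]
      have hall := hL.allPrefix
      rw [heq] at hall ⊢
      refine branchOrder_of_column hδ₀ hδ (m := n - 2) (by omega) (by omega) (by omega) hall
        (fun c hc => ?_) (mem_columnClauses.2 ⟨n - 2, by omega, rfl⟩) fun a h1 h2 h3 => ?_
      · obtain ⟨m, hm, rfl⟩ := mem_columnClauses.1 hc
        exact ⟨m, by omega, rfl⟩
      · unfold InRow
        omega
    · rw [hL.avail_iff] at hm
      omega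
    · unfold InRow
      omega

theorem ends_cascadeState_column (hn : 6 ≤ n) (hδ₀ : 0 < δ) (hδ : δ ≤ 1 / 2) (hJ : 2 ≤ J)
    (hJn : J ≤ n - 2) (hlearn : Ends n δ P (State.restart (cascadeState n J (J - 1)))) :
    Ends n δ P (State.restart (cascadeState n J (n - 1))) := by
  have key : ∀ K, J - 1 ≤ K → K ≤ n - 2 → Ends n δ P (State.restart (cascadeState n J K)) := by
    intro K hK
    induction K, hK using Nat.le_induction with
    | base => exact fun _ => hlearn
    | succ K hK ih =>
      exact fun hKn => ends_cascadeState_succ hn hδ₀ hδ hJ hJn (by omega) hKn (ih (by omega))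
  exact ends_cascadeState_first hn hδ₀ hδ hJ hJn (key (n - 2) (by omega) le_rfl)

theorem ends_headClauses (hn : 6 ≤ n) (hδ₀ : 0 < δ) (hδ : δ ≤ 1 / 2)
    (hlearn : Ends n δ P (State.restart (headClauses n ++ cascadeFrom n 2))) :
    Ends n δ P (State.restart (headClauses n)) := by
  have key : ∀ J, 2 ≤ J → J ≤ n - 1 →
      Ends n δ P (State.restart (headClauses n ++ cascadeFrom n J)) := by
    intro J hJ
    induction J, hJ using Nat.le_induction with
    | base => exact fun _ => hlearn
    | succ J hJ ih =>
      intro hJn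
      have h := ih (by omega)
      rw [cascadeFrom_eq_append (by omega), ← List.append_assoc] at h
      have := ends_cascadeState_column hn hδ₀ hδ hJ (by omega) h
      rwa [cascadeState, columnClauses_last, List.append_nil] at this
  have := key (n - 1) (by omega) le_rfl
  rwa [cascadeFrom_last, List.append_nil] at this

/-- The two Head conflicts are the cases `k = n - 1`, where column `n` is falsified directly, and `k
= n - 2`, where the conflict goes through the last two columns. -/
theorem ends_nil (hn : 6 ≤ n) (hδ₀ : 0 < δ) (hδ : δ ≤ 1 / 2)
    (hlearn : Ends n δ P (State.restart (headClauses n))) :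
    Ends n δ P (State.restart []) := by
  have hL := learned_nil (n := n)
  have h : Phase n [] 1 (n - 1) 0 := by
    refine ⟨hL.allPrefix, le_rfl, by omega, by omega, by omega, hL.avail_iff.2 (by omega),
      fun m hm => ?_, fun h0 => absurd h0 (lt_irrefl 0), fun b m hm => Or.inl ?_⟩ <;>
    · simp only [hL.avail_iff, or_false] at hm
      omega
  refine h.ends_of_restart (Or.inl ⟨hL.avail_iff.2 (by omega), fun m hm => ?_⟩)
    branchOrder_nil ?_
  · simp only [hL.avail_iff, or_false] at hm
    omega
  rw [List.nil_append, show n - 1 - 1 = n - 2 by omega]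
  have hL := learned_singleton hn
  have h : Phase n [prefixClause n 1 (n - 2)] 1 (n - 2) 0 := by
    refine ⟨hL.allPrefix, le_rfl, by omega, by omega, by omega, hL.avail_iff.2 (by omega),
      fun m hm => ?_, fun h0 => absurd h0 (lt_irrefl 0), fun b m hm => Or.inl ?_⟩ <;>
    · rw [hL.avail_iff] at hm
      omega
  refine h.ends_of_restart (Or.inr ⟨rfl, by omega, fun m hm => ?_, fun m hm => ?_⟩) ?_ ?_
  · rw [hL.avail_iff] at hm
    omega
  · rw [hL.avail_iff] at hm
    omega
  · refine branchOrder_of_column (Γ₀ := []) hδ₀ hδ (m := n - 2) le_rfl (by omega) (by omega)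
      hL.allPrefix (fun c hc => ⟨n - 2, by omega, List.mem_singleton.1 hc⟩)
      (List.mem_singleton.2 rfl) fun a h1 h2 h3 => ?_
    unfold InRow
    omega
  · rw [show n - 2 - 1 = n - 3 by omega]
    exact hlearn

theorem ends_restart (hn : 6 ≤ n) (hδ₀ : 0 < δ) (hδ : δ ≤ 1 / 2) :
    Ends n δ (fun s => s.unsat = true ∧
      s.learned = headClauses n ++ cascadeClauses n ++ tailClauses n) (State.restart []) := by
  refine ends_nil hn hδ₀ hδ (ends_headClauses hn hδ₀ hδ ?_)
  have := ends_tailState (P := fun s => s.unsat = true ∧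
      s.learned = headClauses n ++ cascadeClauses n ++ tailClauses n) hn hδ₀ hδ (fun s h1 h2 =>
    ⟨h2, by rw [h1, tailState, cascadeClauses_eq, tailClauses_eq]⟩) (K := n - 3) (by omega) le_rfl
  rwa [tailState, tailFrom_last, List.append_nil] at this

/-! ### Counting the conflicts. -/

theorem length_cascadeFrom (n d : ℕ) : ∀ J, J + d + 1 = n → 1 ≤ J →
    2 * (cascadeFrom n J).length = d * (d + 3) := by
  induction d with
  | zero =>
    intro J hJ _
    rw [show J = n - 1 by omega, cascadeFrom_last]
    simp
  | succ d ih =>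
    rintro J hJ hJ1
    -- Column `J` contributes `n - J = d + 2` clauses, and `d (d + 3) + 2 (d + 2) = (d + 1) (d +
    -- 4)`.
    rw [cascadeFrom_eq_append (by omega), List.length_append, mul_add, ih (J + 1) (by omega)
      (by omega), columnClauses, List.length_map, down, List.length_reverse, List.length_range',
      show n - 1 - (J - 1) = d + 2 by omega]
    ring

theorem length_tailClauses (n : ℕ) : (tailClauses n).length = n - 5 := by
  simp [tailClauses]

end

end OrderingPrinciple

theorem theorem5 (n : ℕ) (hn : 6 ≤ n) (δ : ℝ) (hδ₀ : 0 < δ) (hδ : δ ≤ 1 / 2) :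
    -- the solver always halts
    (¬ ∃ run : ℕ → CDCL.State (ℕ × ℕ), run 0 = CDCL.State.restart [] ∧
      ∀ t, OrderingPrinciple.SolverStep n δ (run t) (run (t + 1))) ∧
    -- and however it halts, it has derived UNSAT after the claimed number of conflicts
    ∀ s : CDCL.State (ℕ × ℕ),
      Relation.ReflTransGen (OrderingPrinciple.SolverStep n δ) (CDCL.State.restart []) s →
      (∀ s', ¬ OrderingPrinciple.SolverStep n δ s s') →
        s.unsat = true ∧
        (s.numConflicts : ℤ) = (n.choose 2 : ℤ) - 3 ∧
        (s.numConflicts : ℚ) = ((n : ℚ) - 3) * ((n : ℚ) + 2) / 2 ∧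
        s.learned = OrderingPrinciple.headClauses n ++ OrderingPrinciple.cascadeClauses n ++
          OrderingPrinciple.tailClauses n ∧
        (OrderingPrinciple.headClauses n).length = 2 ∧
        ((OrderingPrinciple.cascadeClauses n).length : ℚ) = (n : ℚ) * ((n : ℚ) - 3) / 2 ∧
        ((OrderingPrinciple.tailClauses n).length : ℤ) = (n : ℤ) - 5 := by
  have hends := OrderingPrinciple.ends_restart hn hδ₀ hδ
  have hfinal : ∀ s : CDCL.State (ℕ × ℕ), (s.unsat = true ∧ s.learned =
      OrderingPrinciple.headClauses n ++ OrderingPrinciple.cascadeClauses n ++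
        OrderingPrinciple.tailClauses n) → ∀ s', ¬ OrderingPrinciple.SolverStep n δ s s' :=
    fun s hs s' => CDCL.not_step_of_unsat hs.1
  refine ⟨hends.no_infinite_run hfinal, fun s hrun hstuck => ?_⟩
  obtain ⟨hunsat, hlearned⟩ := hends.of_stuck hfinal hrun hstuck
  obtain ⟨d, rfl⟩ : ∃ d, n = d + 3 := ⟨n - 3, by omega⟩
  have hhead : (OrderingPrinciple.headClauses (d + 3)).length = 2 := rfl
  have hcascade := OrderingPrinciple.length_cascadeFrom (d + 3) d 2 (by omega) (by omega)
  rw [← OrderingPrinciple.cascadeClauses_eq] at hcascade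
  have htail := OrderingPrinciple.length_tailClauses (d + 3)
  have hnum : s.numConflicts = 2 + (OrderingPrinciple.cascadeClauses (d + 3)).length + (d - 2) := by
    rw [CDCL.State.numConflicts, hlearned, List.length_append, List.length_append, hhead, htail]
    omega
  have hnum2 : 2 * s.numConflicts = d * (d + 5) := by
    -- Since `6 ≤ n`, the subtraction `d - 2` is not truncated; twice the count is then `4 + d (d +
    -- 3) + 2 (d - 2) = d (d + 5)`.
    obtain ⟨e, rfl⟩ : ∃ e, d = e + 2 := ⟨d - 2, by omega⟩
    rw [hnum, mul_add, mul_add, hcascade, Nat.add_sub_cancel]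
    ring
  have hchoose : 2 * (d + 3).choose 2 = (d + 3) * (d + 2) := by
    rw [Nat.choose_two_right, Nat.mul_div_cancel' (Nat.even_mul_pred_self _).two_dvd]
    rfl
  refine ⟨hunsat, ?_, ?_, hlearned, hhead, ?_, ?_⟩
  · have h1 : (2 : ℤ) * s.numConflicts = d * (d + 5) := by exact_mod_cast hnum2
    have h2 : (2 : ℤ) * ((d + 3).choose 2 : ℕ) = (d + 3) * (d + 2) := by exact_mod_cast hchoose
    linarith
  · have h1 : (2 : ℚ) * s.numConflicts = d * (d + 5) := by exact_mod_cast hnum2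
    push_cast
    linarith
  · have h1 : (2 : ℚ) * (OrderingPrinciple.cascadeClauses (d + 3)).length = d * (d + 3) := by
      exact_mod_cast hcascade
    push_cast
    linarith
  · rw [htail]
    omega
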